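/- Let $\Omega\subset\mathbb{R}^2$ be a bounded Lipschitz domain and let $a=(a_1,a_2)\in L^1(\Omega)$ be a solenoidal vector field, i.e. $\int_\Omega a\cdot\nabla\varphi\,dx=0$ for all $\varphi\in C_0^\infty(\Omega)$. Suppose that $$\lim_{\varepsilon\to 0+}\sqrt{\varepsilon}\,\|a\|_{L^{2-\varepsilon}(\Omega)}=0 .$$ Then for every $f\in W^{-1,2}(\Omega)$, the dual space of $W_0^{1,2}(\Omega)$, the problem $$-\mathrm{div}\,(\nabla u+a u)=f,\qquad u\in W_0^{1,2}(\Omega),$$ has a unique solution, i.e. there is exactly one $u\in W_0^{1,2}(\Omega)$ such that $au\in L^1(\Omega)$ and $$\int_\Omega(\nabla u+a u)\cdot\nabla\varphi\,dx=(f,\varphi)\qquad\text{for all }\varphi\in C_0^\infty(\Omega).$$ -/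

import Mathlib

open MeasureTheory Filter Topology TopologicalSpace
open scoped NNReal ENNReal ContDiff Distributions

noncomputable section

namespace DriftDiffusion

/-- The Euclidean plane `ℝ²`. -/
abbrev Plane : Type := EuclideanSpace ℝ (Fin 2)

/-- A bounded Lipschitz domain in the plane: a bounded, nonempty, connected open set which, near
each of its boundary points and in suitable Cartesian coordinates (given by a linear isometry `e`
of the plane), is the part of the plane strictly above the graph of a Lipschitz function. -/
structure IsBoundedLipschitzDomain (Ω : Opens Plane) : Prop where
  isBounded : Bornology.IsBounded (Ω : Set Plane)
  isConnected : IsConnected (Ω : Set Plane)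
  lipschitz_boundary : ∀ p ∈ frontier (Ω : Set Plane),
    ∃ r : ℝ, 0 < r ∧ ∃ e : Plane ≃ₗᵢ[ℝ] Plane, ∃ K : ℝ≥0, ∃ γ : ℝ → ℝ, LipschitzWith K γ ∧
      ∀ x ∈ Metric.ball p r, x ∈ Ω ↔ γ (e x 0) < e x 1

/-- Lebesgue measure on `Ω`. -/
abbrev volumeOn (Ω : Opens Plane) : Measure Plane := volume.restrict (Ω : Set Plane)

theorem gradient_continuous {φ : Plane → ℝ} (hφ : ContDiff ℝ ∞ φ) : Continuous (gradient φ) :=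
  (InnerProductSpace.toDual ℝ Plane).symm.continuous.comp (hφ.continuous_fderiv (by simp))

theorem gradient_hasCompactSupport {φ : Plane → ℝ} (hφ : HasCompactSupport φ) :
    HasCompactSupport (gradient φ) :=
  (hφ.fderiv (𝕜 := ℝ)).comp_left (g := (InnerProductSpace.toDual ℝ Plane).symm) (map_zero _)

theorem memLp_test {Ω : Opens Plane} (φ : 𝓓(Ω, ℝ)) : MemLp φ 2 (volumeOn Ω) :=
  φ.continuous.memLp_of_hasCompactSupport φ.hasCompactSupport

theorem memLp_gradient_test {Ω : Opens Plane} (φ : 𝓓(Ω, ℝ)) :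
    MemLp (gradient φ) 2 (volumeOn Ω) :=
  (gradient_continuous φ.contDiff).memLp_of_hasCompactSupport
    (gradient_hasCompactSupport φ.hasCompactSupport)

/-- The Hilbert space `L²(Ω) × L²(Ω; ℝ²)` of pairs `(u, g)`, with the norm
`(‖u‖² + ‖g‖²)^{1/2}`. On pairs `(u, ∇u)` this is the norm of `W^{1,2}(Ω)`. -/
abbrev L2Pair (Ω : Opens Plane) : Type :=
  WithLp 2 (Lp ℝ 2 (volumeOn Ω) × Lp Plane 2 (volumeOn Ω))

/-- The map `φ ↦ (φ, ∇φ)` on `C₀^∞(Ω)`. -/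
def testPair (Ω : Opens Plane) : 𝓓(Ω, ℝ) →ₗ[ℝ] L2Pair Ω where
  toFun φ := WithLp.toLp 2 ((memLp_test φ).toLp φ, (memLp_gradient_test φ).toLp (gradient φ))
  map_add' φ ψ := by
    have h : gradient (⇑(φ + ψ)) = gradient φ + gradient ψ := by
      funext x
      have h1 : DifferentiableAt ℝ φ x := (φ.contDiff.differentiable (by simp)) x
      have h2 : DifferentiableAt ℝ ψ x := (ψ.contDiff.differentiable (by simp)) x
      have h3 : fderiv ℝ (⇑(φ + ψ)) x = fderiv ℝ φ x + fderiv ℝ ψ x := fderiv_add h1 h2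
      simp only [gradient, Pi.add_apply, h3, map_add]
    rw [← WithLp.toLp_add, Prod.mk_add_mk, ← MemLp.toLp_add, ← MemLp.toLp_add]
    congr 2
    exact MemLp.toLp_congr _ _ (by rw [h])
  map_smul' c φ := by
    have h : gradient (⇑(c • φ)) = c • gradient φ := by
      funext x
      have h1 : DifferentiableAt ℝ φ x := (φ.contDiff.differentiable (by simp)) x
      have h3 : fderiv ℝ (⇑(c • φ)) x = c • fderiv ℝ φ x := fderiv_const_smul h1 c
      rw [Pi.smul_apply]; simp only [gradient, h3, map_smul]
    simp only [RingHom.id_apply]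
    rw [← WithLp.toLp_smul, Prod.smul_mk, ← MemLp.toLp_const_smul, ← MemLp.toLp_const_smul]
    congr 2
    exact MemLp.toLp_congr _ _ (by rw [h])

/-- The Sobolev space `W₀^{1,2}(Ω)`: the closure of `C₀^∞(Ω)` in the norm of `W^{1,2}(Ω)`.
A function `u` is represented by the pair `(u, ∇u)` of the function and its weak gradient, so that
the space is the closure of the pairs `(φ, ∇φ)`, `φ ∈ C₀^∞(Ω)`, in `L²(Ω) × L²(Ω; ℝ²)`. (For a pair
in this closure the second component is the weak gradient of the first one.) -/
def W012 (Ω : Opens Plane) : Submodule ℝ (L2Pair Ω) :=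
  (LinearMap.range (testPair Ω)).topologicalClosure

/-- An element of `W₀^{1,2}(Ω)` as a function (class) on `Ω`. -/
def valueOf {Ω : Opens Plane} (u : W012 Ω) : Lp ℝ 2 (volumeOn Ω) := (u : L2Pair Ω).fst

/-- The weak gradient of an element of `W₀^{1,2}(Ω)`. -/
def gradOf {Ω : Opens Plane} (u : W012 Ω) : Lp Plane 2 (volumeOn Ω) := (u : L2Pair Ω).snd

/-- A test function as an element of `W₀^{1,2}(Ω)`. -/
def ofTest {Ω : Opens Plane} (φ : 𝓓(Ω, ℝ)) : W012 Ω :=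
  ⟨testPair Ω φ, Submodule.le_topologicalClosure _ ⟨φ, rfl⟩⟩

/-- The space `W^{-1,2}(Ω)`: the dual of `W₀^{1,2}(Ω)`. -/
abbrev WNeg12 (Ω : Opens Plane) : Type := StrongDual ℝ (W012 Ω)

/-- A solenoidal vector field on `Ω`: a field in `L¹(Ω)` with `div a = 0` in the sense of
distributions. -/
structure IsSolenoidal (Ω : Opens Plane) (a : Plane → Plane) : Prop where
  integrable : Integrable a (volumeOn Ω)
  div_eq_zero : ∀ φ : 𝓓(Ω, ℝ), ∫ x in (Ω : Set Plane), inner ℝ (a x) (gradient φ x) = 0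

/-- `u ∈ W₀^{1,2}(Ω)` is a (weak) solution of `-div (∇u + a u) = f`: the product `a u` is
integrable on `Ω`, so that the equation makes sense, and
`∫_Ω (∇u + a u) · ∇φ dx = (f, φ)` for every `φ ∈ C₀^∞(Ω)`. -/
structure IsSolution (Ω : Opens Plane) (a : Plane → Plane) (f : WNeg12 Ω) (u : W012 Ω) :
    Prop where
  integrable : Integrable (fun x => valueOf u x • a x) (volumeOn Ω)
  integral_identity : ∀ φ : 𝓓(Ω, ℝ),
    ∫ x in (Ω : Set Plane), inner ℝ (gradOf u x + valueOf u x • a x) (gradient φ x) =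
      f (ofTest φ)

end DriftDiffusion

end

open DriftDiffusion

namespace DriftDiffusion

/-! The drift `a` need not be square integrable, so the form ∫ (∇u + a u)·∇v is not defined for all
u, v in W₀^{1,2}. It is defined when v is a test function, and since a is solenoidal, ∫ φ a·∇φ = ½ ∫
a·∇(φ²) = 0 for every test function φ. The proof has to get around the fact that the solution itself
is not an admissible test function.

Everything rests on N, the maximal function of |∇u|, cut off outside Ω. It lies in L², and two
pointwise bounds hold off a null set: |u(x) - u(y)| ≤ C |x - y| (N(x) + N(y)), where the cut-off is
allowed because a Lipschitz boundary has exterior discs, and |u(x)| ≤ 8 r N(x) + 2 √(log (D/r)) ‖∇u‖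
for 0 < r ≤ D. Taking r of order 1/N gives |u| ≤ A + B √(log N) where N ≥ 1. Both are collected in
`IsBoundedLipschitzDomain.exists_pointwise_bounds`.

Existence: √(log N) is at most N^ε / √(2ε), so Hölder's inequality with a in L^{2-ε} gives ∫ |a u| ≤
K ‖u‖. For each test function the form is therefore bounded in u. On the diagonal it equals ‖∇φ‖²,
which is coercive by Poincaré's inequality. Lions' projection theorem,
`exists_forall_apply_eq_of_coercive`, then yields a solution.

Uniqueness: let u solve the homogeneous equation. Lipschitz truncation
(`IsBoundedLipschitzDomain.exists_lipschitz_truncation`) provides test functions φ_s with |∇φ_s| ≤ C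
s and ∇φ_s bounded in L². They agree with u up to a small η on {N ≤ s}, and on {N > s} they differ
from it by at most η + A + B √(log N). Since ∫ φ_s a·∇φ_s = 0, ∫ ∇u·∇φ_s = ∫ (φ_s - u) a·∇φ_s, which
is at most C s (η ‖a‖₁ + ∫_{N > s} |a| (A + B √(log N))). If s ∫_{N > s} |a| (A + B √(log N)) stayed
above some c > 0 for all large s, integration against s^{-1-2ε} ds would give c/ε ≲ ε^{-1/2}
‖a‖_{2-ε} (1 + ∫ N²), contradicting √ε ‖a‖_{2-ε} → 0 (`exists_mul_lintegral_superlevel_lt`). So the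
right side vanishes along some s → ∞, while the left side tends to ‖∇u‖² by weak convergence. Hence
∇u = 0, and u = 0 by Poincaré. -/

open Metric Set

/-! ### The Hardy–Littlewood maximal function: weak (1,1) and strong (2,2) bounds -/

/-- The centred Hardy–Littlewood maximal function in the plane, normalised by the square of the
radius instead of the area of the disc. -/
noncomputable def maximalFunction (g : Plane → ℝ≥0∞) (x : Plane) : ℝ≥0∞ :=
  ⨆ (r : ℝ) (_ : 0 < r), (∫⁻ y in closedBall x r, g y) / ENNReal.ofReal (r ^ 2)

theorem setLIntegral_closedBall_le_maximalFunction (g : Plane → ℝ≥0∞) (x : Plane) {r : ℝ}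
    (hr : 0 < r) :
    ∫⁻ y in closedBall x r, g y ≤ ENNReal.ofReal (r ^ 2) * maximalFunction g x := by
  have h : (∫⁻ y in closedBall x r, g y) / ENNReal.ofReal (r ^ 2) ≤ maximalFunction g x :=
    le_iSup₂ (f := fun (r : ℝ) (_ : 0 < r) =>
      (∫⁻ y in closedBall x r, g y) / ENNReal.ofReal (r ^ 2)) r hr
  rw [mul_comm]
  exact (ENNReal.div_le_iff (by simp; positivity) ENNReal.ofReal_ne_top).1 h

theorem lt_maximalFunction_iff {g : Plane → ℝ≥0∞} {x : Plane} {t : ℝ≥0∞} :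
    t < maximalFunction g x ↔
      ∃ r : ℝ, 0 < r ∧ t * ENNReal.ofReal (r ^ 2) < ∫⁻ y in closedBall x r, g y := by
  simp only [maximalFunction, lt_iSup_iff, exists_prop]
  refine exists_congr fun r => and_congr_right fun hr => ?_
  rw [ENNReal.lt_div_iff_mul_lt (Or.inl (by simp; positivity)) (Or.inl ENNReal.ofReal_ne_top)]

theorem maximalFunction_congr {g h : Plane → ℝ≥0∞} (hgh : g =ᵐ[volume] h) :
    maximalFunction g = maximalFunction h := by
  funext x
  simp only [maximalFunction]
  refine iSup_congr fun r => iSup_congr fun _ => ?_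
  rw [lintegral_congr_ae (ae_restrict_of_ae hgh)]

theorem maximalFunction_mono {g h : Plane → ℝ≥0∞} (hgh : g ≤ᵐ[volume] h) (x : Plane) :
    maximalFunction g x ≤ maximalFunction h x := by
  refine iSup₂_mono fun r hr => ?_
  gcongr ?_ / _
  exact lintegral_mono_ae (ae_restrict_of_ae hgh)

theorem maximalFunction_add_le {g : Plane → ℝ≥0∞} (hg : Measurable g) (h : Plane → ℝ≥0∞)
    (x : Plane) :
    maximalFunction (g + h) x ≤ maximalFunction g x + maximalFunction h x := by
  refine iSup₂_le fun r hr => ?_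
  simp only [Pi.add_apply]
  rw [lintegral_add_left hg, ENNReal.add_div]
  exact add_le_add
    (le_iSup₂ (f := fun (r : ℝ) (_ : 0 < r) =>
      (∫⁻ y in closedBall x r, g y) / ENNReal.ofReal (r ^ 2)) r hr)
    (le_iSup₂ (f := fun (r : ℝ) (_ : 0 < r) =>
      (∫⁻ y in closedBall x r, h y) / ENNReal.ofReal (r ^ 2)) r hr)

theorem volume_closedBall_plane (x : Plane) (r : ℝ) (hr : 0 ≤ r) :
    volume (closedBall x r) = ENNReal.ofReal (Real.pi * r ^ 2) := by
  rw [InnerProductSpace.volume_closedBall_of_dim_even (k := 1) (by simp), mul_comm Real.pi,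
    ENNReal.ofReal_mul (by positivity), ENNReal.ofReal_pow hr]
  simp

theorem maximalFunction_const_le (c : ℝ≥0∞) (x : Plane) :
    maximalFunction (fun _ => c) x ≤ c * ENNReal.ofReal Real.pi := by
  refine iSup₂_le fun r hr => ?_
  refine ENNReal.div_le_of_le_mul ?_
  rw [setLIntegral_const, volume_closedBall_plane x r hr.le, mul_assoc,
    ← ENNReal.ofReal_mul Real.pi_pos.le]

/-- The strict inequality at (x, r) leaves room to enlarge r slightly, and the enlarged disc about a
nearby y contains the disc about x. No measurability of `g` is needed. -/
theorem isOpen_lt_maximalFunction (g : Plane → ℝ≥0∞) (t : ℝ≥0∞) :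
    IsOpen {x | t < maximalFunction g x} := by
  by_cases ht : t = ⊤
  · simp [ht]
  rw [Metric.isOpen_iff]
  intro x hx
  obtain ⟨r, hr, hrx⟩ := lt_maximalFunction_iff.1 hx
  have hc : Tendsto (fun s : ℝ => t * ENNReal.ofReal ((r + s) ^ 2)) (𝓝[>] 0)
      (𝓝 (t * ENNReal.ofReal (r ^ 2))) := by
    refine ENNReal.Tendsto.const_mul ?_ (Or.inr ht)
    refine (ENNReal.continuous_ofReal.tendsto _).comp ?_
    have : Continuous fun s : ℝ => (r + s) ^ 2 := by fun_prop
    simpa using (this.tendsto 0).mono_left nhdsWithin_le_nhds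
  obtain ⟨s, hs, hs0⟩ := ((hc.eventually (gt_mem_nhds hrx)).and self_mem_nhdsWithin).exists
  refine ⟨s, hs0, fun y hy => lt_maximalFunction_iff.2 ⟨r + s, by
    have : (0:ℝ) < s := hs0
    positivity, hs.trans_le ?_⟩⟩
  refine lintegral_mono_set (closedBall_subset_closedBall' ?_)
  rw [mem_ball, dist_comm] at hy
  linarith

theorem measurable_maximalFunction (g : Plane → ℝ≥0∞) : Measurable (maximalFunction g) :=
  measurable_of_Ioi fun t => (isOpen_lt_maximalFunction g t).measurableSet

/-- The weak type `(1, 1)` inequality for the maximal function. -/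
theorem mul_volume_lt_maximalFunction_le (g : Plane → ℝ≥0∞) {t : ℝ≥0∞} (ht : t ≠ 0)
    (ht' : t ≠ ⊤) :
    t * volume {x | t < maximalFunction g x} ≤ ENNReal.ofReal (16 * Real.pi) * ∫⁻ y, g y := by
  have hpi := Real.pi_pos
  by_cases hg : ∫⁻ y, g y = ⊤
  · rw [hg, ENNReal.mul_top (by simp; positivity)]; exact le_top
  let T : Set (Plane × ℝ) :=
    {p | 0 < p.2 ∧ t * ENNReal.ofReal (p.2 ^ 2) < ∫⁻ y in closedBall p.1 p.2, g y}
  -- Vitali covering needs bounded radii: every disc in `T` has t r² below the finite total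
  -- integral. The dilation factor 4 (any number above 3 would do) produces the constant π·4² = 16π.
  obtain ⟨u, huT, hdisj, hcov⟩ :=
    Vitali.exists_disjoint_subfamily_covering_enlargement_closedBall T (fun p => p.1)
      (fun p => p.2) (Real.sqrt ((∫⁻ y, g y) / t).toReal) (fun p hp => by
        have h1 : ENNReal.ofReal (p.2 ^ 2) ≤ (∫⁻ y, g y) / t := by
          rw [ENNReal.le_div_iff_mul_le (Or.inl ht) (Or.inl ht'), mul_comm]
          exact hp.2.le.trans (setLIntegral_le_lintegral _ _)
        refine Real.le_sqrt_of_sq_le ?_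
        rwa [← ENNReal.ofReal_le_iff_le_toReal (ENNReal.div_ne_top hg ht)]) 4 (by norm_num)
  have hucount : u.Countable := by
    refine hdisj.countable_of_nonempty_interior fun p hp => ?_
    exact ⟨p.1, ball_subset_interior_closedBall (mem_ball_self (huT hp).1)⟩
  have hsub : {x | t < maximalFunction g x} ⊆ ⋃ p ∈ u, closedBall p.1 (4 * p.2) := by
    intro x hx
    obtain ⟨r, hr, hrx⟩ := lt_maximalFunction_iff.1 hx
    obtain ⟨b, hb, hsb⟩ := hcov (x, r) ⟨hr, hrx⟩
    exact mem_biUnion hb (hsb (mem_closedBall_self hr.le))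
  calc t * volume {x | t < maximalFunction g x}
      ≤ t * ∑' p : u, volume (closedBall p.1.1 (4 * p.1.2)) := by
        gcongr
        exact (measure_mono hsub).trans (measure_biUnion_le _ hucount _)
    _ = ∑' p : u, t * volume (closedBall p.1.1 (4 * p.1.2)) := ENNReal.tsum_mul_left.symm
    _ ≤ ∑' p : u, ENNReal.ofReal (16 * Real.pi) * ∫⁻ y in closedBall p.1.1 p.1.2, g y := by
        refine ENNReal.tsum_le_tsum fun p => ?_
        have hp := huT p.2
        rw [volume_closedBall_plane _ _ (by linarith [hp.1]),
          show Real.pi * (4 * p.1.2) ^ 2 = (16 * Real.pi) * p.1.2 ^ 2 by ring,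
          ENNReal.ofReal_mul (by positivity), mul_left_comm]
        gcongr
        exact hp.2.le
    _ = ENNReal.ofReal (16 * Real.pi) * ∫⁻ y in ⋃ p ∈ u, closedBall p.1 p.2, g y := by
        rw [ENNReal.tsum_mul_left, lintegral_biUnion hucount
          (fun p _ => isClosed_closedBall.measurableSet) hdisj]
    _ ≤ ENNReal.ofReal (16 * Real.pi) * ∫⁻ y, g y :=
        mul_le_mul_right (setLIntegral_le_lintegral _ _) _

/-- Marcinkiewicz splitting of g at height s/(2π): a constant c has maximal function at most cπ, so
the low part contributes at most s/2, and the weak type inequality at level s/2 applies to the high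
part alone. -/
theorem volume_lt_maximalFunction_le {g : Plane → ℝ≥0∞} (hg : Measurable g) {s : ℝ}
    (hs : 0 < s) :
    ENNReal.ofReal s * volume {x | ENNReal.ofReal s < maximalFunction g x} ≤
      ENNReal.ofReal (32 * Real.pi) *
        ∫⁻ y in {y | ENNReal.ofReal s < ENNReal.ofReal (2 * Real.pi) * g y}, g y := by
  have hpi := Real.pi_pos
  set A : Set Plane := {y | ENNReal.ofReal s < ENNReal.ofReal (2 * Real.pi) * g y} with hA
  have hAm : MeasurableSet A := measurableSet_lt measurable_const (hg.const_mul _)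
  have hle : ∀ x, maximalFunction g x ≤
      maximalFunction (A.indicator g) x + ENNReal.ofReal (s / 2) := by
    intro x
    have h1 : g ≤ A.indicator g + fun _ => ENNReal.ofReal (s / (2 * Real.pi)) := by
      intro y
      by_cases hy : y ∈ A
      · simp [hy]
      · have hy' : ENNReal.ofReal (2 * Real.pi) * g y ≤ ENNReal.ofReal s := not_lt.1 hy
        simp only [Pi.add_apply, indicator_of_notMem hy, zero_add]
        rw [ENNReal.ofReal_div_of_pos (by positivity),
          ENNReal.le_div_iff_mul_le (Or.inl (by simp; positivity)) (Or.inl ENNReal.ofReal_ne_top),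
          mul_comm]
        exact hy'
    refine (maximalFunction_mono (Eventually.of_forall h1) x).trans
      ((maximalFunction_add_le (hg.indicator hAm) _ x).trans ?_)
    gcongr
    refine (maximalFunction_const_le _ x).trans_eq ?_
    rw [← ENNReal.ofReal_mul (by positivity)]
    congr 1
    field_simp
  have hsub : {x | ENNReal.ofReal s < maximalFunction g x} ⊆
      {x | ENNReal.ofReal (s / 2) < maximalFunction (A.indicator g) x} := by
    intro x hx
    have h2 : ENNReal.ofReal (s / 2) + ENNReal.ofReal (s / 2) <
        maximalFunction (A.indicator g) x + ENNReal.ofReal (s / 2) := by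
      rw [← ENNReal.ofReal_add (by positivity) (by positivity), add_halves]
      exact lt_of_lt_of_le hx (hle x)
    exact lt_of_add_lt_add_right h2
  have hw := mul_volume_lt_maximalFunction_le (A.indicator g) (t := ENNReal.ofReal (s / 2))
    (by simp; positivity) ENNReal.ofReal_ne_top
  rw [lintegral_indicator hAm] at hw
  calc ENNReal.ofReal s * volume {x | ENNReal.ofReal s < maximalFunction g x}
      = ENNReal.ofReal 2 * (ENNReal.ofReal (s / 2) *
        volume {x | ENNReal.ofReal s < maximalFunction g x}) := by
        rw [← mul_assoc, ← ENNReal.ofReal_mul (by norm_num), mul_div_cancel₀ _ (by norm_num)]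
    _ ≤ ENNReal.ofReal 2 * (ENNReal.ofReal (16 * Real.pi) * ∫⁻ y in A, g y) :=
        mul_le_mul_right ((mul_le_mul_right (measure_mono hsub) _).trans hw) _
    _ = _ := by
        rw [← mul_assoc, ← ENNReal.ofReal_mul (by norm_num)]
        congr 2
        ring

/-- The strong type `(2, 2)` inequality for the maximal function. -/
theorem lintegral_maximalFunction_sq_le {g : Plane → ℝ≥0∞} (hg : Measurable g) :
    ∫⁻ x, maximalFunction g x ^ 2 ≤ ENNReal.ofReal (128 * Real.pi ^ 2) * ∫⁻ x, g x ^ 2 := by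
  have hpi := Real.pi_pos
  have hM := measurable_maximalFunction g
  have hset : MeasurableSet
      {p : Plane × ℝ | ENNReal.ofReal p.2 < ENNReal.ofReal (2 * Real.pi) * g p.1} :=
    measurableSet_lt (by fun_prop) ((hg.comp measurable_fst).const_mul _)
  -- Integrate the refined weak bound over levels and exchange integrals: the levels at which y
  -- counts have length at most 2π g(y), whence 64π·2π = 128π².
  have hmain : ∫⁻ s in Ioi (0 : ℝ), ENNReal.ofReal (2 * s) *
        volume {x | ENNReal.ofReal s < maximalFunction g x} ≤
      ENNReal.ofReal (128 * Real.pi ^ 2) * ∫⁻ x, g x ^ 2 := by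
    calc ∫⁻ s in Ioi (0 : ℝ), ENNReal.ofReal (2 * s) *
          volume {x | ENNReal.ofReal s < maximalFunction g x}
        ≤ ∫⁻ s in Ioi (0 : ℝ), ENNReal.ofReal (64 * Real.pi) *
          ∫⁻ y, {y | ENNReal.ofReal s < ENNReal.ofReal (2 * Real.pi) * g y}.indicator g y := by
          refine setLIntegral_mono' measurableSet_Ioi fun s hs => ?_
          rw [lintegral_indicator (measurableSet_lt measurable_const (hg.const_mul _)),
            ENNReal.ofReal_mul (by norm_num), mul_assoc]
          refine (mul_le_mul_right (volume_lt_maximalFunction_le hg hs) _).trans_eq ?_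
          rw [← mul_assoc, ← ENNReal.ofReal_mul (by norm_num)]
          congr 2
          ring
      _ = ENNReal.ofReal (64 * Real.pi) * ∫⁻ y, ∫⁻ s in Ioi (0 : ℝ),
          {y | ENNReal.ofReal s < ENNReal.ofReal (2 * Real.pi) * g y}.indicator g y := by
          have hmeas : Measurable fun p : ℝ × Plane =>
              {y | ENNReal.ofReal p.1 < ENNReal.ofReal (2 * Real.pi) * g y}.indicator g p.2 := by
            have : Measurable (({p : ℝ × Plane |
                ENNReal.ofReal p.1 < ENNReal.ofReal (2 * Real.pi) * g p.2}).indicator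
                  fun p => g p.2) :=
              (hg.comp measurable_snd).indicator (measurable_swap hset)
            exact this
          rw [lintegral_const_mul _ hmeas.lintegral_prod_right,
            lintegral_lintegral_swap hmeas.aemeasurable]
      _ ≤ ENNReal.ofReal (64 * Real.pi) *
          ∫⁻ y, g y * (ENNReal.ofReal (2 * Real.pi) * g y) := by
          gcongr with y
          calc ∫⁻ s in Ioi (0 : ℝ),
              {y | ENNReal.ofReal s < ENNReal.ofReal (2 * Real.pi) * g y}.indicator g y
              = ∫⁻ s in Ioi (0 : ℝ), {s : ℝ | ENNReal.ofReal s <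
                  ENNReal.ofReal (2 * Real.pi) * g y}.indicator (fun _ => g y) s := rfl
            _ = g y * volume ({s : ℝ | ENNReal.ofReal s <
                  ENNReal.ofReal (2 * Real.pi) * g y} ∩ Ioi 0) := by
                rw [lintegral_indicator_const (measurableSet_lt (by fun_prop) measurable_const),
                  Measure.restrict_apply (measurableSet_lt (by fun_prop) measurable_const)]
            _ ≤ g y * (ENNReal.ofReal (2 * Real.pi) * g y) := by
                gcongr
                set c := ENNReal.ofReal (2 * Real.pi) * g y
                by_cases hc : c = ⊤
                · simp [hc]
                · have : {s : ℝ | ENNReal.ofReal s < c} ∩ Ioi 0 ⊆ Ioo 0 c.toReal := by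
                    rintro s ⟨h1, h2⟩
                    exact ⟨h2, (ENNReal.ofReal_lt_iff_lt_toReal (le_of_lt h2) hc).1 h1⟩
                  refine (measure_mono this).trans ?_
                  rw [Real.volume_Ioo, sub_zero, ENNReal.ofReal_toReal hc]
      _ = _ := by
          have : ∀ y, g y * (ENNReal.ofReal (2 * Real.pi) * g y) =
              ENNReal.ofReal (2 * Real.pi) * g y ^ 2 := fun y => by ring
          simp only [this]
          rw [lintegral_const_mul _ (hg.pow_const 2), ← mul_assoc,
            ← ENNReal.ofReal_mul (by positivity)]
          congr 2
          ring
  -- The layer-cake formula is for real-valued functions, so the maximal function is capped at n and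
  -- the cap removed by monotone convergence.
  have htrunc : ∀ n : ℕ, ∫⁻ x, (min (maximalFunction g x) n) ^ 2 ≤
      ENNReal.ofReal (128 * Real.pi ^ 2) * ∫⁻ x, g x ^ 2 := by
    intro n
    refine le_trans ?_ hmain
    have hfin : ∀ x, min (maximalFunction g x) n ≠ ⊤ := fun x =>
      ((min_le_right _ _).trans_lt (ENNReal.natCast_lt_top n)).ne
    have hlc := lintegral_comp_eq_lintegral_meas_lt_mul (volume : Measure Plane)
      (f := fun x => (min (maximalFunction g x) n).toReal) (g := fun s => 2 * s)
      (Eventually.of_forall fun x => ENNReal.toReal_nonneg)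
      (hM.min measurable_const).ennreal_toReal.aemeasurable
      (fun t _ => (by fun_prop : Continuous fun s : ℝ => 2 * s).intervalIntegrable _ _)
      (by
        filter_upwards [ae_restrict_mem measurableSet_Ioi] with t ht
        have : (0 : ℝ) < t := ht
        positivity)
    have hl : ∀ x, ENNReal.ofReal (∫ t in (0 : ℝ)..(min (maximalFunction g x) n).toReal, 2 * t) =
        (min (maximalFunction g x) n) ^ 2 := by
      intro x
      rw [intervalIntegral.integral_const_mul, integral_id]
      rw [show 2 * (((min (maximalFunction g x) n).toReal ^ 2 - 0 ^ 2) / 2) =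
        (min (maximalFunction g x) n).toReal ^ 2 by ring, ENNReal.ofReal_pow ENNReal.toReal_nonneg,
        ENNReal.ofReal_toReal (hfin x)]
    simp only [hl] at hlc
    rw [hlc]
    refine setLIntegral_mono' measurableSet_Ioi fun s hs => ?_
    rw [mul_comm]
    gcongr with x
    intro hx
    exact ((ENNReal.ofReal_lt_iff_lt_toReal (le_of_lt hs) (hfin x)).2 hx).trans_le (min_le_left _ _)
  have hsup : ∀ x, maximalFunction g x ^ 2 = ⨆ n : ℕ, (min (maximalFunction g x) n) ^ 2 := by
    intro x
    refine le_antisymm ?_ (iSup_le fun n => by gcongr; exact min_le_left _ _)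
    have h1 : Tendsto (fun n : ℕ => (min (maximalFunction g x) n) ^ 2) atTop
        (𝓝 ((min (maximalFunction g x) ⊤) ^ 2)) :=
      (ENNReal.continuous_pow 2).continuousAt.tendsto.comp
        (tendsto_const_nhds.min ENNReal.tendsto_nat_nhds_top)
    rw [min_top_right] at h1
    exact le_of_tendsto' h1 fun n => le_iSup (fun n : ℕ => (min (maximalFunction g x) n) ^ 2) n
  simp only [hsup]
  rw [lintegral_iSup (fun n => (hM.min measurable_const).pow_const 2)]
  · exact iSup_le htrunc
  · intro n m hnm x
    dsimp only
    gcongr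

/-! ### Mean oscillation and two-point bounds for smooth functions -/

theorem lintegral_comp_add_smul {F : Plane → ℝ≥0∞} (hF : Measurable F) (x : Plane) {t : ℝ}
    (ht : 0 < t) :
    ∫⁻ z, F (x + t • z) = ENNReal.ofReal ((t ^ 2)⁻¹) * ∫⁻ y, F y := by
  have h1 : ∫⁻ z, F (x + t • z) = ∫⁻ w, F (x + w) ∂(Measure.map (t • ·) volume) :=
    (lintegral_map (hF.comp (measurable_const_add x)) (measurable_const_smul t)).symm
  rw [h1, Measure.map_addHaar_smul _ ht.ne', lintegral_smul_measure, lintegral_add_left_eq_self,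
    smul_eq_mul, abs_of_pos (by positivity)]
  simp

theorem setLIntegral_comp_add_smul {F : Plane → ℝ≥0∞} (hF : Measurable F) (x : Plane) {r t : ℝ}
    (ht : 0 < t) :
    ∫⁻ z in closedBall 0 r, F (x + t • z) =
      ENNReal.ofReal ((t ^ 2)⁻¹) * ∫⁻ y in closedBall x (t * r), F y := by
  rw [← lintegral_indicator isClosed_closedBall.measurableSet,
    ← lintegral_indicator isClosed_closedBall.measurableSet,
    ← lintegral_comp_add_smul (hF.indicator isClosed_closedBall.measurableSet) x ht]
  refine lintegral_congr fun z => ?_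
  have : x + t • z ∈ closedBall x (t * r) ↔ z ∈ closedBall 0 r := by
    rw [mem_closedBall, mem_closedBall, dist_eq_norm, add_sub_cancel_left, norm_smul,
      Real.norm_of_nonneg ht.le, dist_zero_right]
    exact mul_le_mul_iff_right₀ ht
  simp only [indicator]
  congr 1
  exact propext this.symm

theorem norm_gradient (φ : Plane → ℝ) (x : Plane) : ‖gradient φ x‖ = ‖fderiv ℝ φ x‖ := by
  simp [gradient]

theorem measurable_enorm_gradient {φ : Plane → ℝ} (hφ : ContDiff ℝ ∞ φ) :
    Measurable fun x => ‖gradient φ x‖ₑ :=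
  (gradient_continuous hφ).measurable.enorm

theorem enorm_sub_le_lintegral_gradient {φ : Plane → ℝ} (hφ : ContDiff ℝ ∞ φ) (x z : Plane)
    {a b : ℝ} (hab : a ≤ b) :
    ‖φ (x + a • z) - φ (x + b • z)‖ₑ ≤
      ∫⁻ t in Ioc a b, ‖gradient φ (x + t • z)‖ₑ * ‖z‖ₑ := by
  have hd : ∀ t : ℝ, HasDerivAt (fun t : ℝ => φ (x + t • z)) (fderiv ℝ φ (x + t • z) z) t := by
    intro t
    have h1 : HasDerivAt (fun t : ℝ => x + t • z) z t := by
      simpa using ((hasDerivAt_id t).smul_const z).const_add x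
    exact ((hφ.differentiable (by simp)) _).hasFDerivAt.comp_hasDerivAt t h1
  have hc : Continuous fun t : ℝ => fderiv ℝ φ (x + t • z) z :=
    ((hφ.continuous_fderiv (by simp)).comp (by fun_prop)).clm_apply continuous_const
  have h2 := intervalIntegral.integral_eq_sub_of_hasDerivAt (fun t _ => hd t)
    (hc.intervalIntegrable a b)
  rw [← enorm_neg, neg_sub, ← h2, intervalIntegral.integral_of_le hab]
  refine (enorm_integral_le_lintegral_enorm _).trans (lintegral_mono fun t => ?_)
  dsimp only
  rw [← ofReal_norm, ← ofReal_norm, ← ofReal_norm, ← ENNReal.ofReal_mul (norm_nonneg _),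
    norm_gradient]
  exact ENNReal.ofReal_le_ofReal ((fderiv ℝ φ (x + t • z)).le_opNorm z)

/-- The mean oscillation of a smooth function around a point is controlled by the maximal function
of its gradient. -/
theorem setLIntegral_enorm_sub_le {φ : Plane → ℝ} (hφ : ContDiff ℝ ∞ φ) (x : Plane) {r : ℝ}
    (hr : 0 < r) :
    ∫⁻ y in closedBall x r, ‖φ x - φ y‖ₑ ≤
      ENNReal.ofReal (r ^ 3) * maximalFunction (fun y => ‖gradient φ y‖ₑ) x := by
  have hg := measurable_enorm_gradient hφ
  have hφm : Measurable φ := hφ.continuous.measurable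
  have h1 : ∫⁻ y in closedBall x r, ‖φ x - φ y‖ₑ =
      ∫⁻ z in closedBall 0 r, ‖φ (x + (0 : ℝ) • z) - φ (x + (1 : ℝ) • z)‖ₑ := by
    have := setLIntegral_comp_add_smul (F := fun y => ‖φ x - φ y‖ₑ) (by fun_prop) x (r := r)
      (t := 1) one_pos
    simpa using this.symm
  have hmeas : Measurable fun p : Plane × ℝ => ‖gradient φ (x + p.2 • p.1)‖ₑ :=
    hg.comp (by fun_prop)
  rw [h1]
  calc ∫⁻ z in closedBall 0 r, ‖φ (x + (0 : ℝ) • z) - φ (x + (1 : ℝ) • z)‖ₑ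
      ≤ ∫⁻ z in closedBall 0 r, ∫⁻ t in Ioc (0 : ℝ) 1,
          ‖gradient φ (x + t • z)‖ₑ * ENNReal.ofReal r := by
        refine setLIntegral_mono' isClosed_closedBall.measurableSet fun z hz => ?_
        refine (enorm_sub_le_lintegral_gradient hφ x z zero_le_one).trans
          (lintegral_mono fun t => ?_)
        dsimp only
        gcongr
        rw [← ofReal_norm]
        exact ENNReal.ofReal_le_ofReal (by simpa using hz)
    _ = ∫⁻ t in Ioc (0 : ℝ) 1, ∫⁻ z in closedBall 0 r,
          ‖gradient φ (x + t • z)‖ₑ * ENNReal.ofReal r :=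
        lintegral_lintegral_swap (hmeas.mul_const _).aemeasurable
    _ ≤ ∫⁻ t in Ioc (0 : ℝ) 1, ENNReal.ofReal (r ^ 3) *
          maximalFunction (fun y => ‖gradient φ y‖ₑ) x := by
        -- Rescaling costs t⁻² while the disc of radius t r contributes (t r)², so the bound does
        -- not depend on t.
        refine setLIntegral_mono' measurableSet_Ioc fun t ht => ?_
        have ht0 : 0 < t := ht.1
        rw [lintegral_mul_const _ (by exact hg.comp (by fun_prop)),
          setLIntegral_comp_add_smul hg x ht0]
        calc _ ≤ ENNReal.ofReal ((t ^ 2)⁻¹) * (ENNReal.ofReal ((t * r) ^ 2) *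
              maximalFunction (fun y => ‖gradient φ y‖ₑ) x) * ENNReal.ofReal r := by
              gcongr
              exact setLIntegral_closedBall_le_maximalFunction _ x (by positivity)
          _ = ENNReal.ofReal ((t ^ 2)⁻¹) * ENNReal.ofReal ((t * r) ^ 2) * ENNReal.ofReal r *
              maximalFunction (fun y => ‖gradient φ y‖ₑ) x := by ring
          _ = _ := by
              rw [← ENNReal.ofReal_mul (by positivity), ← ENNReal.ofReal_mul (by positivity)]
              congr 2
              field_simp
    _ = _ := by simp

/-- Average the triangle inequality through φ(z) over the disc with diameter [x, y]. It lies in the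
discs of radius d = |x - y| about both points and has area πd²/4, so the constant is 4/π ≤ 2. -/
theorem edist_le_maximalFunction_add {φ : Plane → ℝ} (hφ : ContDiff ℝ ∞ φ) (x y : Plane) :
    edist (φ x) (φ y) ≤ 2 * edist x y * (maximalFunction (fun y => ‖gradient φ y‖ₑ) x +
      maximalFunction (fun y => ‖gradient φ y‖ₑ) y) := by
  rcases eq_or_ne x y with rfl | hxy
  · simp
  set M := maximalFunction (fun y => ‖gradient φ y‖ₑ)
  set d := dist x y with hd
  have hd0 : 0 < d := dist_pos.2 hxy
  have hφm : Measurable φ := hφ.continuous.measurable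
  have hpi := Real.pi_gt_three
  set B := closedBall (midpoint ℝ x y) (d / 2)
  have hBx : B ⊆ closedBall x d := closedBall_subset_closedBall' (by
    rw [dist_midpoint_left, Real.norm_of_nonneg (by norm_num)]; linarith)
  have hBy : B ⊆ closedBall y d := closedBall_subset_closedBall' (by
    rw [dist_midpoint_right, Real.norm_of_nonneg (by norm_num)]; linarith)
  have h1 : edist (φ x) (φ y) * ENNReal.ofReal (Real.pi * (d / 2) ^ 2) ≤
      ENNReal.ofReal (d ^ 3) * (M x + M y) := by
    calc edist (φ x) (φ y) * ENNReal.ofReal (Real.pi * (d / 2) ^ 2)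
        = ∫⁻ z in B, edist (φ x) (φ y) := by
          rw [setLIntegral_const, volume_closedBall_plane _ _ (by positivity)]
      _ ≤ ∫⁻ z in B, (‖φ x - φ z‖ₑ + ‖φ y - φ z‖ₑ) := by
          refine lintegral_mono fun z => ?_
          rw [← edist_eq_enorm_sub, ← edist_eq_enorm_sub, edist_comm (φ y)]
          exact edist_triangle _ _ _
      _ = (∫⁻ z in B, ‖φ x - φ z‖ₑ) + ∫⁻ z in B, ‖φ y - φ z‖ₑ := lintegral_add_left (by fun_prop) _
      _ ≤ (∫⁻ z in closedBall x d, ‖φ x - φ z‖ₑ) + ∫⁻ z in closedBall y d, ‖φ y - φ z‖ₑ :=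
          add_le_add (lintegral_mono_set hBx) (lintegral_mono_set hBy)
      _ ≤ _ := by
          rw [mul_add]
          exact add_le_add (setLIntegral_enorm_sub_le hφ x hd0) (setLIntegral_enorm_sub_le hφ y hd0)
  have hne : ENNReal.ofReal (Real.pi * (d / 2) ^ 2) ≠ 0 := by simp; positivity
  rw [← ENNReal.mul_le_mul_iff_left hne ENNReal.ofReal_ne_top]
  refine h1.trans ?_
  rw [edist_dist, ← hd]
  calc ENNReal.ofReal (d ^ 3) * (M x + M y)
      ≤ ENNReal.ofReal (2 * d * (Real.pi * (d / 2) ^ 2)) * (M x + M y) := by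
        gcongr
        have : 0 < d ^ 3 := by positivity
        nlinarith
    _ = _ := by
        rw [ENNReal.ofReal_mul (by positivity), ENNReal.ofReal_mul (by norm_num)]
        simp
        ring

/-- A zero disc of size comparable to its distance from x lets φ(x) be read as an average of φ(x) -
φ(z). Only the maximal function at x enters, which later permits cutting it off outside Ω. -/
theorem enorm_le_maximalFunction_of_eqOn_zero {φ : Plane → ℝ} (hφ : ContDiff ℝ ∞ φ) {x c : Plane}
    {κ t : ℝ} (hκ : 0 < κ) (ht : 0 < t) (hsub : closedBall c (κ * t) ⊆ closedBall x (2 * t))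
    (hzero : ∀ y ∈ closedBall c (κ * t), φ y = 0) :
    ‖φ x‖ₑ ≤ ENNReal.ofReal (4 / κ ^ 2 * t) * maximalFunction (fun y => ‖gradient φ y‖ₑ) x := by
  set M := maximalFunction (fun y => ‖gradient φ y‖ₑ)
  have hpi := Real.pi_gt_three
  have h1 : ‖φ x‖ₑ * ENNReal.ofReal (Real.pi * (κ * t) ^ 2) ≤
      ENNReal.ofReal ((2 * t) ^ 3) * M x := by
    calc ‖φ x‖ₑ * ENNReal.ofReal (Real.pi * (κ * t) ^ 2)
        = ∫⁻ z in closedBall c (κ * t), ‖φ x‖ₑ := by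
          rw [setLIntegral_const, volume_closedBall_plane _ _ (by positivity)]
      _ = ∫⁻ z in closedBall c (κ * t), ‖φ x - φ z‖ₑ :=
          setLIntegral_congr_fun isClosed_closedBall.measurableSet fun z hz => by
            simp [hzero z hz]
      _ ≤ ∫⁻ z in closedBall x (2 * t), ‖φ x - φ z‖ₑ := lintegral_mono_set hsub
      _ ≤ _ := setLIntegral_enorm_sub_le hφ x (by positivity)
  have hne : ENNReal.ofReal (Real.pi * (κ * t) ^ 2) ≠ 0 := by simp; positivity
  rw [← ENNReal.mul_le_mul_iff_left hne ENNReal.ofReal_ne_top]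
  refine h1.trans ?_
  calc ENNReal.ofReal ((2 * t) ^ 3) * M x
      ≤ ENNReal.ofReal (4 / κ ^ 2 * t * (Real.pi * (κ * t) ^ 2)) * M x := by
        gcongr
        have : 4 / κ ^ 2 * t * (Real.pi * (κ * t) ^ 2) = 4 * Real.pi * t ^ 3 := by field_simp
        rw [this]
        have : 0 < t ^ 3 := by positivity
        nlinarith
    _ = _ := by
        rw [ENNReal.ofReal_mul (by positivity)]
        ring

/-! ### The logarithmic pointwise bound, by averaging over annuli -/

theorem lintegral_Ioc_inv {a b : ℝ} (ha : 0 < a) (hab : a ≤ b) :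
    ∫⁻ t in Ioc a b, ENNReal.ofReal t⁻¹ = ENNReal.ofReal (Real.log (b / a)) := by
  rw [← integral_inv_of_pos ha (ha.trans_le hab), intervalIntegral.integral_of_le hab,
    ofReal_integral_eq_lintegral_ofReal]
  · refine (intervalIntegrable_iff_integrableOn_Ioc_of_le hab).1 ?_
    exact intervalIntegral.intervalIntegrable_inv (fun t ht => by
      rw [uIcc_of_le hab] at ht
      exact (ha.trans_le ht.1).ne') continuousOn_id
  · filter_upwards [ae_restrict_mem measurableSet_Ioc] with t ht
    exact inv_nonneg.2 (ha.trans ht.1).le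

/-- The annulus of the points at distance between `1` and `2` from the origin. -/
def annulus : Set Plane := closedBall 0 2 \ closedBall 0 1

theorem measurableSet_annulus : MeasurableSet annulus :=
  isClosed_closedBall.measurableSet.diff isClosed_closedBall.measurableSet

theorem mem_annulus {z : Plane} : z ∈ annulus ↔ 1 < ‖z‖ ∧ ‖z‖ ≤ 2 := by
  simp [annulus, and_comm]

theorem volume_annulus : volume annulus = ENNReal.ofReal (3 * Real.pi) := by
  have hpi := Real.pi_pos
  rw [annulus, measure_sdiff (closedBall_subset_closedBall (by norm_num))
    isClosed_closedBall.measurableSet.nullMeasurableSet (by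
      rw [volume_closedBall_plane _ _ zero_le_one]; exact ENNReal.ofReal_ne_top),
    volume_closedBall_plane _ _ zero_le_one, volume_closedBall_plane _ _ zero_le_two,
    ← ENNReal.ofReal_sub _ (by positivity)]
  congr 1
  ring

/-- Under y = x + t z the weight t becomes t/t² = 1/t. A given y at distance d from x is met only
for t in [d/2, d], where 1/t ≤ 2/d, so its total weight is at most 1. -/
theorem lintegral_annulus_sq_mul_le {g : Plane → ℝ≥0∞} (hg : Measurable g) (x : Plane)
    {a b : ℝ} (ha : 0 < a) :
    ∫⁻ t in Ioc a b, ∫⁻ z in annulus, g (x + t • z) ^ 2 * ENNReal.ofReal t ≤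
      ∫⁻ y, g y ^ 2 := by
  have hA := measurableSet_annulus
  have hset : MeasurableSet {p : ℝ × Plane | p.1⁻¹ • (p.2 - x) ∈ annulus} :=
    hA.preimage (by fun_prop)
  have hm : Measurable fun p : ℝ × Plane => ENNReal.ofReal p.1⁻¹ *
      ({p : ℝ × Plane | p.1⁻¹ • (p.2 - x) ∈ annulus}.indicator (fun p => g p.2 ^ 2) p) :=
    Measurable.mul (by fun_prop) (((hg.comp measurable_snd).pow_const 2).indicator hset)
  calc ∫⁻ t in Ioc a b, ∫⁻ z in annulus, g (x + t • z) ^ 2 * ENNReal.ofReal t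
      = ∫⁻ t in Ioc a b, ∫⁻ y, ENNReal.ofReal t⁻¹ *
          ({p : ℝ × Plane | p.1⁻¹ • (p.2 - x) ∈ annulus}.indicator
            (fun p => g p.2 ^ 2) (t, y)) := by
        refine setLIntegral_congr_fun measurableSet_Ioc fun t ht => ?_
        have ht0 : 0 < t := ha.trans ht.1
        have hm1 : Measurable fun y => {p : ℝ × Plane | p.1⁻¹ • (p.2 - x) ∈ annulus}.indicator
            (fun p => g p.2 ^ 2) (t, y) :=
          (((hg.comp measurable_snd).pow_const 2).indicator hset).comp measurable_prodMk_left
        have h1 := lintegral_comp_add_smul hm1 x ht0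
        rw [lintegral_mul_const _ (by fun_prop : Measurable fun z => g (x + t • z) ^ 2),
          ← lintegral_indicator hA,
          lintegral_const_mul _ hm1]
        have h2 : ∀ z, annulus.indicator (fun z => g (x + t • z) ^ 2) z =
            ({p : ℝ × Plane | p.1⁻¹ • (p.2 - x) ∈ annulus}.indicator
            (fun p => g p.2 ^ 2) (t, x + t • z)) := by
          intro z
          have h3 : (t, x + t • z) ∈ {p : ℝ × Plane | p.1⁻¹ • (p.2 - x) ∈ annulus} ↔
              z ∈ annulus := by
            change t⁻¹ • (x + t • z - x) ∈ annulus ↔ _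
            rw [add_sub_cancel_left, inv_smul_smul₀ ht0.ne']
          by_cases hz : z ∈ annulus
          · rw [indicator_of_mem hz, indicator_of_mem (h3.2 hz)]
          · rw [indicator_of_notMem hz, indicator_of_notMem (mt h3.1 hz)]
        simp only [h2]
        rw [h1, mul_right_comm, ← ENNReal.ofReal_mul (by positivity)]
        congr 2
        field_simp
    _ = ∫⁻ y, ∫⁻ t in Ioc a b, ENNReal.ofReal t⁻¹ *
          ({p : ℝ × Plane | p.1⁻¹ • (p.2 - x) ∈ annulus}.indicator
            (fun p => g p.2 ^ 2) (t, y)) :=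
        lintegral_lintegral_swap hm.aemeasurable
    _ ≤ ∫⁻ y, g y ^ 2 := by
        refine lintegral_mono fun y => ?_
        set d := ‖y - x‖ with hd
        have h3 : ∀ t ∈ Ioc a b, ENNReal.ofReal t⁻¹ *
          ({p : ℝ × Plane | p.1⁻¹ • (p.2 - x) ∈ annulus}.indicator
            (fun p => g p.2 ^ 2) (t, y)) ≤
            (Icc (d / 2) d).indicator (fun _ => ENNReal.ofReal (2 / d) * g y ^ 2) t := by
          intro t ht
          have ht0 : 0 < t := ha.trans ht.1
          by_cases hy : t⁻¹ • (y - x) ∈ annulus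
          · have h4 := mem_annulus.1 hy
            rw [norm_smul, norm_inv, Real.norm_of_nonneg ht0.le, ← hd, ← div_eq_inv_mul,
              one_lt_div ht0, div_le_iff₀ ht0] at h4
            have h5 : t ∈ Icc (d / 2) d := ⟨by linarith, h4.1.le⟩
            rw [indicator_of_mem h5, indicator_of_mem (by exact hy)]
            gcongr
            rw [inv_le_comm₀ ht0 (by have := ht0.trans h4.1; positivity), inv_div]
            exact h5.1
          · rw [indicator_of_notMem (by exact hy), mul_zero]
            exact zero_le
        refine (setLIntegral_mono' measurableSet_Ioc h3).trans ?_
        refine (setLIntegral_le_lintegral _ _).trans ?_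
        rw [lintegral_indicator measurableSet_Icc, setLIntegral_const, Real.volume_Icc,
          mul_right_comm, ← ENNReal.ofReal_mul (by positivity)]
        refine mul_le_of_le_one_left zero_le ?_
        rw [← ENNReal.ofReal_one]
        refine ENNReal.ofReal_le_ofReal ?_
        rcases (norm_nonneg (y - x)).eq_or_lt' with h | h
        · rw [← hd] at h; simp [h]
        · rw [← hd] at h
          apply le_of_eq
          field_simp
          ring

/-- Cauchy–Schwarz in (t, z) with weights √t and 1/√t: the first factor is the previous lemma, the
second is ∬ dt/t over the annulus of area 3π. This is the source of the square root of the
logarithm. -/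
theorem lintegral_annulus_enorm_sub_le {φ : Plane → ℝ} (hφ : ContDiff ℝ ∞ φ) (x : Plane)
    {a b : ℝ} (ha : 0 < a) (hab : a ≤ b) :
    ∫⁻ z in annulus, ‖φ (x + a • z) - φ (x + b • z)‖ₑ ≤
      2 * ((∫⁻ y, ‖gradient φ y‖ₑ ^ 2) ^ (1 / 2 : ℝ) *
        ENNReal.ofReal (3 * Real.pi * Real.log (b / a)) ^ (1 / 2 : ℝ)) := by
  have hg := measurable_enorm_gradient hφ
  have hpi := Real.pi_pos
  have hgm : Measurable fun p : ℝ × Plane => ‖gradient φ (x + p.1 • p.2)‖ₑ :=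
    hg.comp (by fun_prop)
  set ν : Measure (ℝ × Plane) := (volume.restrict (Ioc a b)).prod (volume.restrict annulus)
  have hf : Measurable fun p : ℝ × Plane =>
      ‖gradient φ (x + p.1 • p.2)‖ₑ * ENNReal.ofReal (Real.sqrt p.1) :=
    hgm.mul (by fun_prop)
  have hf' : Measurable fun p : ℝ × Plane => ENNReal.ofReal (Real.sqrt p.1)⁻¹ := by fun_prop
  calc ∫⁻ z in annulus, ‖φ (x + a • z) - φ (x + b • z)‖ₑ
      ≤ ∫⁻ z in annulus, ∫⁻ t in Ioc a b, ‖gradient φ (x + t • z)‖ₑ * 2 := by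
        refine setLIntegral_mono' measurableSet_annulus fun z hz => ?_
        refine (enorm_sub_le_lintegral_gradient hφ x z hab).trans (lintegral_mono fun t => ?_)
        dsimp only
        gcongr
        rw [← ofReal_norm]
        exact (ENNReal.ofReal_le_ofReal (mem_annulus.1 hz).2).trans_eq (by simp)
    _ = ∫⁻ t in Ioc a b, ∫⁻ z in annulus, ‖gradient φ (x + t • z)‖ₑ * 2 :=
        (lintegral_lintegral_swap (hgm.mul_const 2).aemeasurable).symm
    _ = 2 * ∫⁻ p, ‖gradient φ (x + p.1 • p.2)‖ₑ ∂ν := by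
        rw [← lintegral_const_mul _ hgm, lintegral_prod _ (hgm.const_mul 2).aemeasurable]
        simp only [mul_comm]
    _ = 2 * ∫⁻ p, ((fun p : ℝ × Plane => ‖gradient φ (x + p.1 • p.2)‖ₑ *
          ENNReal.ofReal (Real.sqrt p.1)) *
          fun p : ℝ × Plane => ENNReal.ofReal (Real.sqrt p.1)⁻¹) p ∂ν := by
        congr 1
        have hpos : ∀ᵐ p ∂ν, a < p.1 := by
          have : ∀ᵐ t ∂(volume.restrict (Ioc a b)), a < t := by
            filter_upwards [ae_restrict_mem measurableSet_Ioc] with t ht using ht.1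
          exact Measure.quasiMeasurePreserving_fst.ae this
        refine lintegral_congr_ae ?_
        filter_upwards [hpos] with p hp
        have h0 : 0 < Real.sqrt p.1 := Real.sqrt_pos.2 (ha.trans hp)
        rw [Pi.mul_apply, mul_assoc, ← ENNReal.ofReal_mul h0.le, mul_inv_cancel₀ h0.ne']
        simp
    _ ≤ 2 * ((∫⁻ p, (‖gradient φ (x + p.1 • p.2)‖ₑ *
          ENNReal.ofReal (Real.sqrt p.1)) ^ (2 : ℝ) ∂ν) ^ (1 / 2 : ℝ) *
          (∫⁻ p, (ENNReal.ofReal (Real.sqrt p.1)⁻¹) ^ (2 : ℝ) ∂ν) ^ (1 / 2 : ℝ)) := by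
        gcongr
        exact ENNReal.lintegral_mul_le_Lp_mul_Lq ν Real.HolderConjugate.two_two
          hf.aemeasurable hf'.aemeasurable
    _ ≤ _ := by
        gcongr
        · rw [lintegral_prod _ (hf.pow_const 2).aemeasurable]
          refine le_trans (le_of_eq ?_) (lintegral_annulus_sq_mul_le hg x ha (b := b))
          refine setLIntegral_congr_fun measurableSet_Ioc fun t ht => ?_
          refine lintegral_congr fun z => ?_
          dsimp only
          rw [ENNReal.rpow_two, mul_pow, ← ENNReal.ofReal_pow (Real.sqrt_nonneg _),
            Real.sq_sqrt (ha.trans ht.1).le]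
        · rw [lintegral_prod _ (hf'.pow_const 2).aemeasurable]
          simp only [lintegral_const, Measure.restrict_apply MeasurableSet.univ, univ_inter,
            volume_annulus]
          rw [lintegral_mul_const _ (by fun_prop), mul_comm,
            ENNReal.ofReal_mul (p := 3 * Real.pi) (by positivity), ← lintegral_Ioc_inv ha hab]
          gcongr 1
          refine le_of_eq (setLIntegral_congr_fun measurableSet_Ioc fun t ht => ?_)
          rw [ENNReal.rpow_two, ← ENNReal.ofReal_pow (by positivity), inv_pow,
            Real.sq_sqrt (ha.trans ht.1).le]

/-- A pointwise logarithmic bound of a compactly supported function through the maximal function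
and the `L²` norm of its gradient. -/
theorem enorm_le_maximalFunction_add_log {φ : Plane → ℝ} (hφ : ContDiff ℝ ∞ φ) {x : Plane}
    {a b : ℝ} (ha : 0 < a) (hab : a ≤ b) (hzero : ∀ y, b < dist y x → φ y = 0) :
    ‖φ x‖ₑ ≤ ENNReal.ofReal (8 * a) * maximalFunction (fun y => ‖gradient φ y‖ₑ) x +
      ENNReal.ofReal (2 * Real.sqrt (Real.log (b / a))) *
        (∫⁻ y, ‖gradient φ y‖ₑ ^ 2) ^ (1 / 2 : ℝ) := by
  have hφm : Measurable φ := hφ.continuous.measurable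
  have hpi := Real.pi_gt_three
  set M := maximalFunction (fun y => ‖gradient φ y‖ₑ)
  set I := (∫⁻ y, ‖gradient φ y‖ₑ ^ 2) ^ (1 / 2 : ℝ)
  have hlog : 0 ≤ Real.log (b / a) := Real.log_nonneg ((one_le_div ha).2 hab)
  have h1 : ∫⁻ z in annulus, ‖φ x - φ (x + a • z)‖ₑ ≤ ENNReal.ofReal (8 * a) * M x := by
    have h2 : ∫⁻ z in annulus, ‖φ x - φ (x + a • z)‖ₑ ≤
        ∫⁻ z in closedBall 0 2, ‖φ x - φ (x + a • z)‖ₑ := lintegral_mono_set sdiff_subset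
    refine h2.trans ?_
    rw [setLIntegral_comp_add_smul (F := fun y => ‖φ x - φ y‖ₑ) (by fun_prop) x ha]
    refine (mul_le_mul_right (setLIntegral_enorm_sub_le hφ x (by positivity)) _).trans_eq ?_
    rw [← mul_assoc, ← ENNReal.ofReal_mul (by positivity)]
    congr 2
    field_simp
    ring
  have h2 : ‖φ x‖ₑ * ENNReal.ofReal (3 * Real.pi) ≤ ENNReal.ofReal (8 * a) * M x +
      2 * (I * ENNReal.ofReal (3 * Real.pi * Real.log (b / a)) ^ (1 / 2 : ℝ)) := by
    calc ‖φ x‖ₑ * ENNReal.ofReal (3 * Real.pi)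
        = ∫⁻ z in annulus, ‖φ x‖ₑ := by rw [setLIntegral_const, volume_annulus]
      _ ≤ ∫⁻ z in annulus, (‖φ x - φ (x + a • z)‖ₑ + ‖φ (x + a • z) - φ (x + b • z)‖ₑ) := by
          refine setLIntegral_mono' measurableSet_annulus fun z hz => ?_
          -- Since |z| > 1 on the annulus, x + b z lies farther than b from x.
          have h0 : φ (x + b • z) = 0 := hzero _ (by
            rw [dist_eq_norm, add_sub_cancel_left, norm_smul,
              Real.norm_of_nonneg (ha.le.trans hab)]
            exact lt_mul_of_one_lt_right (ha.trans_le hab) (mem_annulus.1 hz).1)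
          rw [h0, sub_zero]
          calc ‖φ x‖ₑ = ‖(φ x - φ (x + a • z)) + φ (x + a • z)‖ₑ := by rw [sub_add_cancel]
            _ ≤ _ := enorm_add_le _ _
      _ = (∫⁻ z in annulus, ‖φ x - φ (x + a • z)‖ₑ) +
            ∫⁻ z in annulus, ‖φ (x + a • z) - φ (x + b • z)‖ₑ :=
          lintegral_add_left (by fun_prop) _
      _ ≤ _ := add_le_add h1 (lintegral_annulus_enorm_sub_le hφ x ha hab)
  have hne : ENNReal.ofReal (3 * Real.pi) ≠ 0 := by simp; positivity
  rw [← ENNReal.mul_le_mul_iff_left hne ENNReal.ofReal_ne_top]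
  refine h2.trans ?_
  -- As 3π ≥ 1, its root may be replaced by 3π itself, which cancels against the area of the
  -- annulus.
  have h3 : ENNReal.ofReal (3 * Real.pi * Real.log (b / a)) ^ (1 / 2 : ℝ) ≤
      ENNReal.ofReal (Real.sqrt (Real.log (b / a)) * (3 * Real.pi)) := by
    rw [ENNReal.ofReal_rpow_of_nonneg (by positivity) (by norm_num), ← Real.sqrt_eq_rpow,
      Real.sqrt_mul (by positivity), mul_comm]
    gcongr
    exact (Real.sqrt_le_left (by positivity)).2 (by nlinarith)
  have h4 : (1 : ℝ≥0∞) ≤ ENNReal.ofReal (3 * Real.pi) := by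
    rw [← ENNReal.ofReal_one]
    exact ENNReal.ofReal_le_ofReal (by linarith)
  rw [add_mul]
  refine add_le_add (le_mul_of_one_le_right zero_le h4) ?_
  calc 2 * (I * ENNReal.ofReal (3 * Real.pi * Real.log (b / a)) ^ (1 / 2 : ℝ))
      ≤ 2 * (I * ENNReal.ofReal (Real.sqrt (Real.log (b / a)) * (3 * Real.pi))) := by gcongr
    _ = _ := by
        rw [ENNReal.ofReal_mul (by positivity), ENNReal.ofReal_mul (by norm_num)]
        simp
        ring

/-! ### Exterior discs of a Lipschitz domain -/

theorem exists_mem_frontier_dist_le {s : Set Plane} {x y : Plane} (hx : x ∈ s) (hy : y ∉ s) :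
    ∃ p ∈ frontier s, dist x p ≤ dist x y := by
  by_contra! h
  have hseg : ∀ p ∈ segment ℝ x y, p ∉ frontier s := fun p hp hpf => by
    have h1 := dist_add_dist_of_mem_segment hp
    have h2 := h p hpf
    have := dist_nonneg (x := p) (y := y)
    linarith
  have hcov : segment ℝ x y ⊆ interior s ∪ (closure s)ᶜ := by
    intro p hp
    by_cases hpc : p ∈ closure s
    · left
      by_contra hi
      exact hseg p hp ⟨hpc, hi⟩
    · exact Or.inr hpc
  have hx' : x ∈ interior s := by
    by_contra hi
    exact hseg x (left_mem_segment _ _ _) ⟨subset_closure hx, hi⟩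
  have hy' : y ∈ (closure s)ᶜ := by
    intro hc
    exact hseg y (right_mem_segment _ _ _) ⟨hc, fun hi => hy (interior_subset hi)⟩
  obtain ⟨p, -, hp1, hp2⟩ := (convex_segment x y).isPreconnected _ _ isOpen_interior
    isClosed_closure.isOpen_compl hcov ⟨x, left_mem_segment _ _ _, hx'⟩
    ⟨y, right_mem_segment _ _ _, hy'⟩
  exact hp2 (interior_subset_closure hp1)

/-- The centre sits s/2 below p. Within radius ρ the height rises by at most ρ and the graph drops
by at most Kρ, and ρ is chosen with (1 + K)ρ = s/2. -/
theorem closedBall_below_graph_subset {e : Plane ≃ₗᵢ[ℝ] Plane} {K : ℝ≥0} {γ : ℝ → ℝ}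
    (hγ : LipschitzWith K γ) {p y : Plane} {s : ℝ} (hp : e p 1 ≤ γ (e p 0))
    (hy : y ∈ closedBall (p - (s / 2) • e.symm (EuclideanSpace.single 1 1))
      ((2 * (1 + K))⁻¹ * s)) :
    e y 1 ≤ γ (e y 0) := by
  set ρ := (2 * (1 + (K : ℝ)))⁻¹ * s with hρ
  have hK := K.coe_nonneg
  have hρs : (1 + K) * ρ = s / 2 := by rw [hρ]; field_simp
  have hw : ‖e y - (e p - (s / 2) • EuclideanSpace.single 1 1)‖ ≤ ρ := by
    rw [mem_closedBall, dist_eq_norm] at hy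
    rw [← e.norm_map] at hy
    rwa [map_sub, map_sub, map_smul, e.apply_symm_apply] at hy
  set w := e y - (e p - (s / 2) • EuclideanSpace.single 1 1) with hwdef
  have h0 : e y 0 = e p 0 + w 0 := by simp [hwdef]
  have h1 : e y 1 = e p 1 - s / 2 + w 1 := by simp [hwdef]
  have hw0 : |w 0| ≤ ρ := by simpa using (PiLp.norm_apply_le w 0).trans hw
  have hw1 : |w 1| ≤ ρ := by simpa using (PiLp.norm_apply_le w 1).trans hw
  have hL := hγ.dist_le_mul (e p 0) (e y 0)
  rw [Real.dist_eq, Real.dist_eq, h0, sub_add_cancel_left, abs_neg] at hL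
  have h2 : γ (e p 0) - γ (e p 0 + w 0) ≤ K * ρ :=
    (le_abs_self _).trans (hL.trans (mul_le_mul_of_nonneg_left hw0 hK))
  have h3 := (le_abs_self _).trans hw1
  rw [h0, h1]
  nlinarith

/-- Each boundary chart gives its own radius and ratio. The property passes to unions by taking
minima, so compactness of the boundary makes both uniform. -/
theorem IsBoundedLipschitzDomain.exists_exterior_ball {Ω : Opens Plane}
    (hΩ : IsBoundedLipschitzDomain Ω) :
    ∃ r κ : ℝ, 0 < r ∧ 0 < κ ∧ ∀ p ∈ frontier (Ω : Set Plane), ∀ s : ℝ, 0 < s → s ≤ r →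
      ∃ c, closedBall c (κ * s) ⊆ (Ω : Set Plane)ᶜ ∩ closedBall p s := by
  have hcomp : IsCompact (frontier (Ω : Set Plane)) :=
    Metric.isCompact_of_isClosed_isBounded isClosed_frontier
      (hΩ.isBounded.closure.subset frontier_subset_closure)
  refine hcomp.induction_on (p := fun S => ∃ r κ : ℝ, 0 < r ∧ 0 < κ ∧ ∀ p ∈ S, ∀ s : ℝ, 0 < s →
    s ≤ r → ∃ c, closedBall c (κ * s) ⊆ (Ω : Set Plane)ᶜ ∩ closedBall p s) ?_ ?_ ?_ ?_
  · exact ⟨1, 1, one_pos, one_pos, by simp⟩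
  · rintro S T hST ⟨r, κ, hr, hκ, h⟩
    exact ⟨r, κ, hr, hκ, fun p hp => h p (hST hp)⟩
  · rintro S T ⟨r, κ, hr, hκ, h⟩ ⟨r', κ', hr', hκ', h'⟩
    refine ⟨min r r', min κ κ', lt_min hr hr', lt_min hκ hκ', ?_⟩
    rintro p (hp | hp) s hs hsr
    · obtain ⟨c, hc⟩ := h p hp s hs (hsr.trans (min_le_left _ _))
      exact ⟨c, (closedBall_subset_closedBall (by gcongr; exact min_le_left _ _)).trans hc⟩
    · obtain ⟨c, hc⟩ := h' p hp s hs (hsr.trans (min_le_right _ _))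
      exact ⟨c, (closedBall_subset_closedBall (by gcongr; exact min_le_right _ _)).trans hc⟩
  · intro p₀ hp₀
    obtain ⟨r, hr, e, K, γ, hγ, hΩr⟩ := hΩ.lipschitz_boundary p₀ hp₀
    have hK := K.coe_nonneg
    -- Halving the radius keeps the discs of radius s ≤ r/2 about nearby p inside the chart.
    refine ⟨frontier (Ω : Set Plane) ∩ ball p₀ (r / 2),
      inter_mem self_mem_nhdsWithin (mem_nhdsWithin_of_mem_nhds (ball_mem_nhds _ (by positivity))),
      r / 2, (2 * (1 + (K : ℝ)))⁻¹, by positivity, by positivity, ?_⟩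
    rintro p ⟨hp, hpb⟩ s hs hsr
    have hball : ball p₀ (r / 2) ⊆ ball p₀ r := ball_subset_ball (by linarith)
    have hpΩ : p ∉ Ω := fun h => (Ω.isOpen.frontier_eq ▸ hp).2 h
    have hpe : e p 1 ≤ γ (e p 0) := not_lt.1 fun h => hpΩ ((hΩr p (hball hpb)).2 h)
    have hsub : closedBall (p - (s / 2) • e.symm (EuclideanSpace.single 1 1))
        ((2 * (1 + (K : ℝ)))⁻¹ * s) ⊆ closedBall p s := by
      refine closedBall_subset_closedBall' ?_
      have h1 : (2 * (1 + (K : ℝ)))⁻¹ * s ≤ s / 2 := by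
        rw [div_eq_inv_mul]
        gcongr
        linarith
      have h2 : dist (p - (s / 2) • e.symm (EuclideanSpace.single 1 1)) p = s / 2 := by
        rw [dist_eq_norm, sub_sub_cancel_left, norm_neg, norm_smul, e.symm.norm_map]
        simp [abs_of_pos hs]
      linarith
    refine ⟨p - (s / 2) • e.symm (EuclideanSpace.single 1 1), fun y hy => ⟨fun hyΩ => ?_, hsub hy⟩⟩
    have hyb : y ∈ ball p₀ r := by
      have h1 := hsub hy
      rw [mem_closedBall] at h1
      rw [mem_ball] at hpb ⊢
      linarith [dist_triangle y p p₀]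
    exact absurd ((hΩr y hyb).1 hyΩ) (not_lt.2 (closedBall_below_graph_subset hγ hpe hy))

/-- The bound on the scale disappears because distances from Ω to its boundary are at most 2D:
shrinking κ by the factor min(1, r/(2D)) covers the large scales. -/
theorem IsBoundedLipschitzDomain.exists_exterior_ball_of_mem {Ω : Opens Plane}
    (hΩ : IsBoundedLipschitzDomain Ω) :
    ∃ κ : ℝ, 0 < κ ∧ ∀ x ∈ Ω, ∀ p ∈ frontier (Ω : Set Plane),
      ∃ c, closedBall c (κ * dist x p) ⊆ (Ω : Set Plane)ᶜ ∩ closedBall x (2 * dist x p) := by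
  obtain ⟨r, κ, hr, hκ, h⟩ := hΩ.exists_exterior_ball
  obtain ⟨D, hD0, hD⟩ := hΩ.isBounded.closure.exists_pos_norm_le
  have hdist : ∀ x ∈ Ω, ∀ p ∈ frontier (Ω : Set Plane), dist x p ≤ 2 * D := by
    intro x hx p hp
    have h1 := hD x (subset_closure hx)
    have h2 := hD p (frontier_subset_closure hp)
    rw [dist_eq_norm]
    exact (norm_sub_le _ _).trans (by linarith)
  refine ⟨κ * min 1 (r / (2 * D)), by positivity, fun x hx p hp => ?_⟩
  have hxp : 0 < dist x p := dist_pos.2 fun hxp => by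
    rw [Ω.isOpen.frontier_eq] at hp
    exact hp.2 (hxp ▸ hx)
  obtain ⟨c, hc⟩ := h p hp (min (dist x p) r) (lt_min hxp hr) (min_le_right _ _)
  refine ⟨c, (closedBall_subset_closedBall ?_).trans (hc.trans (inter_subset_inter_right _
    (closedBall_subset_closedBall' ?_)))⟩
  · rw [mul_assoc]
    refine mul_le_mul_of_nonneg_left (le_min ?_ ?_) hκ.le
    · exact mul_le_of_le_one_left hxp.le (min_le_left _ _)
    · calc min 1 (r / (2 * D)) * dist x p ≤ r / (2 * D) * (2 * D) := by
            gcongr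
            · exact min_le_right _ _
            · exact hdist x hx p hp
        _ = r := by field_simp
  · rw [dist_comm p x]
    linarith [min_le_left (dist x p) r]

/-! ### The two-point bound with the maximal function cut off outside Ω -/

theorem TestFunction.eq_zero_of_notMem {Ω : Opens Plane} (φ : 𝓓(Ω, ℝ)) {x : Plane} (hx : x ∉ Ω) :
    φ x = 0 :=
  image_eq_zero_of_notMem_tsupport fun h => hx (φ.tsupport_subset h)

theorem TestFunction.gradient_eq_zero_of_notMem {Ω : Opens Plane} (φ : 𝓓(Ω, ℝ)) {x : Plane}
    (hx : x ∉ Ω) : gradient φ x = 0 := by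
  rw [← norm_eq_zero, norm_gradient, norm_eq_zero]
  exact image_eq_zero_of_notMem_tsupport fun h =>
    hx (φ.tsupport_subset (tsupport_fderiv_subset ℝ h))

/-- Test functions on a bounded Lipschitz domain satisfy a pointwise Lipschitz estimate through the
maximal function of the gradient, cut off outside `Ω`. -/
theorem IsBoundedLipschitzDomain.exists_edist_test_le {Ω : Opens Plane}
    (hΩ : IsBoundedLipschitzDomain Ω) :
    ∃ C : ℝ≥0, ∀ (φ : 𝓓(Ω, ℝ)) (x y : Plane), edist (φ x) (φ y) ≤ C * edist x y *
      ((Ω : Set Plane).indicator (maximalFunction fun y => ‖gradient φ y‖ₑ) x +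
        (Ω : Set Plane).indicator (maximalFunction fun y => ‖gradient φ y‖ₑ) y) := by
  obtain ⟨κ, hκ, h⟩ := hΩ.exists_exterior_ball_of_mem
  -- For y outside Ω no maximal function at y is available. The segment to y meets the boundary at
  -- some p no farther from x than y, and φ vanishes on an exterior disc near p.
  have hout : ∀ (φ : 𝓓(Ω, ℝ)) (x y : Plane), x ∈ Ω → y ∉ Ω → edist (φ x) (φ y) ≤
      (4 / κ ^ 2).toNNReal * edist x y * maximalFunction (fun y => ‖gradient φ y‖ₑ) x := by
    intro φ x y hx hy
    obtain ⟨p, hp, hpd⟩ := exists_mem_frontier_dist_le (s := Ω) hx hy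
    have hxp : 0 < dist x p := dist_pos.2 fun hxp => by
      rw [Ω.isOpen.frontier_eq] at hp
      exact hp.2 (hxp ▸ hx)
    obtain ⟨c, hc⟩ := h x hx p hp
    have h1 := enorm_le_maximalFunction_of_eqOn_zero φ.contDiff hκ hxp
      (hc.trans inter_subset_right)
      (fun z hz => TestFunction.eq_zero_of_notMem φ (hc hz).1)
    rw [TestFunction.eq_zero_of_notMem φ hy, edist_zero_right]
    refine h1.trans ?_
    gcongr
    rw [ENNReal.ofReal_mul (by positivity), edist_dist]
    exact mul_le_mul_right (ENNReal.ofReal_le_ofReal hpd) _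
  refine ⟨max 2 (4 / κ ^ 2).toNNReal, fun φ x y => ?_⟩
  by_cases hx : x ∈ (Ω : Set Plane) <;> by_cases hy : y ∈ (Ω : Set Plane)
  · rw [indicator_of_mem hx, indicator_of_mem hy]
    refine (edist_le_maximalFunction_add φ.contDiff x y).trans ?_
    gcongr
    exact_mod_cast le_max_left _ _
  · rw [indicator_of_mem hx, indicator_of_notMem hy, add_zero]
    refine (hout φ x y hx hy).trans ?_
    gcongr
    exact_mod_cast le_max_right _ _
  · rw [indicator_of_mem hy, indicator_of_notMem hx, zero_add, edist_comm, edist_comm x]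
    refine (hout φ y x hy hx).trans ?_
    gcongr
    exact_mod_cast le_max_right _ _
  · rw [TestFunction.eq_zero_of_notMem φ hx, TestFunction.eq_zero_of_notMem φ hy, edist_self]
    exact zero_le

/-! ### Passage from test functions to W₀^{1,2}(Ω) -/

section

variable {Ω : Opens Plane}

theorem valueOf_sub (u v : W012 Ω) : valueOf (u - v) = valueOf u - valueOf v := rfl

theorem valueOf_add (u v : W012 Ω) : valueOf (u + v) = valueOf u + valueOf v := rfl

theorem valueOf_smul (c : ℝ) (u : W012 Ω) : valueOf (c • u) = c • valueOf u := rfl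

theorem gradOf_sub (u v : W012 Ω) : gradOf (u - v) = gradOf u - gradOf v := rfl

theorem gradOf_add (u v : W012 Ω) : gradOf (u + v) = gradOf u + gradOf v := rfl

theorem gradOf_smul (c : ℝ) (u : W012 Ω) : gradOf (c • u) = c • gradOf u := rfl

theorem norm_gradOf_le (u : W012 Ω) : ‖gradOf u‖ ≤ ‖u‖ := WithLp.norm_snd_le _ (u : L2Pair Ω)

theorem norm_sq_eq (u : W012 Ω) : ‖u‖ ^ 2 = ‖valueOf u‖ ^ 2 + ‖gradOf u‖ ^ 2 :=
  WithLp.prod_norm_sq_eq_of_L2 (u : L2Pair Ω)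

theorem valueOf_ofTest (φ : 𝓓(Ω, ℝ)) : valueOf (ofTest φ) =ᵐ[volumeOn Ω] φ :=
  (memLp_test φ).coeFn_toLp

theorem gradOf_ofTest (φ : 𝓓(Ω, ℝ)) : gradOf (ofTest φ) =ᵐ[volumeOn Ω] gradient φ :=
  (memLp_gradient_test φ).coeFn_toLp

theorem measurableSet_coe (Ω : Opens Plane) : MeasurableSet (Ω : Set Plane) :=
  Ω.isOpen.measurableSet

/-- The extension by zero of an element of `W₀^{1,2}(Ω)` to the plane. -/
noncomputable def extendZero (u : W012 Ω) : Plane → ℝ := (Ω : Set Plane).indicator (valueOf u)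

/-- The norm of the weak gradient of an element of `W₀^{1,2}(Ω)`, extended by zero. -/
noncomputable def gradEnorm (u : W012 Ω) : Plane → ℝ≥0∞ :=
  (Ω : Set Plane).indicator fun x => ‖gradOf u x‖ₑ

/-- The maximal function of the weak gradient of an element of `W₀^{1,2}(Ω)`, cut off
outside `Ω`. -/
noncomputable def gradMax (u : W012 Ω) : Plane → ℝ≥0∞ :=
  (Ω : Set Plane).indicator (maximalFunction (gradEnorm u))

theorem measurable_extendZero (u : W012 Ω) : Measurable (extendZero u) :=
  (Lp.stronglyMeasurable (valueOf u)).measurable.indicator (measurableSet_coe Ω)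

theorem measurable_gradEnorm (u : W012 Ω) : Measurable (gradEnorm u) :=
  (Lp.stronglyMeasurable (gradOf u)).measurable.enorm.indicator (measurableSet_coe Ω)

theorem measurable_gradMax (u : W012 Ω) : Measurable (gradMax u) :=
  (measurable_maximalFunction _).indicator (measurableSet_coe Ω)

theorem lintegral_enorm_sq {E : Type*} [NormedAddCommGroup E] {μ : Measure Plane} (f : Lp E 2 μ) :
    ∫⁻ x, ‖f x‖ₑ ^ 2 ∂μ = ‖f‖ₑ ^ 2 := by
  rw [Lp.enorm_def, eLpNorm_eq_lintegral_rpow_enorm_toReal (by norm_num) (by norm_num)]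
  simp only [ENNReal.toReal_ofNat, ENNReal.rpow_two]
  rw [← ENNReal.rpow_two, ← ENNReal.rpow_mul]
  norm_num

theorem lintegral_extendZero_sq (u : W012 Ω) :
    ∫⁻ x, ‖extendZero u x‖ₑ ^ 2 = ‖valueOf u‖ₑ ^ 2 := by
  rw [← lintegral_enorm_sq, ← lintegral_indicator (measurableSet_coe Ω)]
  refine lintegral_congr fun x => ?_
  by_cases hx : x ∈ (Ω : Set Plane) <;> simp [extendZero, hx]

theorem lintegral_gradEnorm_sq (u : W012 Ω) :
    ∫⁻ x, gradEnorm u x ^ 2 = ‖gradOf u‖ₑ ^ 2 := by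
  rw [← lintegral_enorm_sq, ← lintegral_indicator (measurableSet_coe Ω)]
  refine lintegral_congr fun x => ?_
  by_cases hx : x ∈ (Ω : Set Plane) <;> simp [gradEnorm, hx]

theorem lintegral_gradMax_sq_le (u : W012 Ω) :
    ∫⁻ x, gradMax u x ^ 2 ≤ ENNReal.ofReal (128 * Real.pi ^ 2) * ‖gradOf u‖ₑ ^ 2 := by
  rw [← lintegral_gradEnorm_sq]
  refine (lintegral_mono fun x => ?_).trans
    (lintegral_maximalFunction_sq_le (measurable_gradEnorm u))
  dsimp only
  gcongr
  exact indicator_le_self' (fun _ _ => zero_le) x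

theorem lintegral_gradMax_sq_lt_top (u : W012 Ω) : ∫⁻ x, gradMax u x ^ 2 < ⊤ :=
  (lintegral_gradMax_sq_le u).trans_lt (ENNReal.mul_lt_top ENNReal.ofReal_lt_top
    (ENNReal.pow_lt_top enorm_lt_top))

theorem gradEnorm_ofTest (φ : 𝓓(Ω, ℝ)) :
    gradEnorm (ofTest φ) =ᵐ[volume] fun x => ‖gradient φ x‖ₑ := by
  have h := (ae_restrict_iff' (measurableSet_coe Ω)).1 (gradOf_ofTest φ)
  filter_upwards [h] with x hx
  by_cases hxΩ : x ∈ (Ω : Set Plane)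
  · simp [gradEnorm, hxΩ, hx hxΩ]
  · simp [gradEnorm, hxΩ, TestFunction.gradient_eq_zero_of_notMem φ hxΩ]

theorem extendZero_ofTest (φ : 𝓓(Ω, ℝ)) : extendZero (ofTest φ) =ᵐ[volume] φ := by
  have h := (ae_restrict_iff' (measurableSet_coe Ω)).1 (valueOf_ofTest φ)
  filter_upwards [h] with x hx
  by_cases hxΩ : x ∈ (Ω : Set Plane)
  · simp [extendZero, hxΩ, hx hxΩ]
  · simp [extendZero, hxΩ, TestFunction.eq_zero_of_notMem φ hxΩ]

theorem maximalFunction_gradEnorm_ofTest (φ : 𝓓(Ω, ℝ)) :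
    maximalFunction (gradEnorm (ofTest φ)) = maximalFunction fun x => ‖gradient φ x‖ₑ :=
  maximalFunction_congr (gradEnorm_ofTest φ)

theorem extendZero_sub (u v : W012 Ω) :
    extendZero (u - v) =ᵐ[volume] extendZero u - extendZero v := by
  have h := (ae_restrict_iff' (measurableSet_coe Ω)).1 (Lp.coeFn_sub (valueOf u) (valueOf v))
  filter_upwards [h] with x hx
  by_cases hxΩ : x ∈ (Ω : Set Plane)
  · have := hx hxΩ
    simp only [Pi.sub_apply, extendZero, indicator_of_mem hxΩ, valueOf_sub] at this ⊢
    exact this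
  · simp [extendZero, hxΩ]

theorem gradEnorm_add_le (u v : W012 Ω) :
    gradEnorm (u + v) ≤ᵐ[volume] gradEnorm u + gradEnorm v := by
  have h := (ae_restrict_iff' (measurableSet_coe Ω)).1 (Lp.coeFn_add (gradOf u) (gradOf v))
  filter_upwards [h] with x hx
  by_cases hxΩ : x ∈ (Ω : Set Plane)
  · have := hx hxΩ
    simp only [Pi.add_apply, gradEnorm, indicator_of_mem hxΩ, gradOf_add] at this ⊢
    rw [this]
    exact enorm_add_le _ _
  · simp [gradEnorm, hxΩ]

theorem gradMax_add_le (u v : W012 Ω) (x : Plane) :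
    gradMax (u + v) x ≤ gradMax u x + gradMax v x := by
  by_cases hxΩ : x ∈ (Ω : Set Plane)
  · simp only [gradMax, indicator_of_mem hxΩ]
    exact (maximalFunction_mono (gradEnorm_add_le u v) x).trans
      (maximalFunction_add_le (measurable_gradEnorm u) _ x)
  · simp [gradMax, hxΩ]

theorem ae_tendsto_zero_of_tsum_lintegral_ne_top {f : ℕ → Plane → ℝ≥0∞}
    (hf : ∀ n, Measurable (f n)) (h : ∑' n, ∫⁻ x, f n x ≠ ⊤) :
    ∀ᵐ x, Tendsto (fun n => f n x) atTop (𝓝 0) := by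
  rw [← lintegral_tsum fun n => (hf n).aemeasurable] at h
  filter_upwards [ae_lt_top (Measurable.tsum hf) h] with x hx
  exact ENNReal.tendsto_atTop_zero_of_tsum_ne_top hx.ne

theorem ENNReal.tendsto_zero_of_sq {f : ℕ → ℝ≥0∞} (h : Tendsto (fun n => f n ^ 2) atTop (𝓝 0)) :
    Tendsto f atTop (𝓝 0) := by
  have h1 := (ENNReal.continuous_rpow_const (y := 1 / 2)).continuousAt.tendsto.comp h
  have h2 : (0 : ℝ≥0∞) ^ (1 / 2 : ℝ) = 0 := by norm_num
  rw [h2] at h1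
  refine h1.congr fun n => ?_
  rw [Function.comp_apply, ← ENNReal.rpow_two, ← ENNReal.rpow_mul]
  norm_num

/-- Every element of `W₀^{1,2}(Ω)` is the limit of test functions, in the norm as well as
pointwise together with the maximal functions of the gradients, off a null set. -/
theorem exists_seq_test_tendsto (u : W012 Ω) :
    ∃ φ : ℕ → 𝓓(Ω, ℝ), Tendsto (fun n => ofTest (φ n)) atTop (𝓝 u) ∧
      ∃ Z : Set Plane, Z ⊆ Ω ∧ volume Z = 0 ∧ ∀ x ∉ Z,
        Tendsto (fun n => φ n x) atTop (𝓝 (extendZero u x)) ∧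
        Tendsto (fun n => gradMax (ofTest (φ n) - u) x) atTop (𝓝 0) := by
  -- The geometric rate makes the squared errors summable, so the whole sequence converges almost
  -- everywhere.
  have hex : ∀ n : ℕ, ∃ φ : 𝓓(Ω, ℝ), ‖ofTest φ - u‖ < (1 / 2) ^ n := by
    intro n
    have hu : (u : L2Pair Ω) ∈ closure (LinearMap.range (testPair Ω) : Set (L2Pair Ω)) := u.2
    obtain ⟨-, ⟨φ, rfl⟩, hφ⟩ := Metric.mem_closure_iff.1 hu ((1 / 2) ^ n) (by positivity)
    refine ⟨φ, ?_⟩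
    rw [dist_comm, dist_eq_norm] at hφ
    exact hφ
  choose φ hφ using hex
  have hsq : ∀ n, ‖ofTest (φ n) - u‖ₑ ^ 2 ≤ ENNReal.ofReal (1 / 4) ^ n := by
    intro n
    rw [← ofReal_norm, ← ENNReal.ofReal_pow (norm_nonneg _), ← ENNReal.ofReal_pow (by norm_num)]
    refine ENNReal.ofReal_le_ofReal ?_
    calc ‖ofTest (φ n) - u‖ ^ 2 ≤ ((1 / 2) ^ n) ^ 2 := by gcongr; exact (hφ n).le
      _ = (1 / 4) ^ n := by rw [← pow_mul, mul_comm, pow_mul]; norm_num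
  have hgeom : ∑' n : ℕ, ENNReal.ofReal (1 / 4) ^ n ≠ ⊤ := by
    rw [ENNReal.tsum_geometric]
    simp only [ne_eq, ENNReal.inv_eq_top, tsub_eq_zero_iff_le, not_le]
    rw [← ENNReal.ofReal_one]
    exact (ENNReal.ofReal_lt_ofReal_iff one_pos).2 (by norm_num)
  have h1 : ∀ᵐ x, Tendsto (fun n => ‖extendZero (ofTest (φ n) - u) x‖ₑ ^ 2) atTop (𝓝 0) := by
    refine ae_tendsto_zero_of_tsum_lintegral_ne_top
      (fun n => (measurable_extendZero _).enorm.pow_const 2) ?_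
    refine ne_top_of_le_ne_top hgeom (ENNReal.tsum_le_tsum fun n => ?_)
    rw [lintegral_extendZero_sq]
    refine le_trans ?_ (hsq n)
    gcongr
    exact WithLp.enorm_fst_le _ ((ofTest (φ n) - u : W012 Ω) : L2Pair Ω)
  have h2 : ∀ᵐ x, Tendsto (fun n => gradMax (ofTest (φ n) - u) x ^ 2) atTop (𝓝 0) := by
    refine ae_tendsto_zero_of_tsum_lintegral_ne_top
      (fun n => (measurable_gradMax _).pow_const 2) ?_
    refine ne_top_of_le_ne_top (ENNReal.mul_ne_top
      (ENNReal.ofReal_ne_top (r := 128 * Real.pi ^ 2)) hgeom) ?_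
    rw [← ENNReal.tsum_mul_left]
    refine ENNReal.tsum_le_tsum fun n => (lintegral_gradMax_sq_le _).trans ?_
    refine mul_le_mul_right (le_trans ?_ (hsq n)) _
    gcongr
    exact WithLp.enorm_snd_le _ ((ofTest (φ n) - u : W012 Ω) : L2Pair Ω)
  have h3 : ∀ᵐ x, ∀ n, extendZero (ofTest (φ n) - u) x = φ n x - extendZero u x := by
    refine ae_all_iff.2 fun n => ?_
    filter_upwards [extendZero_sub (ofTest (φ n)) u, extendZero_ofTest (φ n)] with x hx hx'
    rw [hx, Pi.sub_apply, hx']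
  have hae : ∀ᵐ x, Tendsto (fun n => φ n x) atTop (𝓝 (extendZero u x)) ∧
        Tendsto (fun n => gradMax (ofTest (φ n) - u) x) atTop (𝓝 0) := by
    filter_upwards [h1, h2, h3] with x hx1 hx2 hx3
    refine ⟨?_, ENNReal.tendsto_zero_of_sq hx2⟩
    rw [tendsto_iff_edist_tendsto_0]
    have := ENNReal.tendsto_zero_of_sq hx1
    simpa only [hx3, ← edist_eq_enorm_sub] using this
  refine ⟨φ, ?_, {x | ¬ (Tendsto (fun n => φ n x) atTop (𝓝 (extendZero u x)) ∧
        Tendsto (fun n => gradMax (ofTest (φ n) - u) x) atTop (𝓝 0))}, ?_, ?_, ?_⟩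
  · rw [tendsto_iff_norm_sub_tendsto_zero]
    exact squeeze_zero (fun _ => norm_nonneg _) (fun n => (hφ n).le)
      (tendsto_pow_atTop_nhds_zero_of_lt_one (by norm_num) (by norm_num))
  -- Outside Ω all terms vanish, so the exceptional set lies in Ω. The truncation needs this to keep
  -- the whole complement of Ω in its good set.
  · intro x hx
    by_contra hxΩ
    refine hx ⟨?_, ?_⟩
    · simp [extendZero, hxΩ, TestFunction.eq_zero_of_notMem _ hxΩ]
    · simp [gradMax, hxΩ]
  · exact hae
  · intro x hx
    exact not_not.1 hx

/-- Sublinearity of the maximal function, in the form that lets bounds for test functions pass to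
the limit at a fixed point. -/
theorem gradMax_ofTest_le (φ : 𝓓(Ω, ℝ)) (u : W012 Ω) (x : Plane) :
    (Ω : Set Plane).indicator (maximalFunction fun y => ‖gradient φ y‖ₑ) x ≤
      gradMax u x + gradMax (ofTest φ - u) x := by
  have h := gradMax_add_le u (ofTest φ - u) x
  rwa [add_sub_cancel, gradMax, maximalFunction_gradEnorm_ofTest] at h

/-- Elements of `W₀^{1,2}(Ω)` satisfy the pointwise Lipschitz and logarithmic bounds
through the maximal function of the gradient. -/
theorem IsBoundedLipschitzDomain.exists_pointwise_bounds (hΩ : IsBoundedLipschitzDomain Ω) :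
    ∃ C : ℝ≥0, ∃ D : ℝ, 0 < D ∧ ∀ u : W012 Ω, ∃ Z : Set Plane, Z ⊆ Ω ∧ volume Z = 0 ∧
      (∀ x ∉ Z, ∀ y ∉ Z, edist (extendZero u x) (extendZero u y) ≤
        C * edist x y * (gradMax u x + gradMax u y)) ∧
      ∀ x ∉ Z, ∀ r, 0 < r → r ≤ D → ‖extendZero u x‖ₑ ≤ ENNReal.ofReal (8 * r) * gradMax u x +
        ENNReal.ofReal (2 * Real.sqrt (Real.log (D / r))) * ‖gradOf u‖ₑ := by
  obtain ⟨C, hC⟩ := hΩ.exists_edist_test_le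
  obtain ⟨R, hR0, hR⟩ := hΩ.isBounded.exists_pos_norm_le
  refine ⟨C, 2 * R, by positivity, fun u => ?_⟩
  obtain ⟨φ, hφ, Z, hZ, hZ0, hZφ⟩ := exists_seq_test_tendsto u
  refine ⟨Z, hZ, hZ0, fun x hx y hy => ?_, fun x hx r hr hrR => ?_⟩
  · have hl := (hZφ x hx).1.edist (hZφ y hy).1
    have hr : Tendsto (fun n => C * edist x y * ((gradMax u x + gradMax (ofTest (φ n) - u) x) +
        (gradMax u y + gradMax (ofTest (φ n) - u) y))) atTop
        (𝓝 (C * edist x y * ((gradMax u x + 0) + (gradMax u y + 0)))) := by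
      refine ENNReal.Tendsto.const_mul ?_
        (Or.inr (ENNReal.mul_ne_top ENNReal.coe_ne_top (edist_ne_top x y)))
      exact ((hZφ x hx).2.const_add _).add ((hZφ y hy).2.const_add _)
    simp only [add_zero] at hr
    refine le_of_tendsto_of_tendsto' hl hr fun n => (hC (φ n) x y).trans ?_
    gcongr <;> exact gradMax_ofTest_le _ _ _
  · by_cases hxΩ : x ∈ Ω
    swap
    · simp [extendZero, hxΩ]
    have hl := ((hZφ x hx).1).enorm
    have hr' : Tendsto (fun n => ENNReal.ofReal (8 * r) *
        (gradMax u x + gradMax (ofTest (φ n) - u) x) +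
        ENNReal.ofReal (2 * Real.sqrt (Real.log (2 * R / r))) * ‖gradOf (ofTest (φ n))‖ₑ) atTop
        (𝓝 (ENNReal.ofReal (8 * r) * (gradMax u x + 0) +
        ENNReal.ofReal (2 * Real.sqrt (Real.log (2 * R / r))) * ‖gradOf u‖ₑ)) := by
      refine (ENNReal.Tendsto.const_mul ((hZφ x hx).2.const_add _)
        (Or.inr ENNReal.ofReal_ne_top)).add (ENNReal.Tendsto.const_mul ?_
        (Or.inr ENNReal.ofReal_ne_top))
      have : Tendsto (fun n => gradOf (ofTest (φ n))) atTop (𝓝 (gradOf u)) := by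
        rw [tendsto_iff_norm_sub_tendsto_zero] at hφ ⊢
        exact squeeze_zero (fun _ => norm_nonneg _) (fun n => norm_gradOf_le (ofTest (φ n) - u)) hφ
      exact this.enorm
    rw [add_zero] at hr'
    refine le_of_tendsto_of_tendsto' hl hr' fun n => ?_
    -- With Ω in the disc of radius R about 0, points farther than 2R from x ∈ Ω lie outside Ω;
    -- hence D = 2R.
    have h1 := enorm_le_maximalFunction_add_log (φ n).contDiff (x := x) hr hrR fun y hy => by
      refine TestFunction.eq_zero_of_notMem (φ n) fun hyΩ => ?_
      have h2 := hR x hxΩ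
      have h3 := hR y hyΩ
      have h4 : dist y x ≤ ‖y‖ + ‖x‖ := by rw [dist_eq_norm]; exact norm_sub_le _ _
      linarith
    refine h1.trans ?_
    gcongr
    · have := gradMax_ofTest_le (φ n) u x
      rwa [indicator_of_mem (by exact hxΩ)] at this
    · have h5 : ∫⁻ y, ‖gradient (φ n) y‖ₑ ^ 2 = ‖gradOf (ofTest (φ n))‖ₑ ^ 2 := by
        rw [← lintegral_gradEnorm_sq]
        exact (lintegral_congr_ae ((gradEnorm_ofTest (φ n)).fun_comp (· ^ 2))).symm
      rw [h5, ← ENNReal.rpow_two, ← ENNReal.rpow_mul]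
      norm_num

end

/-! ### Approximation of Lipschitz functions by test functions -/

section Mollification

/-- The kernel is at most 1/(π rIn²), and the points it sees from y lie within 4 rIn of x; the
constant is 16/π ≤ 6. -/
theorem lintegral_normed_mul_le (f : ContDiffBump (0 : Plane)) (hf : f.rOut = 2 * f.rIn)
    (m : Plane → ℝ≥0∞) {x y : Plane} (hxy : dist y x ≤ f.rOut) :
    ∫⁻ t, ENNReal.ofReal (f.normed volume t) * m (y - t) ≤ 6 * maximalFunction m x := by
  have hpi := Real.pi_gt_three
  have hr := f.rIn_pos
  have h1 := lintegral_sub_left_eq_self (μ := (volume : Measure Plane))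
    (fun z => ENNReal.ofReal (f.normed volume (y - z)) * m z) y
  simp only [sub_sub_cancel] at h1
  rw [h1]
  have h2 : ∀ z, ENNReal.ofReal (f.normed volume (y - z)) * m z ≤
      (closedBall x (4 * f.rIn)).indicator
        (fun z => ENNReal.ofReal (Real.pi * f.rIn ^ 2)⁻¹ * m z) z := by
    intro z
    by_cases hz : z ∈ closedBall x (4 * f.rIn)
    · rw [indicator_of_mem hz]
      gcongr
      have h3 := f.normed_le_div_measure_closedBall_rIn (μ := volume) (y - z)
      rwa [Measure.real, volume_closedBall_plane _ _ hr.le,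
        ENNReal.toReal_ofReal (by positivity), one_div] at h3
    · have h3 : y - z ∉ Function.support (f.normed volume) := by
        rw [f.support_normed_eq, mem_ball, dist_zero_right, ← dist_eq_norm]
        intro h4
        rw [mem_closedBall, not_le] at hz
        have := dist_triangle z y x
        rw [dist_comm z y] at this
        linarith
      rw [Function.notMem_support.1 h3]
      simp
  calc ∫⁻ z, ENNReal.ofReal (f.normed volume (y - z)) * m z
      ≤ ∫⁻ z, (closedBall x (4 * f.rIn)).indicator
        (fun z => ENNReal.ofReal (Real.pi * f.rIn ^ 2)⁻¹ * m z) z := lintegral_mono h2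
    _ = ENNReal.ofReal (Real.pi * f.rIn ^ 2)⁻¹ * ∫⁻ z in closedBall x (4 * f.rIn), m z := by
        rw [lintegral_indicator isClosed_closedBall.measurableSet,
          lintegral_const_mul' _ _ ENNReal.ofReal_ne_top]
    _ ≤ ENNReal.ofReal (Real.pi * f.rIn ^ 2)⁻¹ *
          (ENNReal.ofReal ((4 * f.rIn) ^ 2) * maximalFunction m x) := by
        gcongr
        exact setLIntegral_closedBall_le_maximalFunction m x (by positivity)
    _ ≤ 6 * maximalFunction m x := by
        rw [← mul_assoc, ← ENNReal.ofReal_mul (by positivity)]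
        gcongr
        rw [show (6 : ℝ≥0∞) = ENNReal.ofReal 6 by simp]
        refine ENNReal.ofReal_le_ofReal ?_
        rw [← div_eq_inv_mul, div_le_iff₀ (by positivity)]
        have : 0 < f.rIn ^ 2 := by positivity
        nlinarith

/-- Soft thresholding annihilates values of size at most δ without expanding differences. It serves
to move the support of a function vanishing outside Ω into a compact subset of Ω before mollifying.
-/
theorem lipschitzWith_softThreshold (δ : ℝ) :
    LipschitzWith 1 fun t : ℝ => max (t - δ) (min (t + δ) 0) := by
  have h1 : LipschitzWith 1 fun t : ℝ => t - δ := by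
    simpa using LipschitzWith.id.sub (LipschitzWith.const (α := ℝ) δ)
  have h2 : LipschitzWith 1 fun t : ℝ => t + δ := by
    simpa using LipschitzWith.id.add (LipschitzWith.const (α := ℝ) δ)
  simpa using h1.max (h2.min_const 0)

theorem abs_softThreshold_sub_le {δ : ℝ} (hδ : 0 ≤ δ) (t : ℝ) :
    |max (t - δ) (min (t + δ) 0) - t| ≤ δ := by
  rw [abs_le]
  grind

theorem softThreshold_eq_zero {δ t : ℝ} (ht : |t| ≤ δ) : max (t - δ) (min (t + δ) 0) = 0 := by
  rw [abs_le] at ht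
  grind

/-- Smooth approximation, by test functions, of a Lipschitz function vanishing outside `Ω`. -/
theorem exists_test_approx {Ω : Opens Plane} (hΩ : Bornology.IsBounded (Ω : Set Plane))
    {w : Plane → ℝ} {L : ℝ≥0} (hw : LipschitzWith L w) (hw0 : ∀ x ∉ Ω, w x = 0)
    {m : Plane → ℝ≥0∞} (hm : Measurable m) {Z : Set Plane} (hZ : volume Z = 0)
    (hwm : ∀ x ∉ Z, ∀ y ∉ Z, edist (w x) (w y) ≤ edist x y * (m x + m y)) {η : ℝ} (hη : 0 < η) :
    ∃ φ : 𝓓(Ω, ℝ), (∀ x, |φ x - w x| ≤ η) ∧ (∀ x, ‖gradient φ x‖ ≤ L) ∧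
      ∫⁻ x, ‖gradient φ x‖ₑ ^ 2 ≤
        144 * (ENNReal.ofReal (128 * Real.pi ^ 2) * ∫⁻ x, m x ^ 2) := by
  set δ := η / 2 with hδ
  have hδ0 : 0 < δ := by positivity
  set v : Plane → ℝ := fun x => max (w x - δ) (min (w x + δ) 0) with hv
  have hvw : ∀ x y, edist (v x) (v y) ≤ edist (w x) (w y) := fun x y => by
    simpa using lipschitzWith_softThreshold δ (w x) (w y)
  have hvL : LipschitzWith L v := fun x y => (hvw x y).trans (hw x y)
  have hvd : ∀ x, |v x - w x| ≤ δ := fun x => abs_softThreshold_sub_le hδ0.le _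
  set K : Set Plane := {x | δ ≤ |w x|} with hK
  have hKΩ : K ⊆ Ω := by
    intro x hx
    by_contra hxΩ
    have : δ ≤ |w x| := hx
    rw [hw0 x hxΩ, abs_zero] at this
    linarith
  have hKc : IsCompact K := Metric.isCompact_of_isClosed_isBounded
    (isClosed_le continuous_const hw.continuous.abs) (hΩ.subset hKΩ)
  have hvK : ∀ x ∉ K, v x = 0 := fun x hx => softThreshold_eq_zero (not_le.1 hx).le
  obtain ⟨ρ, hρ, hρΩ⟩ := hKc.exists_cthickening_subset_open Ω.isOpen hKΩ
  -- The radius ρ keeps the mollified support inside Ω, and δ/(L + 1) bounds the mollification error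
  -- by δ; the 1 guards against L = 0.
  set r := min ρ (δ / (L + 1)) with hr
  have hr0 : 0 < r := by positivity
  let f : ContDiffBump (0 : Plane) := ⟨r / 2, r, by positivity, by linarith⟩
  have hfr : f.rOut = 2 * f.rIn := by simp only [f]; ring
  have hk0 := f.nonneg_normed (μ := volume)
  have hkint : ∫⁻ t, ENNReal.ofReal (f.normed volume t) = 1 := by
    rw [← ofReal_integral_eq_lintegral_ofReal f.integrable_normed (Eventually.of_forall hk0),
      f.integral_normed]
    simp
  set φ : Plane → ℝ := convolution (f.normed volume) v (ContinuousLinearMap.lsmul ℝ ℝ) volume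
    with hφ
  have hφint : ∀ x, Integrable (fun t => f.normed volume t * v (x - t)) := fun x =>
    (f.continuous_normed.mul (hvL.continuous.comp (by fun_prop))).integrable_of_hasCompactSupport
      f.hasCompactSupport_normed.mul_right
  have hφx : ∀ x, φ x = ∫ t, f.normed volume t * v (x - t) := fun x => by
    simp [hφ, convolution]
  have hφe : ∀ x y, edist (φ x) (φ y) ≤
      ∫⁻ t, ENNReal.ofReal (f.normed volume t) * edist (v (x - t)) (v (y - t)) := by
    intro x y
    rw [edist_eq_enorm_sub, hφx, hφx, ← integral_sub (hφint x) (hφint y)]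
    refine (enorm_integral_le_lintegral_enorm _).trans_eq (lintegral_congr fun t => ?_)
    rw [← mul_sub, enorm_mul, Real.enorm_of_nonneg (hk0 t), edist_eq_enorm_sub]
  have hφL : LipschitzWith L φ := by
    intro x y
    refine (hφe x y).trans ?_
    calc ∫⁻ t, ENNReal.ofReal (f.normed volume t) * edist (v (x - t)) (v (y - t))
        ≤ ∫⁻ t, ENNReal.ofReal (f.normed volume t) * (L * edist x y) := by
          gcongr with t
          simpa using hvL (x - t) (y - t)
      _ = L * edist x y := by
          rw [lintegral_mul_const' _ _ (ENNReal.mul_ne_top ENNReal.coe_ne_top (edist_ne_top x y)),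
            hkint, one_mul]
  have hφd : ∀ x, dist (φ x) (v x) ≤ δ := by
    intro x
    refine f.dist_normed_convolution_le hvL.continuous.aestronglyMeasurable fun y hy => ?_
    refine (hvL.dist_le_mul y x).trans ?_
    have hy' : dist y x ≤ δ / (L + 1) := (le_of_lt hy).trans (min_le_right _ _)
    calc L * dist y x ≤ (L + 1) * (δ / (L + 1)) := by gcongr; linarith
      _ = δ := by field_simp
  have hφc : ContDiff ℝ ∞ φ :=
    f.hasCompactSupport_normed.contDiff_convolution_left _ f.contDiff_normed
      hvL.continuous.locallyIntegrable
  have hsupp : Function.support φ ⊆ cthickening ρ K := by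
    intro x hx
    by_contra hxK
    refine hx ?_
    rw [hφx]
    refine integral_eq_zero_of_ae (Eventually.of_forall fun t => ?_)
    by_cases ht : t ∈ Function.support (f.normed volume)
    · rw [f.support_normed_eq, mem_ball, dist_zero_right] at ht
      have h1 : x - t ∉ K := fun h => hxK (mem_cthickening_of_dist_le x (x - t) ρ K h (by
        rw [dist_eq_norm, sub_sub_cancel]
        exact ht.le.trans (min_le_left _ _)))
      simp [hvK _ h1]
    · simp [Function.notMem_support.1 ht]
  have htsupp : tsupport φ ⊆ cthickening ρ K := closure_minimal hsupp isClosed_cthickening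
  have hcomp : HasCompactSupport φ :=
    HasCompactSupport.of_support_subset_isCompact hKc.cthickening hsupp
  -- This bound does not involve L: averaging the two-point estimate against the kernel gives kernel
  -- means of m near x and near y, each at most 6 times the maximal function at x.
  have hgrad : ∀ x, ‖gradient φ x‖ₑ ≤ 12 * maximalFunction m x := by
    intro x
    by_cases htop : maximalFunction m x = ⊤
    · simp [htop]
    have h12 : 12 * maximalFunction m x ≠ ⊤ := ENNReal.mul_ne_top (by norm_num) htop
    have hmp : ∀ y, MeasurePreserving (fun t : Plane => y - t) volume volume := fun y =>
      Measure.measurePreserving_sub_left volume y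
    have hlip : ∀ y, dist y x ≤ r → edist (φ y) (φ x) ≤ 12 * maximalFunction m x * edist y x := by
      intro y hy
      refine (hφe y x).trans ?_
      calc ∫⁻ t, ENNReal.ofReal (f.normed volume t) * edist (v (y - t)) (v (x - t))
          ≤ ∫⁻ t, (ENNReal.ofReal (f.normed volume t) * m (y - t) +
              ENNReal.ofReal (f.normed volume t) * m (x - t)) * edist y x := by
            have hZae : ∀ᵐ z : Plane, z ∉ Z := measure_eq_zero_iff_ae_notMem.1 hZ
            refine lintegral_mono_ae ?_
            filter_upwards [(hmp y).quasiMeasurePreserving.ae hZae,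
              (hmp x).quasiMeasurePreserving.ae hZae] with t ht1 ht2
            rw [← mul_add, mul_assoc, mul_comm (_ + _)]
            gcongr
            refine (hvw _ _).trans ((hwm _ ht1 _ ht2).trans_eq ?_)
            rw [edist_sub_right]
        _ = ((∫⁻ t, ENNReal.ofReal (f.normed volume t) * m (y - t)) +
              ∫⁻ t, ENNReal.ofReal (f.normed volume t) * m (x - t)) * edist y x := by
            rw [lintegral_mul_const' _ _ (edist_ne_top y x), lintegral_add_left]
            exact (f.continuous_normed.measurable.ennreal_ofReal).mul (hm.comp (by fun_prop))
        _ ≤ (6 * maximalFunction m x + 6 * maximalFunction m x) * edist y x := by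
            gcongr
            · exact lintegral_normed_mul_le f hfr m hy
            · exact lintegral_normed_mul_le f hfr m (by simpa using hr0.le)
        _ = _ := by ring
    rw [← ofReal_norm, norm_gradient]
    refine ENNReal.ofReal_le_of_le_toReal ?_
    refine ((hφc.differentiable (by simp)) x).hasFDerivAt.le_of_lip' ENNReal.toReal_nonneg ?_
    filter_upwards [closedBall_mem_nhds x hr0] with y hy
    have h1 := ENNReal.toReal_mono (ENNReal.mul_ne_top h12 (edist_ne_top y x)) (hlip y hy)
    rwa [ENNReal.toReal_mul (a := 12 * _), ← dist_edist, ← dist_edist, dist_eq_norm,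
      dist_eq_norm] at h1
  refine ⟨⟨φ, hφc, hcomp, htsupp.trans hρΩ⟩, fun x => ?_, fun x => ?_, ?_⟩
  · have h1 := hφd x
    rw [Real.dist_eq] at h1
    calc |φ x - w x| ≤ |φ x - v x| + |v x - w x| := abs_sub_le _ _ _
      _ ≤ η := by linarith [hvd x]
  · refine (norm_gradient φ x).trans_le ?_
    exact norm_fderiv_le_of_lipschitz ℝ hφL
  · calc ∫⁻ x, ‖gradient φ x‖ₑ ^ 2 ≤ ∫⁻ x, (12 * maximalFunction m x) ^ 2 := by
          gcongr with x
          exact hgrad x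
      _ = 144 * ∫⁻ x, maximalFunction m x ^ 2 := by
          rw [← lintegral_const_mul' _ _ (by norm_num)]
          refine lintegral_congr fun x => ?_
          rw [mul_pow]
          norm_num
      _ ≤ _ := by
          gcongr
          exact lintegral_maximalFunction_sq_le hm

end Mollification

/-! ### Lipschitz truncation -/

section Truncation

variable {Ω : Opens Plane}

/-- Lipschitz truncation of an element of `W₀^{1,2}(Ω)`. -/
theorem IsBoundedLipschitzDomain.exists_lipschitz_truncation (hΩ : IsBoundedLipschitzDomain Ω)
    (u : W012 Ω) :
    ∃ (C : ℝ≥0) (A B : ℝ) (K : ℝ≥0∞) (n : Plane → ℝ), 0 ≤ A ∧ 0 ≤ B ∧ K ≠ ⊤ ∧ Measurable n ∧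
      (∀ x, 0 ≤ n x) ∧ ∫⁻ x, ENNReal.ofReal (n x) ^ 2 ≠ ⊤ ∧
      ∀ s : ℝ, 1 ≤ s → ∀ η : ℝ, 0 < η → ∃ φ : 𝓓(Ω, ℝ), (∀ x, ‖gradient φ x‖ ≤ C * s) ∧
        ∫⁻ x, ‖gradient φ x‖ₑ ^ 2 ≤ K ∧
        ∀ᵐ x, |φ x - extendZero u x| ≤
          η + {x | s < n x}.indicator (fun x => A + B * Real.sqrt (Real.log (n x))) x := by
  obtain ⟨C, D, hD, h⟩ := hΩ.exists_pointwise_bounds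
  obtain ⟨Z, hZΩ, hZ0, hlip, hlog⟩ := h u
  set N := gradMax u with hN
  have hNm : Measurable N := measurable_gradMax u
  have hN2 : ∫⁻ x, N x ^ 2 < ⊤ := lintegral_gradMax_sq_lt_top u
  have hNae : ∀ᵐ x, N x < ⊤ := by
    filter_upwards [ae_lt_top (hNm.pow_const 2) hN2.ne] with x hx
    exact lt_top_iff_ne_top.2 fun h => by simp [h] at hx
  set A₀ := 8 * D with hA₀
  set B₀ := 2 * ‖gradOf u‖ with hB₀
  have hB₀0 : 0 ≤ B₀ := by positivity
  -- The scale r = D/s balances the logarithmic bound: r N ≤ D, and log(D/r) = log s.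
  have hbound : ∀ x ∉ Z, ∀ s : ℝ, 1 ≤ s → N x ≤ ENNReal.ofReal s →
      |extendZero u x| ≤ A₀ + B₀ * Real.sqrt (Real.log s) := by
    intro x hx s hs hxs
    have hs0 : 0 < s := by linarith
    have h1 := hlog x hx (D / s) (by positivity) (div_le_self hD.le hs)
    rw [div_div_cancel₀ hD.ne'] at h1
    have h2 : ‖extendZero u x‖ₑ ≤ ENNReal.ofReal (A₀ + B₀ * Real.sqrt (Real.log s)) := by
      refine h1.trans ?_
      rw [ENNReal.ofReal_add (by positivity) (by positivity)]
      refine add_le_add ?_ (le_of_eq ?_)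
      · calc ENNReal.ofReal (8 * (D / s)) * N x
            ≤ ENNReal.ofReal (8 * (D / s)) * ENNReal.ofReal s := by gcongr
          _ = ENNReal.ofReal A₀ := by
              rw [← ENNReal.ofReal_mul (by positivity)]
              congr 1
              rw [hA₀]
              field_simp
      · rw [← ofReal_norm, ← ENNReal.ofReal_mul (by positivity)]
        congr 1
        rw [hB₀]
        ring
    rwa [← ofReal_norm, ENNReal.ofReal_le_ofReal_iff (by positivity), Real.norm_eq_abs] at h2
  refine ⟨2 * C, 2 * A₀, 2 * B₀, 144 * (ENNReal.ofReal (128 * Real.pi ^ 2) *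
    ∫⁻ x, (2 * C * N x) ^ 2), fun x => (N x).toReal, by positivity, by positivity, ?_,
    hNm.ennreal_toReal, fun x => ENNReal.toReal_nonneg, ?_, ?_⟩
  · refine ENNReal.mul_ne_top (by norm_num) (ENNReal.mul_ne_top ENNReal.ofReal_ne_top ?_)
    simp only [mul_pow]
    rw [lintegral_const_mul _ (hNm.pow_const 2)]
    exact ENNReal.mul_ne_top (by simp [← mul_pow, ENNReal.mul_eq_top]) hN2.ne
  · refine ne_top_of_le_ne_top hN2.ne (lintegral_mono fun x => ?_)
    dsimp only
    gcongr
    exact ENNReal.ofReal_toReal_le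
  intro s hs η hη
  have hs0 : 0 < s := by linarith
  set b := A₀ + B₀ * Real.sqrt (Real.log s) with hb
  have hb0 : 0 ≤ b := by positivity
  -- The good set contains the complement of Ω, where N = 0, so the Lipschitz extension from `G`
  -- still vanishes there.
  set G : Set Plane := {x | x ∉ Z ∧ N x ≤ ENNReal.ofReal s} with hG
  have hGΩ : ∀ x ∉ Ω, x ∈ G := fun x hx => ⟨fun h => hx (hZΩ h), by
    have : N x = 0 := indicator_of_notMem hx _
    simp [this]⟩
  have hUG : LipschitzOnWith (2 * C * s.toNNReal) (extendZero u) G := by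
    intro x hx y hy
    refine (hlip x hx.1 y hy.1).trans ?_
    calc C * edist x y * (N x + N y)
        ≤ C * edist x y * (ENNReal.ofReal s + ENNReal.ofReal s) := by
          gcongr
          exacts [hx.2, hy.2]
      _ = _ := by
          rw [← two_mul]
          push_cast
          rw [ENNReal.ofReal]
          ring
  obtain ⟨w₀, hw₀L, hw₀⟩ := hUG.extend_real
  -- Clamping changes nothing on `G`, where |u| ≤ b, and keeps the error on the bad set logarithmic.
  set w : Plane → ℝ := fun x => max (-b) (min (w₀ x) b) with hw
  have hwL : LipschitzWith (2 * C * s.toNNReal) w := (hw₀L.min_const b).const_max (-b)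
  have hwG : ∀ x ∈ G, w x = extendZero u x := by
    intro x hx
    have h1 := abs_le.1 (hbound x hx.1 s hs hx.2)
    simp only [hw]
    rw [← hw₀ hx, min_eq_left h1.2, max_eq_right h1.1]
  have hwb : ∀ x, |w x| ≤ b := fun x => by
    rw [abs_le]
    exact ⟨le_max_left _ _, max_le (by linarith) (min_le_right _ _)⟩
  -- Where N ≥ s at one of the points, the Lipschitz constant 2Cs is itself at most 2CN; elsewhere w
  -- = u. This makes the L² gradient bound independent of s.
  have hwm : ∀ x ∉ Z, ∀ y ∉ Z, edist (w x) (w y) ≤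
      edist x y * (2 * C * N x + 2 * C * N y) := by
    have hbad : ∀ x y, ENNReal.ofReal s ≤ N x →
        edist (w x) (w y) ≤ edist x y * (2 * C * N x) := by
      intro x y hxs
      refine (hwL x y).trans ?_
      push_cast
      rw [mul_comm]
      gcongr
      exact hxs
    intro x hx y hy
    rcases le_total (N x) (ENNReal.ofReal s) with hxs | hxs
    · rcases le_total (N y) (ENNReal.ofReal s) with hys | hys
      · rw [hwG x ⟨hx, hxs⟩, hwG y ⟨hy, hys⟩]
        refine (hlip x hx y hy).trans ?_
        rw [← mul_add, ← mul_assoc, mul_comm (edist x y)]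
        gcongr
        exact le_mul_of_one_le_left zero_le (by norm_num)
      · rw [edist_comm, edist_comm x]
        refine (hbad y x hys).trans ?_
        gcongr
        exact le_add_self
    · refine (hbad x y hxs).trans ?_
      gcongr
      exact le_self_add
  obtain ⟨φ, hφw, hφL, hφ2⟩ := exists_test_approx hΩ.isBounded hwL (fun x hx => by
    rw [hwG x (hGΩ x hx)]
    exact indicator_of_notMem hx _) (hNm.const_mul (2 * (C : ℝ≥0∞))) hZ0 hwm hη
  refine ⟨φ, fun x => (hφL x).trans_eq ?_, hφ2, ?_⟩
  · push_cast
    rw [Real.coe_toNNReal _ hs0.le]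
  · filter_upwards [hNae, measure_eq_zero_iff_ae_notMem.1 hZ0] with x hxN hxZ
    by_cases hxs : s < (N x).toReal
    · rw [indicator_of_mem (by exact hxs)]
      have h1 := hbound x hxZ (N x).toReal (hs.trans hxs.le) (by rw [ENNReal.ofReal_toReal hxN.ne])
      have h2 : b ≤ A₀ + B₀ * Real.sqrt (Real.log (N x).toReal) := by
        rw [hb]
        gcongr
      have h3 := hφw x
      calc |φ x - extendZero u x| ≤ |φ x - w x| + |w x - extendZero u x| := abs_sub_le _ _ _
        _ ≤ |φ x - w x| + (|w x| + |extendZero u x|) := by gcongr; exact abs_sub _ _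
        _ ≤ _ := by linarith [hwb x]
    · rw [indicator_of_notMem (by exact hxs), add_zero, ← hwG x ⟨hxZ, ?_⟩]
      · exact hφw x
      · rw [← ENNReal.ofReal_toReal hxN.ne]
        exact ENNReal.ofReal_le_ofReal (not_lt.1 hxs)

end Truncation

/-! ### Weak convergence of gradients from distributional convergence -/

section WeakConvergence

variable {Ω : Opens Plane}

theorem gradient_apply (ψ : Plane → ℝ) (x : Plane) (i : Fin 2) :
    gradient ψ x i = fderiv ℝ ψ x (EuclideanSpace.single i 1) := by
  have h : inner ℝ (gradient ψ x) (EuclideanSpace.single i 1) =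
      fderiv ℝ ψ x (EuclideanSpace.single i 1) := InnerProductSpace.toDual_symm_apply
  rw [← h, EuclideanSpace.inner_single_right]
  simp

theorem inner_gradient_eq_sum (φ ψ : Plane → ℝ) (x : Plane) :
    inner ℝ (gradient φ x) (gradient ψ x) =
      ∑ i : Fin 2, fderiv ℝ φ x (EuclideanSpace.single i 1) *
        fderiv ℝ ψ x (EuclideanSpace.single i 1) := by
  simp only [PiLp.inner_apply, gradient_apply]
  simp [mul_comm]

/-- The weak form of the Laplacian on test functions. -/
theorem exists_integral_inner_gradient_eq (ψ : 𝓓(Ω, ℝ)) :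
    ∃ L : Plane → ℝ, Continuous L ∧ HasCompactSupport L ∧ ∀ φ : 𝓓(Ω, ℝ),
      ∫ x in (Ω : Set Plane), inner ℝ (gradient φ x) (gradient ψ x) =
        ∫ x in (Ω : Set Plane), φ x * L x := by
  set e : Fin 2 → Plane := fun i => EuclideanSpace.single i 1
  set d : Fin 2 → Plane → ℝ := fun i x => fderiv ℝ ψ x (e i) with hd
  have hdc : ∀ i, ContDiff ℝ 1 (d i) := fun i =>
    (ψ.contDiff.fderiv_right (m := 1) (WithTop.coe_le_coe.2 (le_top : (1 + 1 : ℕ∞) ≤ ⊤))).clm_apply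
      contDiff_const
  have hds : ∀ i, HasCompactSupport (d i) := fun i => ψ.hasCompactSupport.fderiv_apply ℝ (e i)
  set L : Fin 2 → Plane → ℝ := fun i x => fderiv ℝ (d i) x (e i) with hL
  have hLc : ∀ i, Continuous (L i) := fun i =>
    ((hdc i).continuous_fderiv (by simp)).clm_apply continuous_const
  have hLs : ∀ i, HasCompactSupport (L i) := fun i => (hds i).fderiv_apply ℝ (e i)
  -- The witness is -Δψ.
  refine ⟨fun x => -(L 0 x + L 1 x), ((hLc 0).add (hLc 1)).neg, ((hLs 0).add (hLs 1)).neg,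
    fun φ => ?_⟩
  have hφc : ∀ i, Continuous fun x => fderiv ℝ φ x (e i) := fun i =>
    (φ.contDiff.continuous_fderiv (by simp)).clm_apply continuous_const
  have hi1 : ∀ i, Integrable fun x => fderiv ℝ φ x (e i) * d i x := fun i =>
    ((hφc i).mul (hdc i).continuous).integrable_of_hasCompactSupport (hds i).mul_left
  have hi2 : ∀ i, Integrable fun x => φ x * L i x := fun i =>
    (φ.continuous.mul (hLc i)).integrable_of_hasCompactSupport (hLs i).mul_left
  have hi3 : ∀ i, Integrable fun x => φ x * d i x := fun i =>
    (φ.continuous.mul (hdc i).continuous).integrable_of_hasCompactSupport (hds i).mul_left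
  have hibp : ∀ i, ∫ x, fderiv ℝ φ x (e i) * d i x = - ∫ x, φ x * L i x := by
    intro i
    rw [integral_mul_fderiv_eq_neg_fderiv_mul_of_integrable (hi1 i) (hi2 i) (hi3 i)
      (fun x _ => (φ.contDiff.differentiable (by simp)) x)
      (fun x _ => ((hdc i).differentiable (by simp)) x), neg_neg]
  rw [setIntegral_eq_integral_of_forall_compl_eq_zero fun x hx => by
      rw [TestFunction.gradient_eq_zero_of_notMem φ hx, inner_zero_left],
    setIntegral_eq_integral_of_forall_compl_eq_zero fun x hx => by
      rw [TestFunction.eq_zero_of_notMem φ hx, zero_mul]]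
  simp only [inner_gradient_eq_sum, Fin.sum_univ_two]
  rw [integral_add (hi1 0) (hi1 1), hibp, hibp, ← neg_add, ← integral_add (hi2 0) (hi2 1),
    ← integral_neg]
  refine integral_congr_ae (Eventually.of_forall fun x => ?_)
  dsimp only
  ring

theorem inner_gradOf_ofTest (u : W012 Ω) (ψ : 𝓓(Ω, ℝ)) :
    inner ℝ (gradOf u) (gradOf (ofTest ψ)) =
      ∫ x in (Ω : Set Plane), inner ℝ (gradOf u x) (gradient ψ x) := by
  rw [L2.inner_def]
  refine integral_congr_ae ?_
  filter_upwards [gradOf_ofTest ψ] with x hx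
  rw [hx]

theorem inner_gradOf_ofTest_ofTest (φ ψ : 𝓓(Ω, ℝ)) :
    inner ℝ (gradOf (ofTest φ)) (gradOf (ofTest ψ)) =
      ∫ x in (Ω : Set Plane), inner ℝ (gradient φ x) (gradient ψ x) := by
  rw [inner_gradOf_ofTest]
  refine integral_congr_ae ?_
  filter_upwards [gradOf_ofTest φ] with x hx
  rw [hx]

theorem continuous_valueOf : Continuous (valueOf : W012 Ω → _) :=
  (WithLp.continuous_fst _ _ _).comp continuous_subtype_val

theorem continuous_gradOf : Continuous (gradOf : W012 Ω → _) :=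
  (WithLp.continuous_snd _ _ _).comp continuous_subtype_val

/-- Both sides are continuous in u for the Sobolev norm, so the identity extends from test functions
by density. -/
theorem exists_inner_gradOf_eq (ψ : 𝓓(Ω, ℝ)) :
    ∃ L : Plane → ℝ, Continuous L ∧ HasCompactSupport L ∧ ∀ u : W012 Ω,
      inner ℝ (gradOf u) (gradOf (ofTest ψ)) = ∫ x in (Ω : Set Plane), valueOf u x * L x := by
  obtain ⟨L, hLc, hLs, hL⟩ := exists_integral_inner_gradient_eq ψ
  refine ⟨L, hLc, hLs, fun u => ?_⟩
  have hLm : MemLp L 2 (volumeOn Ω) := hLc.memLp_of_hasCompactSupport hLs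
  have hinner : ∀ v : W012 Ω, inner ℝ (hLm.toLp L) (valueOf v) =
      ∫ x in (Ω : Set Plane), valueOf v x * L x := by
    intro v
    rw [L2.inner_def]
    refine integral_congr_ae ?_
    filter_upwards [hLm.coeFn_toLp] with x hx
    rw [hx]
    simp
  rw [← hinner]
  obtain ⟨φ, hφ, -⟩ := exists_seq_test_tendsto u
  have h1 : Tendsto (fun n => inner ℝ (gradOf (ofTest (φ n))) (gradOf (ofTest ψ))) atTop
      (𝓝 (inner ℝ (gradOf u) (gradOf (ofTest ψ)))) :=
    ((continuous_gradOf.tendsto u).comp hφ).inner tendsto_const_nhds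
  have h2 : Tendsto (fun n => inner ℝ (hLm.toLp L) (valueOf (ofTest (φ n)))) atTop
      (𝓝 (inner ℝ (hLm.toLp L) (valueOf u))) :=
    tendsto_const_nhds.inner ((continuous_valueOf.tendsto u).comp hφ)
  refine tendsto_nhds_unique h1 (h2.congr fun n => ?_)
  rw [hinner, inner_gradOf_ofTest_ofTest, hL]
  refine integral_congr_ae ?_
  filter_upwards [valueOf_ofTest (φ n)] with x hx
  rw [hx]

/-- Test functions which are bounded in `W₀^{1,2}(Ω)` and converge to `u` in the sense of
distributions have gradients which converge weakly to the gradient of `u`. -/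
theorem tendsto_inner_gradOf {u : W012 Ω} {φ : ℕ → 𝓓(Ω, ℝ)} {K : ℝ}
    (hK : ∀ n, ‖gradOf (ofTest (φ n))‖ ≤ K)
    (hφ : ∀ L : Plane → ℝ, Continuous L → HasCompactSupport L →
      Tendsto (fun n => ∫ x in (Ω : Set Plane), φ n x * L x) atTop
        (𝓝 (∫ x in (Ω : Set Plane), valueOf u x * L x))) :
    Tendsto (fun n => inner ℝ (gradOf (ofTest (φ n))) (gradOf u)) atTop
      (𝓝 (‖gradOf u‖ ^ 2)) := by
  have hK0 : 0 ≤ K := (norm_nonneg _).trans (hK 0)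
  rw [← real_inner_self_eq_norm_sq, Metric.tendsto_atTop]
  intro ε hε
  set η := ε / (2 * (K + ‖gradOf u‖ + 1)) with hη
  have hη0 : 0 < η := by positivity
  obtain ⟨ψ', hψ', -⟩ := exists_seq_test_tendsto u
  have h1 := (continuous_gradOf.tendsto u).comp hψ'
  obtain ⟨m, hm⟩ := ((Metric.tendsto_nhds.1 h1) η hη0).exists
  set ψ := ψ' m
  have hm' : ‖gradOf u - gradOf (ofTest ψ)‖ < η := by
    rw [← dist_eq_norm, dist_comm]; exact hm
  obtain ⟨L, hLc, hLs, hL⟩ := exists_inner_gradOf_eq ψ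
  have h2 := hφ L hLc hLs
  have h3 : Tendsto (fun n => inner ℝ (gradOf (ofTest (φ n))) (gradOf (ofTest ψ))) atTop
      (𝓝 (inner ℝ (gradOf u) (gradOf (ofTest ψ)))) := by
    rw [hL]
    refine h2.congr fun n => ?_
    rw [hL]
    refine integral_congr_ae ?_
    filter_upwards [valueOf_ofTest (φ n)] with x hx
    rw [hx]
  obtain ⟨N, hN⟩ := (Metric.tendsto_atTop.1 h3) (ε / 2) (by positivity)
  refine ⟨N, fun n hn => ?_⟩
  have h4 := hN n hn
  rw [Real.dist_eq] at h4 ⊢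
  set X := gradOf (ofTest (φ n))
  set Y := gradOf (ofTest ψ)
  set G := gradOf u
  -- With Y = ∇ψ close to ∇u, the first bracket tends to 0 by distributional convergence and the
  -- last term is small uniformly in n.
  have h5 : inner ℝ X G - inner ℝ G G = (inner ℝ X Y - inner ℝ G Y) + inner ℝ (X - G) (G - Y) := by
    simp only [inner_sub_left, inner_sub_right]
    ring
  rw [h5]
  have h6 : |inner ℝ (X - G) (G - Y)| ≤ (K + ‖G‖) * η := by
    refine (abs_real_inner_le_norm _ _).trans ?_
    gcongr
    exact (norm_sub_le _ _).trans (by gcongr; exact hK n)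
  have h7 : (K + ‖G‖) * η ≤ ε / 2 := by
    rw [hη, ← mul_div_assoc, div_le_div_iff₀ (by positivity) (by norm_num)]
    nlinarith [norm_nonneg G]
  exact (abs_add_le _ _).trans_lt (by linarith)

end WeakConvergence

/-! ### Drift integrals over superlevel sets -/

section DriftIntegrals

variable {μ : Measure Plane} {a : Plane → Plane} {n : Plane → ℝ}

/-- Hölder with exponents 2-ε and (2-ε)/(1-ε): the power of n is the one that the conjugate exponent
turns into n². Replacing the root of ∫ n² by 1 + ∫ n² makes this factor independent of ε. -/
theorem lintegral_enorm_mul_rpow_le (ha : AEStronglyMeasurable a μ) (hn : Measurable n) {ε : ℝ}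
    (hε : 0 < ε) (hε1 : ε < 1) :
    ∫⁻ x, ‖a x‖ₑ * ENNReal.ofReal (n x) ^ (2 * (1 - ε) / (2 - ε)) ∂μ ≤
      eLpNorm a (ENNReal.ofReal (2 - ε)) μ * (1 + ∫⁻ x, ENNReal.ofReal (n x) ^ 2 ∂μ) := by
  have h1 : 0 < 1 - ε := by linarith
  have h2 : 0 < 2 - ε := by linarith
  have hpq : (2 - ε).HolderConjugate ((2 - ε) / (1 - ε)) := by
    rw [Real.holderConjugate_iff]
    refine ⟨by linarith, ?_⟩
    field_simp
    ring
  refine (ENNReal.lintegral_mul_le_Lp_mul_Lq μ hpq ha.enorm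
    (hn.ennreal_ofReal.pow_const _).aemeasurable).trans ?_
  rw [eLpNorm_eq_lintegral_rpow_enorm_toReal (by simp; linarith) ENNReal.ofReal_ne_top,
    ENNReal.toReal_ofReal h2.le]
  gcongr
  have h3 : ∀ x, (ENNReal.ofReal (n x) ^ (2 * (1 - ε) / (2 - ε))) ^ ((2 - ε) / (1 - ε)) =
      ENNReal.ofReal (n x) ^ 2 := by
    intro x
    rw [← ENNReal.rpow_mul, ← ENNReal.rpow_two]
    congr 1
    field_simp
  simp only [h3]
  set I := ∫⁻ x, ENNReal.ofReal (n x) ^ 2 ∂μ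
  have h4 : 1 / ((2 - ε) / (1 - ε)) ≤ 1 := by
    rw [one_div_div, div_le_one h2]
    linarith
  rcases le_total I 1 with hI | hI
  · exact (ENNReal.rpow_le_one hI (by positivity)).trans le_self_add
  · calc I ^ (1 / ((2 - ε) / (1 - ε))) ≤ I ^ (1 : ℝ) := ENNReal.rpow_le_rpow_of_exponent_le hI h4
      _ ≤ 1 + I := by rw [ENNReal.rpow_one]; exact le_add_self

/-- From log t ≤ t^{2ε}/(2ε). The loss is only ε^{-1/2}, precisely what the hypothesis on a can
absorb. -/
theorem add_mul_sqrt_log_le {A B t ε : ℝ} (hA : 0 ≤ A) (hB : 0 ≤ B) (ht : 1 ≤ t) (hε : 0 < ε)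
    (hε1 : ε ≤ 1 / 4) :
    A + B * Real.sqrt (Real.log t) ≤ (A + B) / Real.sqrt (2 * ε) * t ^ ε := by
  have ht0 : 0 < t := by linarith
  have hs : 0 < Real.sqrt (2 * ε) := Real.sqrt_pos.2 (by positivity)
  have hs1 : Real.sqrt (2 * ε) ≤ 1 := Real.sqrt_le_one.2 (by linarith)
  have h1 : 1 ≤ t ^ ε / Real.sqrt (2 * ε) :=
    (one_le_div hs).2 (hs1.trans (Real.one_le_rpow ht hε.le))
  have h2 : Real.sqrt (Real.log t) ≤ t ^ ε / Real.sqrt (2 * ε) := by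
    refine (Real.sqrt_le_sqrt (Real.log_le_rpow_div ht0.le (ε := 2 * ε) (by positivity))).trans ?_
    rw [Real.sqrt_div' _ (by positivity), mul_comm 2 ε, Real.rpow_mul ht0.le]
    norm_num
    rw [Real.sqrt_sq (by positivity)]
  calc A + B * Real.sqrt (Real.log t)
      ≤ A * (t ^ ε / Real.sqrt (2 * ε)) + B * (t ^ ε / Real.sqrt (2 * ε)) := by
        gcongr
        exact le_mul_of_one_le_right hA h1
    _ = _ := by ring

/-- The exponents add up to 1-ε ≤ 2(1-ε)/(2-ε), the power allowed by Hölder; 1-2ε ≥ 1/2 gives the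
factor 2. -/
theorem add_mul_sqrt_log_mul_rpow_le {A B t ε : ℝ} (hA : 0 ≤ A) (hB : 0 ≤ B) (ht : 1 ≤ t)
    (hε : 0 < ε) (hε1 : ε ≤ 1 / 4) :
    (A + B * Real.sqrt (Real.log t)) * (t ^ (1 - 2 * ε) / (1 - 2 * ε)) ≤
      2 * (A + B) / Real.sqrt (2 * ε) * t ^ (2 * (1 - ε) / (2 - ε)) := by
  have ht0 : 0 < t := by linarith
  have hs : 0 < Real.sqrt (2 * ε) := Real.sqrt_pos.2 (by positivity)
  have h1 : t ^ (1 - 2 * ε) / (1 - 2 * ε) ≤ 2 * t ^ (1 - 2 * ε) := by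
    rw [div_le_iff₀ (by linarith)]
    have : 0 < t ^ (1 - 2 * ε) := by positivity
    nlinarith
  have h2 : t ^ ε * t ^ (1 - 2 * ε) ≤ t ^ (2 * (1 - ε) / (2 - ε)) := by
    rw [← Real.rpow_add ht0]
    refine Real.rpow_le_rpow_of_exponent_le ht ?_
    rw [le_div_iff₀ (by linarith)]
    nlinarith
  calc (A + B * Real.sqrt (Real.log t)) * (t ^ (1 - 2 * ε) / (1 - 2 * ε))
      ≤ ((A + B) / Real.sqrt (2 * ε) * t ^ ε) * (2 * t ^ (1 - 2 * ε)) := by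
        exact mul_le_mul (add_mul_sqrt_log_le hA hB ht hε hε1) h1
          (div_nonneg (by positivity) (by linarith)) (by positivity)
    _ = 2 * (A + B) / Real.sqrt (2 * ε) * (t ^ ε * t ^ (1 - 2 * ε)) := by ring
    _ ≤ _ := by gcongr

theorem lintegral_Ioi_rpow_ge {s₀ ε : ℝ} (hs₀ : 1 ≤ s₀) (hε : 0 < ε) (hε1 : ε ≤ 1 / 4) :
    ENNReal.ofReal (1 / s₀) * ENNReal.ofReal (1 / (2 * ε)) ≤
      ∫⁻ s in Ioi s₀, ENNReal.ofReal (s ^ (-1 - 2 * ε)) := by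
  have hs0 : 0 < s₀ := by linarith
  rw [← ofReal_integral_eq_lintegral_ofReal (integrableOn_Ioi_rpow_of_lt (by linarith) hs0),
    integral_Ioi_rpow_of_lt (by linarith) hs0, ← ENNReal.ofReal_mul (by positivity)]
  · refine ENNReal.ofReal_le_ofReal ?_
    have h1 : -s₀ ^ (-1 - 2 * ε + 1) / (-1 - 2 * ε + 1) = s₀ ^ (-2 * ε) * (1 / (2 * ε)) := by
      rw [show -1 - 2 * ε + 1 = -(2 * ε) by ring, neg_div_neg_eq, neg_mul]
      ring
    rw [h1]
    gcongr
    rw [one_div, ← Real.rpow_neg_one]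
    exact Real.rpow_le_rpow_of_exponent_le hs₀ (by linarith)
  · filter_upwards [ae_restrict_mem measurableSet_Ioi] with s hs
    exact Real.rpow_nonneg (hs0.trans hs).le _

theorem lintegral_Ioi_rpow_indicator_le {s₀ ε t : ℝ} (hs₀ : 1 ≤ s₀) (hε : 0 < ε)
    (hε1 : ε ≤ 1 / 4) :
    ∫⁻ s in Ioi s₀, (Iio t).indicator (fun s => ENNReal.ofReal (s ^ (-2 * ε))) s ≤
      (Ioi s₀).indicator (fun t => ENNReal.ofReal (t ^ (1 - 2 * ε) / (1 - 2 * ε))) t := by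
  rw [lintegral_indicator measurableSet_Iio, Measure.restrict_restrict measurableSet_Iio]
  by_cases ht : s₀ < t
  · have ht0 : 0 < t := by linarith
    rw [indicator_of_mem (by exact ht)]
    have h1 : ∫⁻ s in Iio t ∩ Ioi s₀, ENNReal.ofReal (s ^ (-2 * ε)) ≤
        ∫⁻ s in Ioc 0 t, ENNReal.ofReal (s ^ (-2 * ε)) :=
      lintegral_mono_set fun s hs => by
        have h2 : s < t := hs.1
        have h3 : s₀ < s := hs.2
        exact ⟨by linarith, h2.le⟩
    refine h1.trans (le_of_eq ?_)
    rw [← ofReal_integral_eq_lintegral_ofReal, ← intervalIntegral.integral_of_le ht0.le,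
      integral_rpow (Or.inl (by linarith)), Real.zero_rpow (by linarith)]
    · rw [sub_zero, show -2 * ε + 1 = 1 - 2 * ε by ring]
    · exact (intervalIntegrable_iff_integrableOn_Ioc_of_le ht0.le).1
        (intervalIntegral.intervalIntegrable_rpow' (by linarith))
    · filter_upwards [ae_restrict_mem measurableSet_Ioc] with s hs
      exact Real.rpow_nonneg hs.1.le _
  · have h1 : Iio t ∩ Ioi s₀ = ∅ := by
      ext s
      simp only [mem_inter_iff, mem_Iio, mem_Ioi, mem_empty_iff_false, iff_false, not_and]
      intro h2 h3
      linarith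
    simp [h1]

/-- If `√ε ‖a‖_{2-ε} → 0`, the integrals of `s |a| (A + B √(log n))` over the superlevel sets
`{n > s}` of a square integrable function `n` come arbitrarily close to zero for large `s`. -/
theorem exists_mul_lintegral_superlevel_lt [SFinite μ] (ha : AEStronglyMeasurable a μ)
    (hn : Measurable n) (hn2 : ∫⁻ x, ENNReal.ofReal (n x) ^ 2 ∂μ ≠ ⊤)
    (hlim : Tendsto
      (fun ε : ℝ => ENNReal.ofReal (Real.sqrt ε) * eLpNorm a (ENNReal.ofReal (2 - ε)) μ)
      (𝓝[>] 0) (𝓝 0))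
    {A B : ℝ} (hA : 0 ≤ A) (hB : 0 ≤ B) {c : ℝ≥0∞} (hc : c ≠ 0) {s₀ : ℝ} (hs₀ : 1 ≤ s₀) :
    ∃ s ≥ s₀, ENNReal.ofReal s * ∫⁻ x, {x | s < n x}.indicator
      (fun x => ‖a x‖ₑ * ENNReal.ofReal (A + B * Real.sqrt (Real.log (n x)))) x ∂μ < c := by
  -- The quantity would be at least c for every s ≥ s₀. Integrating this against s^{-1-2ε} ds makes
  -- the left side of order 1/ε, while exchanging integrals bounds the right side by ε^{-1/2}
  -- ‖a‖_{2-ε}.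
  by_contra! hcon
  have hs0 : 0 < s₀ := by linarith
  set F : Plane → ℝ≥0∞ := fun x => ‖a x‖ₑ * ENNReal.ofReal (A + B * Real.sqrt (Real.log (n x)))
    with hF
  have hFm : AEMeasurable F μ :=
    ha.enorm.mul (((hn.log.sqrt).const_mul B).const_add A).ennreal_ofReal.aemeasurable
  set I := ∫⁻ x, ENNReal.ofReal (n x) ^ 2 ∂μ with hI
  have hkey : ∀ ε : ℝ, 0 < ε → ε ≤ 1 / 4 → c * ENNReal.ofReal (1 / s₀) ≤
      ENNReal.ofReal (2 * (A + B) * Real.sqrt 2) * (1 + I) *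
        (ENNReal.ofReal (Real.sqrt ε) * eLpNorm a (ENNReal.ofReal (2 - ε)) μ) := by
    intro ε hε hε1
    have hsq : 0 < Real.sqrt (2 * ε) := Real.sqrt_pos.2 (by positivity)
    have hset : MeasurableSet {p : ℝ × Plane | p.1 < n p.2} :=
      measurableSet_lt measurable_fst (hn.comp measurable_snd)
    have hjoint : AEMeasurable (fun p : ℝ × Plane => ENNReal.ofReal (p.1 ^ (-2 * ε)) *
        {p : ℝ × Plane | p.1 < n p.2}.indicator (fun p => F p.2) p)
        ((volume.restrict (Ioi s₀)).prod μ) :=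
      (by fun_prop : Measurable fun p : ℝ × Plane =>
        ENNReal.ofReal (p.1 ^ (-2 * ε))).aemeasurable.mul (hFm.comp_snd.indicator hset)
    have h1 : c * ENNReal.ofReal (1 / s₀) * ENNReal.ofReal (1 / (2 * ε)) ≤
        ENNReal.ofReal (2 * (A + B) / Real.sqrt (2 * ε)) *
          (eLpNorm a (ENNReal.ofReal (2 - ε)) μ * (1 + I)) := by
      calc c * ENNReal.ofReal (1 / s₀) * ENNReal.ofReal (1 / (2 * ε))
          ≤ c * ∫⁻ s in Ioi s₀, ENNReal.ofReal (s ^ (-1 - 2 * ε)) := by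
            rw [mul_assoc]
            exact mul_le_mul_right (lintegral_Ioi_rpow_ge hs₀ hε hε1) _
        _ ≤ ∫⁻ s in Ioi s₀, ENNReal.ofReal (s ^ (-1 - 2 * ε)) *
              (ENNReal.ofReal s * ∫⁻ x, {x | s < n x}.indicator F x ∂μ) := by
            rw [← lintegral_const_mul _ (by fun_prop)]
            refine setLIntegral_mono' measurableSet_Ioi fun s hs => ?_
            rw [mul_comm]
            gcongr
            exact hcon s (le_of_lt hs)
        _ = ∫⁻ s in Ioi s₀, ∫⁻ x, ENNReal.ofReal (s ^ (-2 * ε)) *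
              {p : ℝ × Plane | p.1 < n p.2}.indicator (fun p => F p.2) (s, x) ∂μ := by
            refine setLIntegral_congr_fun measurableSet_Ioi fun s hs => ?_
            have hs' : 0 < s := hs0.trans hs
            rw [lintegral_const_mul' _ _ ENNReal.ofReal_ne_top, ← mul_assoc,
              ← ENNReal.ofReal_mul (by positivity)]
            congr 2
            rw [← Real.rpow_add_one hs'.ne']
            congr 1
            ring
        _ = ∫⁻ x, (∫⁻ s in Ioi s₀, ENNReal.ofReal (s ^ (-2 * ε)) *
              {p : ℝ × Plane | p.1 < n p.2}.indicator (fun p => F p.2) (s, x)) ∂μ :=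
            lintegral_lintegral_swap hjoint
        _ ≤ ∫⁻ x, ENNReal.ofReal (2 * (A + B) / Real.sqrt (2 * ε)) *
              (‖a x‖ₑ * ENNReal.ofReal (n x) ^ (2 * (1 - ε) / (2 - ε))) ∂μ := by
            refine lintegral_mono fun x => ?_
            have h2 : ∀ s, ENNReal.ofReal (s ^ (-2 * ε)) *
                {p : ℝ × Plane | p.1 < n p.2}.indicator (fun p => F p.2) (s, x) =
                (Iio (n x)).indicator (fun s => ENNReal.ofReal (s ^ (-2 * ε))) s * F x := by
              intro s
              by_cases hs : s < n x
              · rw [indicator_of_mem (by exact hs), indicator_of_mem (by exact hs)]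
              · rw [indicator_of_notMem (by exact hs), indicator_of_notMem (by exact hs),
                  mul_zero, zero_mul]
            simp only [h2]
            rw [lintegral_mul_const _ (by
              exact (by fun_prop : Measurable fun s : ℝ =>
                ENNReal.ofReal (s ^ (-2 * ε))).indicator measurableSet_Iio)]
            refine (mul_le_mul_left (lintegral_Ioi_rpow_indicator_le hs₀ hε hε1) _).trans ?_
            by_cases hx : s₀ < n x
            · have hx1 : 1 ≤ n x := by linarith
              rw [indicator_of_mem (by exact hx), hF]
              dsimp only
              have h3 : 0 ≤ n x ^ (1 - 2 * ε) / (1 - 2 * ε) :=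
                div_nonneg (Real.rpow_nonneg (by linarith) _) (by linarith)
              rw [mul_left_comm, mul_left_comm _ ‖a x‖ₑ, ENNReal.ofReal_rpow_of_pos (by linarith),
                ← ENNReal.ofReal_mul h3, mul_comm (n x ^ _ / _),
                ← ENNReal.ofReal_mul (by positivity)]
              exact mul_le_mul_right (ENNReal.ofReal_le_ofReal
                (add_mul_sqrt_log_mul_rpow_le hA hB hx1 hε hε1)) _
            · rw [indicator_of_notMem (by exact hx), zero_mul]
              exact zero_le
        _ ≤ _ := by
            rw [lintegral_const_mul' _ _ ENNReal.ofReal_ne_top]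
            gcongr
            exact lintegral_enorm_mul_rpow_le ha hn hε (by linarith)
    -- Multiplying by 2ε turns ε^{-1/2} into √ε, so the hypothesis sends the right side to 0.
    calc c * ENNReal.ofReal (1 / s₀)
        = ENNReal.ofReal (2 * ε) *
            (c * ENNReal.ofReal (1 / s₀) * ENNReal.ofReal (1 / (2 * ε))) := by
          rw [mul_left_comm, ← ENNReal.ofReal_mul (by positivity),
            mul_one_div_cancel (by positivity)]
          simp
      _ ≤ ENNReal.ofReal (2 * ε) * (ENNReal.ofReal (2 * (A + B) / Real.sqrt (2 * ε)) *
          (eLpNorm a (ENNReal.ofReal (2 - ε)) μ * (1 + I))) := mul_le_mul_right h1 _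
      _ = ENNReal.ofReal (2 * (A + B) * Real.sqrt 2 * Real.sqrt ε) *
          (eLpNorm a (ENNReal.ofReal (2 - ε)) μ * (1 + I)) := by
          rw [← mul_assoc, ← ENNReal.ofReal_mul (by positivity)]
          congr 2
          rw [mul_assoc _ (Real.sqrt 2), ← Real.sqrt_mul (by norm_num), mul_div_assoc',
            div_eq_iff hsq.ne', mul_assoc (2 * (A + B)), Real.mul_self_sqrt (by positivity)]
          ring
      _ = _ := by
          rw [ENNReal.ofReal_mul (by positivity)]
          ring
  have hl : Tendsto (fun ε : ℝ => ENNReal.ofReal (2 * (A + B) * Real.sqrt 2) * (1 + I) *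
      (ENNReal.ofReal (Real.sqrt ε) * eLpNorm a (ENNReal.ofReal (2 - ε)) μ)) (𝓝[>] 0)
      (𝓝 (ENNReal.ofReal (2 * (A + B) * Real.sqrt 2) * (1 + I) * 0)) :=
    ENNReal.Tendsto.const_mul hlim (Or.inr (ENNReal.mul_ne_top ENNReal.ofReal_ne_top
      (ENNReal.add_ne_top.2 ⟨ENNReal.one_ne_top, hn2⟩)))
  rw [mul_zero] at hl
  have hle : c * ENNReal.ofReal (1 / s₀) ≤ 0 := by
    refine ge_of_tendsto hl ?_
    filter_upwards [Ioc_mem_nhdsGT (show (0 : ℝ) < 1 / 4 by norm_num)] with ε hε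
    exact hkey ε hε.1 hε.2
  rw [nonpos_iff_eq_zero, mul_eq_zero] at hle
  rcases hle with h | h
  · exact hc h
  · rw [ENNReal.ofReal_eq_zero] at h
    exact absurd h (not_le.2 (by positivity))

end DriftIntegrals

/-! ### Lions' projection theorem -/

/-- Lions' projection theorem: a bilinear form which is coercive along a space of test vectors
represents every continuous functional on the test vectors. -/
theorem exists_forall_apply_eq_of_coercive {H V : Type*} [NormedAddCommGroup H]
    [InnerProductSpace ℝ H] [CompleteSpace H] [AddCommGroup V] [Module ℝ V]
    (B : V →ₗ[ℝ] StrongDual ℝ H) (ι : V →ₗ[ℝ] H) {α : ℝ} (hα : 0 < α)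
    (hB : ∀ v, α * ‖ι v‖ ^ 2 ≤ B v (ι v)) (f : StrongDual ℝ H) :
    ∃ u : H, ∀ v, B v u = f (ι v) := by
  set S : V →ₗ[ℝ] H := (InnerProductSpace.toDual ℝ H).symm.toLinearEquiv.toLinearMap ∘ₗ B with hS
  have hSB : ∀ v u, inner ℝ (S v) u = B v u := fun v u =>
    InnerProductSpace.toDual_symm_apply
  have hcoer : ∀ v, α * ‖ι v‖ ≤ ‖S v‖ := by
    intro v
    rcases (norm_nonneg (ι v)).eq_or_lt' with h | h
    · rw [h, mul_zero]; exact norm_nonneg _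
    · have h1 := (hB v).trans ((hSB v (ι v)).symm.le.trans (real_inner_le_norm _ _))
      rw [pow_two, ← mul_assoc] at h1
      exact le_of_mul_le_mul_right h1 h
  -- On the range of S the wanted functional is S v ↦ f(ι v). A linear section σ defines it,
  -- coercivity bounds it, Hahn–Banach extends it to H, and Riesz gives u.
  obtain ⟨σ, hσ⟩ := LinearMap.exists_rightInverse_of_surjective S.rangeRestrict
    S.range_rangeRestrict
  have hσ' : ∀ y : LinearMap.range S, S (σ y) = y := fun y =>
    congrArg Subtype.val (LinearMap.congr_fun hσ y)
  let g : LinearMap.range S →ₗ[ℝ] ℝ := (f : H →ₗ[ℝ] ℝ) ∘ₗ ι ∘ₗ σ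
  have hg : ∀ y, ‖g y‖ ≤ (‖f‖ / α) * ‖y‖ := by
    intro y
    have h1 : ‖ι (σ y)‖ ≤ ‖y‖ / α := by
      rw [le_div_iff₀' hα]
      refine (hcoer (σ y)).trans_eq ?_
      rw [hσ']
      rfl
    calc ‖g y‖ ≤ ‖f‖ * ‖ι (σ y)‖ := f.le_opNorm _
      _ ≤ ‖f‖ * (‖y‖ / α) := by gcongr
      _ = _ := by ring
  obtain ⟨G, hG, -⟩ := exists_extension_norm_eq (LinearMap.range S)
    (g.mkContinuous _ hg)
  refine ⟨(InnerProductSpace.toDual ℝ H).symm G, fun v => ?_⟩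
  rw [← hSB, real_inner_comm, InnerProductSpace.toDual_symm_apply]
  have h1 := hG ⟨S v, LinearMap.mem_range_self S v⟩
  dsimp only at h1
  rw [h1]
  change f (ι (σ _)) = f (ι v)
  -- The choice of section is immaterial: two preimages of S v have the same image under ι by
  -- coercivity.
  have h2 := hcoer (σ ⟨S v, LinearMap.mem_range_self S v⟩ - v)
  rw [map_sub S, hσ'] at h2
  simp only [sub_self, norm_zero] at h2
  have h3 : ‖ι (σ ⟨S v, LinearMap.mem_range_self S v⟩ - v)‖ = 0 :=
    le_antisymm (nonpos_of_mul_nonpos_right h2 hα) (norm_nonneg _)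
  rw [norm_eq_zero, map_sub, sub_eq_zero] at h3
  rw [h3]

/-! ### Poincaré's inequality and integrability of the drift term -/

section Estimates

variable {Ω : Opens Plane}

instance : CompleteSpace (W012 Ω) :=
  (Submodule.isClosed_topologicalClosure (LinearMap.range (testPair Ω))).completeSpace_coe

theorem isFiniteMeasure_volumeOn (hΩ : IsBoundedLipschitzDomain Ω) :
    IsFiniteMeasure (volumeOn Ω) :=
  ⟨by rw [Measure.restrict_apply_univ]; exact hΩ.isBounded.measure_lt_top⟩

/-- The Poincaré inequality. -/
theorem IsBoundedLipschitzDomain.exists_norm_valueOf_le (hΩ : IsBoundedLipschitzDomain Ω) :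
    ∃ K : ℝ, 0 ≤ K ∧ ∀ u : W012 Ω, ‖valueOf u‖ ^ 2 ≤ K * ‖gradOf u‖ ^ 2 := by
  obtain ⟨_, D, hD, h⟩ := hΩ.exists_pointwise_bounds
  refine ⟨(8 * D) ^ 2 * (128 * Real.pi ^ 2), by positivity, fun u => ?_⟩
  obtain ⟨Z, -, hZ0, -, hlog⟩ := h u
  have h1 : ‖valueOf u‖ₑ ^ 2 ≤
      ENNReal.ofReal ((8 * D) ^ 2 * (128 * Real.pi ^ 2)) * ‖gradOf u‖ₑ ^ 2 := by
    rw [← lintegral_extendZero_sq]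
    calc ∫⁻ x, ‖extendZero u x‖ₑ ^ 2
        ≤ ∫⁻ x, ENNReal.ofReal ((8 * D) ^ 2) * gradMax u x ^ 2 := by
          refine lintegral_mono_ae ?_
          filter_upwards [measure_eq_zero_iff_ae_notMem.1 hZ0] with x hx
          -- At the largest scale r = D the logarithm vanishes and |u| ≤ 8 D N remains.
          have h2 := hlog x hx D hD le_rfl
          rw [div_self hD.ne', Real.log_one, Real.sqrt_zero, mul_zero, ENNReal.ofReal_zero,
            zero_mul, add_zero] at h2
          rw [ENNReal.ofReal_pow (by positivity), ← mul_pow]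
          gcongr
      _ ≤ ENNReal.ofReal ((8 * D) ^ 2) *
            (ENNReal.ofReal (128 * Real.pi ^ 2) * ‖gradOf u‖ₑ ^ 2) := by
          rw [lintegral_const_mul' _ _ ENNReal.ofReal_ne_top]
          exact mul_le_mul_right (lintegral_gradMax_sq_le u) _
      _ = _ := by rw [← mul_assoc, ← ENNReal.ofReal_mul (by positivity)]
  rw [← ofReal_norm, ← ofReal_norm, ← ENNReal.ofReal_pow (norm_nonneg _),
    ← ENNReal.ofReal_pow (norm_nonneg _), ← ENNReal.ofReal_mul (by positivity)] at h1
  exact (ENNReal.ofReal_le_ofReal_iff (by positivity)).1 h1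

theorem ae_volumeOn_of_ae {p : Plane → Prop} (h : ∀ᵐ x, p x) : ∀ᵐ x ∂(volumeOn Ω), p x :=
  ae_restrict_of_ae h

theorem extendZero_ae_eq (u : W012 Ω) : extendZero u =ᵐ[volumeOn Ω] valueOf u := by
  filter_upwards [ae_restrict_mem (measurableSet_coe Ω)] with x hx
  exact indicator_of_mem hx _

/-- The pointwise bound |u| ≤ 8D + 2 √(log max(1, N)) is turned into a power of N admissible for
Hölder. One fixed ε with finite norm suffices here; smallness is needed only for uniqueness. -/
theorem exists_lintegral_enorm_mul_le_of_norm_le_one (hΩ : IsBoundedLipschitzDomain Ω)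
    {a : Plane → Plane} (ha : Integrable a (volumeOn Ω)) {ε : ℝ} (hε : 0 < ε) (hε1 : ε ≤ 1 / 4)
    (hfin : eLpNorm a (ENNReal.ofReal (2 - ε)) (volumeOn Ω) ≠ ⊤) :
    ∃ K : ℝ≥0∞, K ≠ ⊤ ∧ ∀ u : W012 Ω, ‖u‖ ≤ 1 →
      ∫⁻ x, ‖valueOf u x‖ₑ * ‖a x‖ₑ ∂(volumeOn Ω) ≤ K := by
  obtain ⟨_, D, hD, h⟩ := hΩ.exists_pointwise_bounds
  set c := (8 * D + 2) / Real.sqrt (2 * ε) with hc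
  have hc0 : 0 ≤ c := by positivity
  set q := 2 * (1 - ε) / (2 - ε) with hq
  refine ⟨ENNReal.ofReal (8 * D) * ∫⁻ x, ‖a x‖ₑ ∂(volumeOn Ω) +
    ENNReal.ofReal c * (eLpNorm a (ENNReal.ofReal (2 - ε)) (volumeOn Ω) *
      (1 + ENNReal.ofReal (128 * Real.pi ^ 2))), ?_, fun u hu => ?_⟩
  · refine ENNReal.add_ne_top.2 ⟨ENNReal.mul_ne_top ENNReal.ofReal_ne_top ha.2.ne,
      ENNReal.mul_ne_top ENNReal.ofReal_ne_top (ENNReal.mul_ne_top hfin ?_)⟩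
    exact ENNReal.add_ne_top.2 ⟨ENNReal.one_ne_top, ENNReal.ofReal_ne_top⟩
  obtain ⟨Z, -, hZ0, -, hlog⟩ := h u
  have hgrad : ‖gradOf u‖ₑ ≤ 1 := by
    rw [← ofReal_norm, ENNReal.ofReal_le_one]
    exact (norm_gradOf_le u).trans hu
  have hNm : Measurable (gradMax u) := measurable_gradMax u
  set n : Plane → ℝ := fun x => (gradMax u x).toReal with hn
  have hnm : Measurable n := hNm.ennreal_toReal
  have hn2 : ∫⁻ x, ENNReal.ofReal (n x) ^ 2 ∂(volumeOn Ω) ≤ ENNReal.ofReal (128 * Real.pi ^ 2) := by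
    calc ∫⁻ x, ENNReal.ofReal (n x) ^ 2 ∂(volumeOn Ω) ≤ ∫⁻ x, gradMax u x ^ 2 := by
          refine (setLIntegral_le_lintegral _ _).trans (lintegral_mono fun x => ?_)
          dsimp only
          gcongr
          exact ENNReal.ofReal_toReal_le
      _ ≤ ENNReal.ofReal (128 * Real.pi ^ 2) * ‖gradOf u‖ₑ ^ 2 := lintegral_gradMax_sq_le u
      _ ≤ _ := mul_le_of_le_one_right zero_le (pow_le_one₀ zero_le hgrad)
  have hNae : ∀ᵐ x, gradMax u x < ⊤ := by
    filter_upwards [ae_lt_top (hNm.pow_const 2) (lintegral_gradMax_sq_lt_top u).ne] with x hx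
    exact lt_top_iff_ne_top.2 fun h => by simp [h] at hx
  have hpt : ∀ᵐ x ∂(volumeOn Ω), ‖valueOf u x‖ₑ ≤
      ENNReal.ofReal (8 * D) + ENNReal.ofReal c * ENNReal.ofReal (n x) ^ q := by
    filter_upwards [extendZero_ae_eq u, ae_volumeOn_of_ae hNae,
      ae_volumeOn_of_ae (measure_eq_zero_iff_ae_notMem.1 hZ0)] with x hx hxN hxZ
    rw [← hx]
    set s := max 1 (n x) with hs
    have hs1 : 1 ≤ s := le_max_left _ _
    have hs0 : 0 < s := by linarith
    have h1 := hlog x hxZ (D / s) (by positivity) (div_le_self hD.le hs1)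
    rw [div_div_cancel₀ hD.ne'] at h1
    have h2 : ‖extendZero u x‖ₑ ≤ ENNReal.ofReal (8 * D + 2 * Real.sqrt (Real.log s)) := by
      refine h1.trans ?_
      rw [ENNReal.ofReal_add (by positivity) (by positivity)]
      refine add_le_add ?_ (mul_le_of_le_one_right zero_le hgrad)
      calc ENNReal.ofReal (8 * (D / s)) * gradMax u x
          ≤ ENNReal.ofReal (8 * (D / s)) * ENNReal.ofReal s := by
            gcongr
            rw [← ENNReal.ofReal_toReal hxN.ne]
            exact ENNReal.ofReal_le_ofReal (le_max_right _ _)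
        _ = ENNReal.ofReal (8 * D) := by
            rw [← ENNReal.ofReal_mul (by positivity)]
            congr 1
            field_simp
    refine h2.trans ?_
    rcases le_total (n x) 1 with hx1 | hx1
    · rw [hs, max_eq_left hx1, Real.log_one, Real.sqrt_zero, mul_zero, add_zero]
      exact le_self_add
    · rw [hs, max_eq_right hx1]
      refine le_trans ?_ le_add_self
      rw [ENNReal.ofReal_rpow_of_pos (by linarith), ← ENNReal.ofReal_mul hc0]
      refine ENNReal.ofReal_le_ofReal ?_
      refine (add_mul_sqrt_log_le (by positivity) (by norm_num) hx1 hε hε1).trans ?_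
      rw [hc]
      gcongr
      rw [hq, le_div_iff₀ (by linarith)]
      nlinarith
  calc ∫⁻ x, ‖valueOf u x‖ₑ * ‖a x‖ₑ ∂(volumeOn Ω)
      ≤ ∫⁻ x, (ENNReal.ofReal (8 * D) * ‖a x‖ₑ +
          ENNReal.ofReal c * (‖a x‖ₑ * ENNReal.ofReal (n x) ^ q)) ∂(volumeOn Ω) := by
        refine lintegral_mono_ae ?_
        filter_upwards [hpt] with x hx
        refine (mul_le_mul_left hx _).trans_eq ?_
        ring
    _ = ENNReal.ofReal (8 * D) * ∫⁻ x, ‖a x‖ₑ ∂(volumeOn Ω) + ENNReal.ofReal c *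
          ∫⁻ x, ‖a x‖ₑ * ENNReal.ofReal (n x) ^ q ∂(volumeOn Ω) := by
        rw [lintegral_add_left' (ha.1.enorm.const_mul _),
          lintegral_const_mul' _ _ ENNReal.ofReal_ne_top,
          lintegral_const_mul' _ _ ENNReal.ofReal_ne_top]
    _ ≤ _ := by
        gcongr
        refine (lintegral_enorm_mul_rpow_le ha.1 hnm hε (by linarith)).trans ?_
        gcongr

theorem exists_eLpNorm_ne_top {μ : Measure Plane} {a : Plane → Plane}
    (hlim : Tendsto
      (fun ε : ℝ => ENNReal.ofReal (Real.sqrt ε) * eLpNorm a (ENNReal.ofReal (2 - ε)) μ)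
      (𝓝[>] 0) (𝓝 0)) :
    ∃ ε : ℝ, 0 < ε ∧ ε ≤ 1 / 4 ∧ eLpNorm a (ENNReal.ofReal (2 - ε)) μ ≠ ⊤ := by
  obtain ⟨ε, hε, hε0, hε1⟩ := ((hlim.eventually (gt_mem_nhds ENNReal.zero_lt_top)).and
    (Ioc_mem_nhdsGT (show (0 : ℝ) < 1 / 4 by norm_num))).exists
  refine ⟨ε, hε0, hε1, fun h => ?_⟩
  rw [h, ENNReal.mul_top (by simpa using Real.sqrt_pos.2 hε0)] at hε
  exact lt_irrefl _ hε

/-- The product of the drift with an element of `W₀^{1,2}(Ω)` is integrable, with a bound. -/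
theorem exists_lintegral_enorm_mul_le (hΩ : IsBoundedLipschitzDomain Ω) {a : Plane → Plane}
    (ha : Integrable a (volumeOn Ω))
    (hlim : Tendsto
      (fun ε : ℝ => ENNReal.ofReal (Real.sqrt ε) * eLpNorm a (ENNReal.ofReal (2 - ε)) (volumeOn Ω))
      (𝓝[>] 0) (𝓝 0)) :
    ∃ K : ℝ, 0 ≤ K ∧ ∀ u : W012 Ω,
      ∫⁻ x, ‖valueOf u x‖ₑ * ‖a x‖ₑ ∂(volumeOn Ω) ≤ ENNReal.ofReal (K * ‖u‖) := by
  obtain ⟨ε, hε, hε1, hfin⟩ := exists_eLpNorm_ne_top hlim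
  obtain ⟨K, hK, h⟩ := exists_lintegral_enorm_mul_le_of_norm_le_one hΩ ha hε hε1 hfin
  refine ⟨K.toReal, ENNReal.toReal_nonneg, fun u => ?_⟩
  rcases eq_or_ne u 0 with rfl | hu
  · have h0 : valueOf (0 : W012 Ω) =ᵐ[volumeOn Ω] 0 := Lp.coeFn_zero _ _ _
    rw [lintegral_congr_ae (g := fun _ => 0)]
    · simp
    · filter_upwards [h0] with x hx
      simp [hx]
  have hu0 : 0 < ‖u‖ := norm_pos_iff.2 hu
  -- The logarithmic estimate is not homogeneous in u, so it is applied on the unit sphere and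
  -- rescaled.
  have h1 := h (‖u‖⁻¹ • u) (by rw [norm_smul, norm_inv, norm_norm, inv_mul_cancel₀ hu0.ne'])
  have h2 : ∫⁻ x, ‖valueOf u x‖ₑ * ‖a x‖ₑ ∂(volumeOn Ω) = ENNReal.ofReal ‖u‖ *
      ∫⁻ x, ‖valueOf (‖u‖⁻¹ • u) x‖ₑ * ‖a x‖ₑ ∂(volumeOn Ω) := by
    rw [← lintegral_const_mul' _ _ ENNReal.ofReal_ne_top]
    refine lintegral_congr_ae ?_
    have h3 := Lp.coeFn_smul ‖u‖⁻¹ (valueOf u)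
    filter_upwards [h3] with x hx
    rw [valueOf_smul, hx, Pi.smul_apply, enorm_smul, ← mul_assoc, ← mul_assoc,
      Real.enorm_of_nonneg (inv_nonneg.2 hu0.le), ← ENNReal.ofReal_mul hu0.le,
      mul_inv_cancel₀ hu0.ne']
    simp
  rw [h2, mul_comm K.toReal, ENNReal.ofReal_mul hu0.le, ENNReal.ofReal_toReal hK]
  exact mul_le_mul_right h1 _

end Estimates

/-! ### Existence, and triviality of homogeneous solutions -/

section Equation

variable {Ω : Opens Plane} {a : Plane → Plane}

theorem gradient_test_add (φ ψ : 𝓓(Ω, ℝ)) :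
    gradient (⇑(φ + ψ)) = gradient φ + gradient ψ := by
  funext x
  have h1 : DifferentiableAt ℝ φ x := (φ.contDiff.differentiable (by simp)) x
  have h2 : DifferentiableAt ℝ ψ x := (ψ.contDiff.differentiable (by simp)) x
  have h3 : fderiv ℝ (⇑(φ + ψ)) x = fderiv ℝ φ x + fderiv ℝ ψ x := fderiv_add h1 h2
  simp only [gradient, Pi.add_apply, h3, map_add]

theorem gradient_test_smul (c : ℝ) (φ : 𝓓(Ω, ℝ)) :
    gradient (⇑(c • φ)) = c • gradient φ := by
  funext x
  have h1 : DifferentiableAt ℝ φ x := (φ.contDiff.differentiable (by simp)) x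
  have h3 : fderiv ℝ (⇑(c • φ)) x = c • fderiv ℝ φ x := fderiv_const_smul h1 c
  rw [Pi.smul_apply]
  simp only [gradient, h3, map_smul]

theorem exists_norm_gradient_le (φ : 𝓓(Ω, ℝ)) : ∃ M : ℝ, 0 ≤ M ∧ ∀ x, ‖gradient φ x‖ ≤ M := by
  obtain ⟨M, hM⟩ := (gradient_hasCompactSupport φ.hasCompactSupport).exists_bound_of_continuous
    (gradient_continuous φ.contDiff)
  exact ⟨M, (norm_nonneg _).trans (hM 0), hM⟩

theorem integrable_inner_gradient {F : Plane → Plane} (hF : Integrable F (volumeOn Ω))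
    (φ : 𝓓(Ω, ℝ)) : Integrable (fun x => inner ℝ (F x) (gradient φ x)) (volumeOn Ω) := by
  obtain ⟨M, hM0, hM⟩ := exists_norm_gradient_le φ
  refine (hF.norm.mul_const M).mono'
    (hF.1.inner (gradient_continuous φ.contDiff).aestronglyMeasurable)
    (Eventually.of_forall fun x => ?_)
  exact (norm_inner_le_norm _ _).trans (by gcongr; exact hM x)

/-- Solenoidal fields do no work: `∫ φ a · ∇φ = 0`. -/
theorem IsSolenoidal.integral_mul_inner_gradient_eq_zero (ha : IsSolenoidal Ω a) (φ : 𝓓(Ω, ℝ)) :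
    ∫ x in (Ω : Set Plane), φ x * inner ℝ (a x) (gradient φ x) = 0 := by
  -- Test div a = 0 with φ², whose gradient is 2φ∇φ.
  let ψ : 𝓓(Ω, ℝ) := ⟨fun x => φ x * φ x, φ.contDiff.mul φ.contDiff,
    φ.hasCompactSupport.mul_left, (tsupport_mul_subset_left).trans φ.tsupport_subset⟩
  have h1 : ∀ x, gradient ψ x = (2 * φ x) • gradient φ x := by
    intro x
    have hd : DifferentiableAt ℝ φ x := (φ.contDiff.differentiable (by simp)) x
    have h2 : fderiv ℝ ψ x = φ x • fderiv ℝ φ x + φ x • fderiv ℝ φ x := fderiv_fun_mul hd hd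
    simp only [gradient, h2, map_add, map_smul, two_mul, add_smul]
  have h2 := ha.div_eq_zero ψ
  simp only [h1, inner_smul_right, mul_assoc] at h2
  rw [integral_const_mul] at h2
  linarith

theorem integrable_gradOf (hΩ : IsBoundedLipschitzDomain Ω) (u : W012 Ω) :
    Integrable (gradOf u) (volumeOn Ω) :=
  haveI := isFiniteMeasure_volumeOn hΩ
  (Lp.memLp (gradOf u)).integrable (by norm_num)

theorem integrable_valueOf (hΩ : IsBoundedLipschitzDomain Ω) (u : W012 Ω) :
    Integrable (valueOf u) (volumeOn Ω) :=
  haveI := isFiniteMeasure_volumeOn hΩ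
  (Lp.memLp (valueOf u)).integrable (by norm_num)

theorem integrable_valueOf_smul (ha : Integrable a (volumeOn Ω)) {K : ℝ}
    (hK : ∀ u : W012 Ω, ∫⁻ x, ‖valueOf u x‖ₑ * ‖a x‖ₑ ∂(volumeOn Ω) ≤ ENNReal.ofReal (K * ‖u‖))
    (u : W012 Ω) : Integrable (fun x => valueOf u x • a x) (volumeOn Ω) := by
  have hm : AEStronglyMeasurable (fun x => valueOf u x • a x) (volumeOn Ω) :=
    (Lp.aestronglyMeasurable (valueOf u)).smul ha.1
  refine ⟨hm, ?_⟩
  simp only [HasFiniteIntegral, enorm_smul]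
  exact (hK u).trans_lt ENNReal.ofReal_lt_top

/-- The weak form of the equation splits into the gradient part and the drift part. -/
theorem integral_weak_form_eq (hΩ : IsBoundedLipschitzDomain Ω) {u : W012 Ω}
    (hu : Integrable (fun x => valueOf u x • a x) (volumeOn Ω)) (φ : 𝓓(Ω, ℝ)) :
    ∫ x in (Ω : Set Plane), inner ℝ (gradOf u x + valueOf u x • a x) (gradient φ x) =
      inner ℝ (gradOf u) (gradOf (ofTest φ)) +
        ∫ x in (Ω : Set Plane), valueOf u x * inner ℝ (a x) (gradient φ x) := by
  rw [inner_gradOf_ofTest]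
  simp only [inner_add_left]
  rw [integral_add (integrable_inner_gradient (integrable_gradOf hΩ u) φ)
    (integrable_inner_gradient hu φ)]
  simp only [real_inner_smul_left]

/-- Lions' theorem with test functions as test vectors: their gradients are bounded, so the L¹ bound
on a u makes the form continuous in u, and on the diagonal the drift drops out. -/
theorem exists_isSolution (hΩ : IsBoundedLipschitzDomain Ω) (ha : IsSolenoidal Ω a) {K : ℝ}
    (hK0 : 0 ≤ K)
    (hK : ∀ u : W012 Ω, ∫⁻ x, ‖valueOf u x‖ₑ * ‖a x‖ₑ ∂(volumeOn Ω) ≤ ENNReal.ofReal (K * ‖u‖))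
    (f : WNeg12 Ω) : ∃ u : W012 Ω, IsSolution Ω a f u := by
  have hint := fun u => integrable_valueOf_smul ha.integrable hK u
  have hFint : ∀ u : W012 Ω, Integrable (fun x => gradOf u x + valueOf u x • a x) (volumeOn Ω) :=
    fun u => (integrable_gradOf hΩ u).add (hint u)
  have hP := fun u φ => integrable_inner_gradient (hFint u) φ
  let P : 𝓓(Ω, ℝ) →ₗ[ℝ] W012 Ω →ₗ[ℝ] ℝ := LinearMap.mk₂ ℝ
    (fun φ u => ∫ x in (Ω : Set Plane),
      inner ℝ (gradOf u x + valueOf u x • a x) (gradient φ x))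
    (fun φ ψ u => by
      rw [← integral_add (hP u φ) (hP u ψ)]
      simp only [gradient_test_add, Pi.add_apply, inner_add_right])
    (fun c φ u => by
      rw [smul_eq_mul, ← integral_const_mul]
      simp only [gradient_test_smul, Pi.smul_apply, inner_smul_right])
    (fun φ u v => by
      rw [← integral_add (hP u φ) (hP v φ)]
      refine integral_congr_ae ?_
      filter_upwards [Lp.coeFn_add (gradOf u) (gradOf v), Lp.coeFn_add (valueOf u) (valueOf v)]
        with x hx hx'
      rw [gradOf_add, valueOf_add, hx, hx', Pi.add_apply, Pi.add_apply, ← inner_add_left, add_smul,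
        add_add_add_comm])
    (fun c φ u => by
      rw [smul_eq_mul, ← integral_const_mul]
      refine integral_congr_ae ?_
      filter_upwards [Lp.coeFn_smul c (gradOf u), Lp.coeFn_smul c (valueOf u)] with x hx hx'
      rw [gradOf_smul, valueOf_smul, hx, hx', Pi.smul_apply, Pi.smul_apply, smul_eq_mul, mul_smul,
        ← smul_add, real_inner_smul_left])
  have hPeq : ∀ φ u, P φ u = inner ℝ (gradOf u) (gradOf (ofTest φ)) +
        ∫ x in (Ω : Set Plane), valueOf u x * inner ℝ (a x) (gradient φ x) := fun φ u =>
    integral_weak_form_eq hΩ (hint u) φ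
  have hbound : ∀ φ, ∃ C : ℝ, ∀ u, ‖P φ u‖ ≤ C * ‖u‖ := by
    intro φ
    obtain ⟨M, hM0, hM⟩ := exists_norm_gradient_le φ
    refine ⟨‖gradOf (ofTest φ)‖ + M * K, fun u => ?_⟩
    have h1 : ‖∫ x in (Ω : Set Plane), valueOf u x * inner ℝ (a x) (gradient φ x)‖ ≤
        M * (K * ‖u‖) := by
      have h2 : ‖∫ x in (Ω : Set Plane), valueOf u x * inner ℝ (a x) (gradient φ x)‖ₑ ≤
          ENNReal.ofReal (M * (K * ‖u‖)) := by
        refine (enorm_integral_le_lintegral_enorm _).trans ?_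
        rw [ENNReal.ofReal_mul hM0]
        refine le_trans ?_ (mul_le_mul_right (hK u) _)
        rw [← lintegral_const_mul' _ _ ENNReal.ofReal_ne_top]
        refine lintegral_mono fun x => ?_
        dsimp only
        rw [enorm_mul, mul_left_comm]
        gcongr
        rw [← ofReal_norm, ← ofReal_norm, ← ENNReal.ofReal_mul hM0]
        refine ENNReal.ofReal_le_ofReal ((norm_inner_le_norm _ _).trans ?_)
        rw [mul_comm]
        gcongr
        exact hM x
      rwa [← ofReal_norm, ENNReal.ofReal_le_ofReal_iff (by positivity)] at h2
    rw [hPeq]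
    calc _ ≤ ‖gradOf u‖ * ‖gradOf (ofTest φ)‖ + M * (K * ‖u‖) :=
          (norm_add_le _ _).trans (add_le_add (norm_inner_le_norm _ _) h1)
      _ ≤ ‖u‖ * ‖gradOf (ofTest φ)‖ + M * (K * ‖u‖) := by
          gcongr
          exact norm_gradOf_le u
      _ = _ := by ring
  let B : 𝓓(Ω, ℝ) →ₗ[ℝ] StrongDual ℝ (W012 Ω) :=
    { toFun := fun φ => (P φ).mkContinuousOfExistsBound (hbound φ)
      map_add' := fun φ ψ => by ext u; simp
      map_smul' := fun c φ => by ext u; simp }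
  let ι : 𝓓(Ω, ℝ) →ₗ[ℝ] W012 Ω := (testPair Ω).codRestrict (W012 Ω) fun φ => (ofTest φ).2
  have hι : ∀ φ, ι φ = ofTest φ := fun φ => rfl
  obtain ⟨L, hL0, hL⟩ := hΩ.exists_norm_valueOf_le
  -- By Poincaré the full squared norm is at most (1 + L) ‖∇φ‖².
  have hcoer : ∀ φ, (1 + L)⁻¹ * ‖ι φ‖ ^ 2 ≤ B φ (ι φ) := by
    intro φ
    have h1 : B φ (ι φ) = ‖gradOf (ofTest φ)‖ ^ 2 := by
      have h2 : B φ (ι φ) = P φ (ofTest φ) := rfl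
      rw [h2, hPeq, real_inner_self_eq_norm_sq, add_eq_left,
        ← ha.integral_mul_inner_gradient_eq_zero φ]
      refine integral_congr_ae ?_
      filter_upwards [valueOf_ofTest φ] with x hx
      rw [hx]
    rw [h1, hι, norm_sq_eq, inv_mul_le_iff₀ (by positivity)]
    linarith [hL (ofTest φ)]
  obtain ⟨u, hu⟩ := exists_forall_apply_eq_of_coercive B ι (by positivity) hcoer f
  exact ⟨u, hint u, fun φ => hu φ⟩

/-- Dominated convergence: at a given point the bad-set term disappears once s_k ≥ n(x), and √(log
n) ≤ 1 + n is integrable since n is in L² and Ω is bounded. -/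
theorem tendsto_integral_mul_of_truncation (hΩ : IsBoundedLipschitzDomain Ω) {u : W012 Ω}
    {n : Plane → ℝ} (hn : Measurable n) (hn0 : ∀ x, 0 ≤ n x)
    (hn2 : ∫⁻ x, ENNReal.ofReal (n x) ^ 2 ≠ ⊤) {A B : ℝ} (hA : 0 ≤ A) (hB : 0 ≤ B)
    {s η : ℕ → ℝ} (hs : Tendsto s atTop atTop) (hη : Tendsto η atTop (𝓝 0))
    (hη1 : ∀ k, η k ≤ 1) {φ : ℕ → 𝓓(Ω, ℝ)}
    (hφ : ∀ k, ∀ᵐ x, |φ k x - extendZero u x| ≤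
      η k + {x | s k < n x}.indicator (fun x => A + B * Real.sqrt (Real.log (n x))) x)
    {L : Plane → ℝ} (hL : Continuous L) (hLs : HasCompactSupport L) :
    Tendsto (fun k => ∫ x in (Ω : Set Plane), φ k x * L x) atTop
      (𝓝 (∫ x in (Ω : Set Plane), valueOf u x * L x)) := by
  have := isFiniteMeasure_volumeOn hΩ
  obtain ⟨M, hM⟩ := hLs.exists_bound_of_continuous hL
  have hM0 : 0 ≤ M := (norm_nonneg _).trans (hM 0)
  have hnint : Integrable n (volumeOn Ω) := by
    have h2 : MemLp n 2 (volumeOn Ω) := by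
      refine ⟨hn.aestronglyMeasurable, ?_⟩
      rw [eLpNorm_eq_lintegral_rpow_enorm_toReal (by norm_num) (by norm_num)]
      refine ENNReal.rpow_lt_top_of_nonneg (by positivity) ?_
      refine ne_top_of_le_ne_top hn2 ((setLIntegral_le_lintegral _ _).trans_eq ?_)
      refine lintegral_congr fun x => ?_
      rw [Real.enorm_of_nonneg (hn0 x)]
      simp
    exact h2.integrable (by norm_num)
  have hφ' : ∀ᵐ x ∂(volumeOn Ω), ∀ k, |φ k x - extendZero u x| ≤
      η k + {x | s k < n x}.indicator (fun x => A + B * Real.sqrt (Real.log (n x))) x :=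
    ae_all_iff.2 fun k => ae_volumeOn_of_ae (hφ k)
  refine tendsto_integral_of_dominated_convergence
    (fun x => (1 + (A + B * (1 + n x)) + |valueOf u x|) * M)
    (fun k => ((φ k).continuous.mul hL).aestronglyMeasurable) ?_ (fun k => ?_) ?_
  · exact ((((integrable_const _).add ((integrable_const _).add
      (((integrable_const _).add hnint).const_mul B))).add
      (integrable_valueOf hΩ u).abs).mul_const M)
  · filter_upwards [hφ', extendZero_ae_eq u] with x hx hxu
    have h1 := hx k
    rw [hxu] at h1
    have h2 : {x | s k < n x}.indicator (fun x => A + B * Real.sqrt (Real.log (n x))) x ≤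
        A + B * (1 + n x) := by
      have h3 : Real.sqrt (Real.log (n x)) ≤ 1 + n x := by
        refine Real.sqrt_le_iff.2 ⟨by linarith [hn0 x], ?_⟩
        nlinarith [Real.log_le_self (hn0 x), hn0 x]
      have h4 : 0 ≤ A + B * (1 + n x) := by have := hn0 x; positivity
      by_cases hxs : s k < n x
      · rw [indicator_of_mem (by exact hxs)]
        gcongr
      · rw [indicator_of_notMem (by exact hxs)]
        exact h4
    have h3 : |φ k x| ≤ |φ k x - valueOf u x| + |valueOf u x| := by
      simpa using abs_add_le (φ k x - valueOf u x) (valueOf u x)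
    rw [norm_mul, Real.norm_eq_abs]
    exact mul_le_mul (by linarith [hη1 k]) (hM x) (norm_nonneg _)
      (by have := hn0 x; positivity)
  · filter_upwards [hφ', extendZero_ae_eq u] with x hx hxu
    refine Tendsto.mul_const _ ?_
    rw [← hxu, tendsto_iff_dist_tendsto_zero]
    refine squeeze_zero' (Eventually.of_forall fun _ => dist_nonneg) ?_ hη
    filter_upwards [hs.eventually_ge_atTop (n x)] with k hk
    have h1 := hx k
    rw [indicator_of_notMem (by exact not_lt.2 hk), add_zero] at h1
    exact h1

/-- The homogeneous equation has only the trivial solution. -/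
theorem gradOf_eq_zero_of_homogeneous (hΩ : IsBoundedLipschitzDomain Ω) (ha : IsSolenoidal Ω a)
    (hlim : Tendsto
      (fun ε : ℝ => ENNReal.ofReal (Real.sqrt ε) * eLpNorm a (ENNReal.ofReal (2 - ε)) (volumeOn Ω))
      (𝓝[>] 0) (𝓝 0)) {u : W012 Ω}
    (hu : Integrable (fun x => valueOf u x • a x) (volumeOn Ω))
    (heq : ∀ φ : 𝓓(Ω, ℝ), ∫ x in (Ω : Set Plane),
      inner ℝ (gradOf u x + valueOf u x • a x) (gradient φ x) = 0) :
    gradOf u = 0 := by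
  obtain ⟨C, A, B, K, n, hA, hB, hK, hn, hn0, hn2, htrunc⟩ := hΩ.exists_lipschitz_truncation u
  have hn2' : ∫⁻ x, ENNReal.ofReal (n x) ^ 2 ∂(volumeOn Ω) ≠ ⊤ :=
    ne_top_of_le_ne_top hn2 (setLIntegral_le_lintegral _ _)
  set δ : ℕ → ℝ := fun k => 1 / ((k : ℝ) + 1) with hδ
  have hδ0 : ∀ k, 0 < δ k := fun k => by positivity
  have hδ1 : ∀ k, δ k ≤ 1 := fun k => by
    rw [hδ]
    exact (div_le_one (by positivity)).2 (by linarith [(Nat.cast_nonneg k : (0 : ℝ) ≤ k)])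
  have hδlim : Tendsto δ atTop (𝓝 0) := tendsto_one_div_add_atTop_nhds_zero_nat
  have hex := fun k : ℕ => exists_mul_lintegral_superlevel_lt ha.integrable.1 hn hn2' hlim hA hB
    (c := ENNReal.ofReal (δ k)) (by simpa using hδ0 k) (s₀ := (k : ℝ) + 1)
    (by linarith [(Nat.cast_nonneg k : (0 : ℝ) ≤ k)])
  choose s hsk hsΦ using hex
  have hs1 : ∀ k, 1 ≤ s k := fun k => le_trans (by linarith [(Nat.cast_nonneg k : (0 : ℝ) ≤ k)])
    (hsk k)
  have hs0 : ∀ k, 0 < s k := fun k => one_pos.trans_le (hs1 k)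
  have hs_lim : Tendsto s atTop atTop := tendsto_atTop_mono hsk
    (tendsto_atTop_add_const_right _ _ tendsto_natCast_atTop_atTop)
  -- The accuracy δ_k/s_k offsets the gradient bound C s_k, leaving a contribution of order δ_k
  -- ‖a‖₁.
  choose φ hφL hφK hφu using fun k => htrunc (s k) (hs1 k) (δ k / s k)
    (div_pos (hδ0 k) (hs0 k))
  have hηδ : ∀ k, δ k / s k ≤ δ k := fun k => div_le_self (hδ0 k).le (hs1 k)
  have hweak := tendsto_inner_gradOf (u := u) (φ := φ) (K := Real.sqrt K.toReal)
    (fun k => by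
      have h1 : ‖gradOf (ofTest (φ k))‖ₑ ^ 2 ≤ K := by
        rw [← lintegral_gradEnorm_sq]
        refine le_trans (le_of_eq ?_) (hφK k)
        exact lintegral_congr_ae ((gradEnorm_ofTest (φ k)).fun_comp (· ^ 2))
      rw [← ofReal_norm, ← ENNReal.ofReal_pow (norm_nonneg _)] at h1
      exact Real.le_sqrt_of_sq_le ((ENNReal.ofReal_le_iff_le_toReal hK).1 h1))
    (fun L hL hLs => tendsto_integral_mul_of_truncation hΩ hn hn0 hn2 hA hB hs_lim
      (squeeze_zero (fun k => (div_pos (hδ0 k) (hs0 k)).le) hηδ hδlim)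
      (fun k => (hηδ k).trans (hδ1 k)) hφu hL hLs)
  have hsmall : ∀ k, ‖inner ℝ (gradOf (ofTest (φ k))) (gradOf u)‖ₑ ≤
      ENNReal.ofReal (δ k) * (C * (∫⁻ x, ‖a x‖ₑ ∂(volumeOn Ω) + 1)) := by
    intro k
    have h1 := heq (φ k)
    rw [integral_weak_form_eq hΩ hu] at h1
    have hi1 : Integrable (fun x => valueOf u x * inner ℝ (a x) (gradient (φ k) x))
        (volumeOn Ω) := by
      simpa only [real_inner_smul_left] using integrable_inner_gradient hu (φ k)
    have hi2 : Integrable (fun x => φ k x * inner ℝ (a x) (gradient (φ k) x)) (volumeOn Ω) := by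
      obtain ⟨M, hM⟩ := (φ k).hasCompactSupport.exists_bound_of_continuous (φ k).continuous
      exact (integrable_inner_gradient ha.integrable (φ k)).bdd_mul
        (φ k).continuous.aestronglyMeasurable (Eventually.of_forall hM)
    -- Adding ∫ φ a·∇φ = 0 replaces -u by φ - u, which is tiny off the bad set.
    have h2 : inner ℝ (gradOf (ofTest (φ k))) (gradOf u) = ∫ x in (Ω : Set Plane),
        (φ k x - valueOf u x) * inner ℝ (a x) (gradient (φ k) x) := by
      simp only [sub_mul]
      rw [integral_sub hi2 hi1, ha.integral_mul_inner_gradient_eq_zero, real_inner_comm]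
      linarith
    rw [h2]
    have hCs : 0 ≤ C * s k := mul_nonneg C.coe_nonneg (hs0 k).le
    set H : Plane → ℝ := fun x => A + B * Real.sqrt (Real.log (n x)) with hH
    have hH0 : ∀ x, 0 ≤ H x := fun x => by positivity
    calc ‖∫ x in (Ω : Set Plane), (φ k x - valueOf u x) * inner ℝ (a x) (gradient (φ k) x)‖ₑ
        ≤ ∫⁻ x, ‖(φ k x - valueOf u x) * inner ℝ (a x) (gradient (φ k) x)‖ₑ ∂(volumeOn Ω) :=
          enorm_integral_le_lintegral_enorm _
      _ ≤ ∫⁻ x, ENNReal.ofReal (C * s k) * (ENNReal.ofReal (δ k / s k) * ‖a x‖ₑ +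
            {x | s k < n x}.indicator (fun x => ‖a x‖ₑ * ENNReal.ofReal (H x)) x)
              ∂(volumeOn Ω) := by
          refine lintegral_mono_ae ?_
          filter_upwards [ae_volumeOn_of_ae (hφu k), extendZero_ae_eq u] with x hx hxu
          rw [hxu] at hx
          have h3 : ‖inner ℝ (a x) (gradient (φ k) x)‖ₑ ≤ ‖a x‖ₑ * ENNReal.ofReal (C * s k) := by
            rw [← ofReal_norm, ← ofReal_norm, ← ENNReal.ofReal_mul (norm_nonneg _)]
            refine ENNReal.ofReal_le_ofReal ((norm_inner_le_norm _ _).trans ?_)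
            gcongr
            exact hφL k x
          have h4 : ‖φ k x - valueOf u x‖ₑ ≤ ENNReal.ofReal (δ k / s k) +
              {x | s k < n x}.indicator (fun x => ENNReal.ofReal (H x)) x := by
            rw [← ofReal_norm, Real.norm_eq_abs]
            refine (ENNReal.ofReal_le_ofReal hx).trans (ENNReal.ofReal_add_le.trans ?_)
            gcongr
            by_cases hxs : s k < n x
            · rw [indicator_of_mem (by exact hxs), indicator_of_mem (by exact hxs)]
            · rw [indicator_of_notMem (by exact hxs)]
              simp
          rw [enorm_mul]
          refine (mul_le_mul' h4 h3).trans_eq ?_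
          by_cases hxs : s k < n x
          · rw [indicator_of_mem (by exact hxs), indicator_of_mem (by exact hxs)]
            ring
          · rw [indicator_of_notMem (by exact hxs), indicator_of_notMem (by exact hxs)]
            ring
      _ = ENNReal.ofReal (C * s k) * (ENNReal.ofReal (δ k / s k) * ∫⁻ x, ‖a x‖ₑ ∂(volumeOn Ω) +
            ∫⁻ x, {x | s k < n x}.indicator (fun x => ‖a x‖ₑ * ENNReal.ofReal (H x)) x
              ∂(volumeOn Ω)) := by
          rw [lintegral_const_mul' _ _ ENNReal.ofReal_ne_top,
            lintegral_add_left' (ha.integrable.1.enorm.const_mul _),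
            lintegral_const_mul' _ _ ENNReal.ofReal_ne_top]
      _ = C * (ENNReal.ofReal (s k) * ENNReal.ofReal (δ k / s k) *
            ∫⁻ x, ‖a x‖ₑ ∂(volumeOn Ω) + ENNReal.ofReal (s k) *
            ∫⁻ x, {x | s k < n x}.indicator (fun x => ‖a x‖ₑ * ENNReal.ofReal (H x)) x
              ∂(volumeOn Ω)) := by
          rw [ENNReal.ofReal_mul C.coe_nonneg, ENNReal.ofReal_coe_nnreal]
          ring
      _ ≤ C * (ENNReal.ofReal (δ k) * ∫⁻ x, ‖a x‖ₑ ∂(volumeOn Ω) + ENNReal.ofReal (δ k)) := by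
          rw [← ENNReal.ofReal_mul (hs0 k).le, mul_div_cancel₀ _ (hs0 k).ne']
          gcongr
          exact (hsΦ k).le
      _ = _ := by ring
  have hzero : Tendsto (fun k => ‖inner ℝ (gradOf (ofTest (φ k))) (gradOf u)‖ₑ) atTop (𝓝 0) := by
    have h1 : Tendsto (fun k => ENNReal.ofReal (δ k) * (C * (∫⁻ x, ‖a x‖ₑ ∂(volumeOn Ω) + 1)))
        atTop (𝓝 (ENNReal.ofReal 0 * (C * (∫⁻ x, ‖a x‖ₑ ∂(volumeOn Ω) + 1)))) :=
      ENNReal.Tendsto.mul_const (ENNReal.tendsto_ofReal hδlim) (Or.inr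
        (ENNReal.mul_ne_top ENNReal.coe_ne_top
          (ENNReal.add_ne_top.2 ⟨ha.integrable.2.ne, ENNReal.one_ne_top⟩)))
    rw [ENNReal.ofReal_zero, zero_mul] at h1
    exact tendsto_of_tendsto_of_tendsto_of_le_of_le tendsto_const_nhds h1 (fun _ => zero_le) hsmall
  have h1 := tendsto_nhds_unique hweak.enorm hzero
  simpa using h1

end Equation

end DriftDiffusion

theorem theorem2 (Ω : Opens Plane) (hΩ : IsBoundedLipschitzDomain Ω)
    (a : Plane → Plane) (ha : IsSolenoidal Ω a)
    (hlim : Tendsto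
      (fun ε : ℝ => ENNReal.ofReal (Real.sqrt ε) * eLpNorm a (ENNReal.ofReal (2 - ε)) (volumeOn Ω))
      (𝓝[>] 0) (𝓝 0))
    (f : WNeg12 Ω) :
    ∃! u : W012 Ω, IsSolution Ω a f u := by
  obtain ⟨K, hK0, hK⟩ := exists_lintegral_enorm_mul_le hΩ ha.integrable hlim
  obtain ⟨u, hu⟩ := exists_isSolution hΩ ha hK0 hK f
  refine ⟨u, hu, fun v hv => ?_⟩
  have hint := fun w => integrable_valueOf_smul ha.integrable hK w
  have hF : ∀ w : W012 Ω, Integrable (fun x => gradOf w x + valueOf w x • a x) (volumeOn Ω) :=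
    fun w => (integrable_gradOf hΩ w).add (hint w)
  have hgrad : gradOf (v - u) = 0 := by
    refine gradOf_eq_zero_of_homogeneous hΩ ha hlim (hint _) fun φ => ?_
    have h1 : ∫ x in (Ω : Set Plane),
        inner ℝ (gradOf (v - u) x + valueOf (v - u) x • a x) (gradient φ x) =
        ∫ x in (Ω : Set Plane), (inner ℝ (gradOf v x + valueOf v x • a x) (gradient φ x) -
          inner ℝ (gradOf u x + valueOf u x • a x) (gradient φ x)) := by
      refine integral_congr_ae ?_
      filter_upwards [Lp.coeFn_sub (gradOf v) (gradOf u), Lp.coeFn_sub (valueOf v) (valueOf u)]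
        with x hx hx'
      rw [gradOf_sub, valueOf_sub, hx, hx', Pi.sub_apply, Pi.sub_apply, ← inner_sub_left, sub_smul,
        add_sub_add_comm]
    rw [h1, integral_sub (integrable_inner_gradient (hF v) φ)
        (integrable_inner_gradient (hF u) φ),
      hv.integral_identity, hu.integral_identity, sub_self]
  -- A vanishing gradient forces the difference of the two solutions to vanish by Poincaré.
  obtain ⟨L, -, hL⟩ := hΩ.exists_norm_valueOf_le
  have hnorm := norm_sq_eq (v - u)
  have hval := hL (v - u)
  rw [hgrad] at hnorm hval
  simp only [norm_zero, ne_eq, OfNat.ofNat_ne_zero, not_false_eq_true, zero_pow, mul_zero,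
    add_zero] at hnorm hval
  have h2 : ‖v - u‖ ^ 2 ≤ 0 := hnorm.trans_le hval
  exact sub_eq_zero.1 (norm_eq_zero.1 (pow_eq_zero_iff (two_ne_zero)|>.1
    (le_antisymm h2 (by positivity))))
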